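/- Let $\mathbb K$ be a field of characteristic $0$ and let $A$, $B$ be $\mathbb Z$-graded differential graded Lie algebras over $\mathbb K$ with differentials $d_A$, $d_B$ of degree $+1$. For a graded vector space $V$ put $V[1]^n=V^{n+1}$, and let $\operatorname{Sym}(V[1])=\bigoplus_{n\ge 0}\operatorname{Sym}^n(V[1])$ be the graded symmetric coalgebra: $\operatorname{Sym}^n$ denotes coinvariants of the $n$-th tensor power for the action of $S_n$ with Koszul signs $\epsilon(\sigma)$, the product is written $\vee$, and the coproduct is the symmetrized deconcatenation. For a linear map $F$ between symmetric coalgebras write $F_n^j$ for its component $\operatorname{Sym}^n\to\operatorname{Sym}^j$. The codifferential $Q_A$ is the coderivation of $\operatorname{Sym}(A[1])$ with $Q_{A,1}^1=-d_A$, $Q_{A,2}^1(x\vee y)=-(-1)^{|x|}[x,y]$ ($|x|$ being the degree in $A[1]$) and no other structure maps; $Q_B$ is defined in the same way. Let $i\colon A\to B$, $p\colon B\to A$ be cochain maps of degree $0$ and $h\colon B\to B$ a linear map of degree $-1$ with $$h d_B+d_B h=\mathrm{id}_B-ip,\qquad p i=\mathrm{id}_A,\qquad h^2=0,\quad h i=0,\quad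 p h=0,$$ and assume that $i$ is a morphism of differential graded Lie algebras. For $n\ge1$ define operators on $\operatorname{Sym}^n(B[1])$ by $$\tilde H_n(x_1\vee\dots\vee x_n)=-\sum_{\sigma\in \mathrm{Sh}(1,n-1)}\epsilon(\sigma)\,h x_{\sigma(1)}\vee x_{\sigma(2)}\vee\dots\vee x_{\sigma(n)},$$ $$K_n(x_1\vee\dots\vee x_n)=\frac1{n!}\sum_{j=0}^{n-1}\sum_{\sigma\in S_n}\frac{\epsilon(\sigma)}{n-j}\,ipx_{\sigma(1)}\vee\dots\vee ipx_{\sigma(j)}\vee x_{\sigma(j+1)}\vee\dots\vee x_{\sigma(n)},$$ and $H_n=K_n\circ\tilde H_n$. For a linear map $F\colon\operatorname{Sym}(B[1])\to\operatorname{Sym}(A[1])$ and $k\ge1$ put $$L_{\infty,k+1}(F)=Q^1_{A,2}\circ F^2_{k+1}-F^1_k\circ Q^k_{B,k+1}\colon \operatorname{Sym}^{k+1}(B[1])\to A[1].$$ Then there is exactly one morphism $P\colon\operatorname{Sym}(B[1])\to\operatorname{Sym}(A[1])$ of counital graded coalgebras (of degree $0$, with $P(1)=1$) such that $$P_1^1=p,\qquad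 P_{k+1}^1=L_{\infty,k+1}(P)\circ H_{k+1}\quad(k\ge1).$$ It is an $L_\infty$-quasi-isomorphism, i.e. $P\circ Q_B=Q_A\circ P$ and $P_1^1$ is a quasi-isomorphism of complexes $(B[1],-d_B)\to(A[1],-d_A)$, and it is quasi-inverse to $i$: the coalgebra morphism $\operatorname{Sym}(i)\colon\operatorname{Sym}(A[1])\to\operatorname{Sym}(B[1])$ induced by $i$ is an $L_\infty$-quasi-isomorphism, and $P_1^1=p$ and $\operatorname{Sym}(i)_1^1=i$ induce mutually inverse isomorphisms in cohomology. Moreover $P\circ\operatorname{Sym}(i)=\mathrm{id}$. -/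

import Mathlib

open scoped TensorProduct

noncomputable section

namespace GradedCoalg

/-! ### Graded vector spaces

A graded vector space is a `K`-vector space `V` with a family `𝒱 : ℤ → Submodule K V` and an
instance `[DirectSum.Decomposition 𝒱]`, i.e. `V = ⨁ₙ 𝒱 n`. -/

/-- `f` is homogeneous of degree `r`, i.e. `f (𝒱 n) ⊆ 𝒲 (n + r)` for all `n`. -/
def HasDegree {K V W : Type*} [Field K] [AddCommGroup V] [Module K V] [AddCommGroup W] [Module K W]
    (𝒱 : ℤ → Submodule K V) (𝒲 : ℤ → Submodule K W) (r : ℤ) (f : V →ₗ[K] W) : Prop :=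
  ∀ n : ℤ, ∀ x ∈ 𝒱 n, f x ∈ 𝒲 (n + r)

/-- The grading of the shifted space `V[1]`, namely `V[1]ⁿ = Vⁿ⁺¹`. -/
def shift {K V : Type*} [Field K] [AddCommGroup V] [Module K V]
    (𝒱 : ℤ → Submodule K V) : ℤ → Submodule K V :=
  fun n => 𝒱 (n + 1)

theorem shift_isInternal {K V : Type*} [Field K] [AddCommGroup V] [Module K V]
    (𝒱 : ℤ → Submodule K V) [DirectSum.Decomposition 𝒱] : DirectSum.IsInternal (shift 𝒱) := by
  have h := (DirectSum.isInternal_submodule_iff_iSupIndep_and_iSup_eq_top 𝒱).1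
    (DirectSum.Decomposition.isInternal 𝒱)
  refine (DirectSum.isInternal_submodule_iff_iSupIndep_and_iSup_eq_top _).2 ⟨?_, ?_⟩
  · exact h.1.comp (f := fun n : ℤ => n + 1) (add_left_injective 1)
  · rw [← h.2]
    exact (Equiv.addRight (1 : ℤ)).iSup_comp (g := 𝒱)

instance shiftDecomposition {K V : Type*} [Field K] [AddCommGroup V] [Module K V]
    (𝒱 : ℤ → Submodule K V) [DirectSum.Decomposition 𝒱] : DirectSum.Decomposition (shift 𝒱) :=
  (shift_isInternal 𝒱).chooseDecomposition

theorem HasDegree.shift {K V W : Type*} [Field K] [AddCommGroup V] [Module K V] [AddCommGroup W]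
    [Module K W] {𝒱 : ℤ → Submodule K V} {𝒲 : ℤ → Submodule K W} {r : ℤ} {f : V →ₗ[K] W}
    (hf : HasDegree 𝒱 𝒲 r f) : HasDegree (shift 𝒱) (shift 𝒲) r f := fun n x hx => by
  have h := hf (n + 1) x hx
  rwa [add_right_comm] at h

/-! ### The graded symmetric algebra and its coproduct -/

section Symmetric

variable {K V W : Type*} [Field K] [AddCommGroup V] [Module K V] [AddCommGroup W] [Module K W]

/-- The relations `x ⊗ y = (-1)^{|x||y|} y ⊗ x` for homogeneous `x`, `y`. -/
inductive SymRel (𝒱 : ℤ → Submodule K V) : TensorAlgebra K V → TensorAlgebra K V → Prop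
  | swap (m n : ℤ) (x y : V) (hx : x ∈ 𝒱 m) (hy : y ∈ 𝒱 n) :
      SymRel 𝒱 (TensorAlgebra.ι K x * TensorAlgebra.ι K y)
        ((-1 : K) ^ (m * n) • (TensorAlgebra.ι K y * TensorAlgebra.ι K x))

/-- The graded symmetric algebra `Sym V = ⨁ₙ Symⁿ V`, where `Symⁿ V` is the space of coinvariants
of `V^{⊗n}` for the action of the symmetric group with Koszul signs (these coinvariants are the
quotient by the relations for adjacent transpositions). Its product is `∨`. -/
def GSym (𝒱 : ℤ → Submodule K V) : Type _ := RingQuot (SymRel 𝒱)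

instance instRingGSym (𝒱 : ℤ → Submodule K V) : Ring (GSym 𝒱) :=
  inferInstanceAs (Ring (RingQuot (SymRel 𝒱)))

instance instAlgebraGSym (𝒱 : ℤ → Submodule K V) : Algebra K (GSym 𝒱) :=
  inferInstanceAs (Algebra K (RingQuot (SymRel 𝒱)))

/-- The inclusion `V = Sym¹ V → Sym V`. -/
def gen (𝒱 : ℤ → Submodule K V) : V →ₗ[K] GSym 𝒱 :=
  (RingQuot.mkAlgHom K (SymRel 𝒱)).toLinearMap ∘ₗ TensorAlgebra.ι K

theorem gen_mul_gen (𝒱 : ℤ → Submodule K V) {m n : ℤ} {x y : V} (hx : x ∈ 𝒱 m) (hy : y ∈ 𝒱 n) :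
    gen 𝒱 x * gen 𝒱 y = (-1 : K) ^ (m * n) • (gen 𝒱 y * gen 𝒱 x) := by
  have h := RingQuot.mkAlgHom_rel K (SymRel.swap (𝒱 := 𝒱) m n x y hx hy)
  rw [map_mul, map_smul, map_mul] at h
  exact h

/-- The universal property of `Sym V`. -/
def lift (𝒱 : ℤ → Submodule K V) {R : Type*} [Ring R] [Algebra K R] (f : V →ₗ[K] R)
    (hf : ∀ (m n : ℤ) (x y : V), x ∈ 𝒱 m → y ∈ 𝒱 n →
      f x * f y = (-1 : K) ^ (m * n) • (f y * f x)) : GSym 𝒱 →ₐ[K] R :=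
  RingQuot.liftAlgHom K ⟨TensorAlgebra.lift K f, by
    rintro _ _ ⟨m, n, x, y, hx, hy⟩
    simpa using hf m n x y hx hy⟩

@[simp]
theorem lift_gen (𝒱 : ℤ → Submodule K V) {R : Type*} [Ring R] [Algebra K R] (f : V →ₗ[K] R)
    (hf : ∀ (m n : ℤ) (x y : V), x ∈ 𝒱 m → y ∈ 𝒱 n →
      f x * f y = (-1 : K) ^ (m * n) • (f y * f x)) (x : V) : lift 𝒱 f hf (gen 𝒱 x) = f x := by
  change RingQuot.liftAlgHom K _ (RingQuot.mkAlgHom K (SymRel 𝒱) (TensorAlgebra.ι K x)) = f x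
  rw [RingQuot.liftAlgHom_mkAlgHom_apply, TensorAlgebra.lift_ι_apply]

theorem gsym_hom_ext {𝒱 : ℤ → Submodule K V} {R : Type*} [Ring R] [Algebra K R]
    {f g : GSym 𝒱 →ₐ[K] R} (h : ∀ x, f (gen 𝒱 x) = g (gen 𝒱 x)) : f = g := by
  refine RingQuot.ringQuot_ext' K _ _ (TensorAlgebra.hom_ext (LinearMap.ext fun x => ?_))
  exact h x

/-- The algebra morphism `Sym f : Sym V → Sym W`, `x₁ ∨ ⋯ ∨ xₙ ↦ f x₁ ∨ ⋯ ∨ f xₙ`, induced by a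
linear map `f` of degree `0`. -/
def symMap {𝒱 : ℤ → Submodule K V} {𝒲 : ℤ → Submodule K W} (f : V →ₗ[K] W)
    (hf : HasDegree 𝒱 𝒲 0 f) : GSym 𝒱 →ₐ[K] GSym 𝒲 :=
  lift 𝒱 (gen 𝒲 ∘ₗ f) fun m n x y hx hy => by
    have h1 := hf m x hx
    have h2 := hf n y hy
    rw [add_zero] at h1 h2
    exact gen_mul_gen 𝒲 h1 h2

/-- `Symⁿ V` as a subspace of `Sym V`: the span of the products of `n` elements of `V`. -/
def symPow (𝒱 : ℤ → Submodule K V) (n : ℕ) : Submodule K (GSym 𝒱) :=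
  LinearMap.range (gen 𝒱) ^ n

/-- The algebra morphism `Sym V → (Sym V)[t]`, `x₁ ∨ ⋯ ∨ xₙ ↦ (x₁ ∨ ⋯ ∨ xₙ) tⁿ`. -/
def weight (𝒱 : ℤ → Submodule K V) : GSym 𝒱 →ₐ[K] Polynomial (GSym 𝒱) :=
  lift 𝒱 ((Polynomial.monomial 1).restrictScalars K ∘ₗ gen 𝒱) fun m n x y hx hy => by
    simp only [LinearMap.comp_apply, LinearMap.restrictScalars_apply,
      Polynomial.monomial_mul_monomial]
    rw [gen_mul_gen 𝒱 hx hy, Polynomial.smul_monomial]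

/-- The projection `Sym V → Symⁿ V ⊆ Sym V`. -/
def proj (𝒱 : ℤ → Submodule K V) (n : ℕ) : GSym 𝒱 →ₗ[K] GSym 𝒱 :=
  (Polynomial.lcoeff (GSym 𝒱) n).restrictScalars K ∘ₗ (weight 𝒱).toLinearMap

theorem weight_of_mem (𝒱 : ℤ → Submodule K V) (m : ℕ) (x : GSym 𝒱) (hx : x ∈ symPow 𝒱 m) :
    weight 𝒱 x = Polynomial.monomial m x := by
  induction m generalizing x with
  | zero =>
    rw [symPow, pow_zero, Submodule.mem_one] at hx
    obtain ⟨c, rfl⟩ := hx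
    rw [AlgHom.commutes]
    rfl
  | succ m ih =>
    rw [symPow, pow_succ] at hx
    refine Submodule.mul_induction_on hx ?_ ?_
    · rintro a ha _ ⟨v, rfl⟩
      rw [map_mul, ih a ha]
      simp only [weight, lift_gen, LinearMap.comp_apply, LinearMap.restrictScalars_apply,
        Polynomial.monomial_mul_monomial]
    · intro a b ha hb
      rw [map_add, ha, hb, map_add]

theorem proj_of_mem (𝒱 : ℤ → Submodule K V) (m n : ℕ) (x : GSym 𝒱) (hx : x ∈ symPow 𝒱 m) :
    proj 𝒱 n x = if m = n then x else 0 := by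
  simp [proj, weight_of_mem 𝒱 m x hx, Polynomial.coeff_monomial]

/-- The subspace of `Sym V` of elements of total degree `n`, spanned by the products
`x₁ ∨ ⋯ ∨ xₖ` of homogeneous elements with `|x₁| + ⋯ + |xₖ| = n`. -/
def totalDegree (𝒱 : ℤ → Submodule K V) (n : ℤ) : Submodule K (GSym 𝒱) :=
  Submodule.span K {z | ∃ l : List (Σ m : ℤ, 𝒱 m),
    (l.map fun x => x.1).sum = n ∧ (l.map fun x => gen 𝒱 (x.2 : V)).prod = z}

/-- The augmentation and the projection to `Sym¹ V = V` together, as the algebra morphism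
`Sym V → K ⊕ V` onto the square-zero extension. -/
def trunc (𝒱 : ℤ → Submodule K V) :
    letI : Module Kᵐᵒᵖ V := Module.compHom _ ((RingHom.id K).fromOpposite mul_comm)
    haveI : IsCentralScalar K V := ⟨fun _ _ => rfl⟩
    GSym 𝒱 →ₐ[K] TrivSqZeroExt K V :=
  letI : Module Kᵐᵒᵖ V := Module.compHom _ ((RingHom.id K).fromOpposite mul_comm)
  haveI : IsCentralScalar K V := ⟨fun _ _ => rfl⟩
  lift 𝒱 (TrivSqZeroExt.inrHom K V) fun m n x y _ _ => by
    simp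

/-- The counit `ε : Sym V → K`, the projection to `Sym⁰ V = K`. -/
def counit (𝒱 : ℤ → Submodule K V) : GSym 𝒱 →ₗ[K] K :=
  letI : Module Kᵐᵒᵖ V := Module.compHom _ ((RingHom.id K).fromOpposite mul_comm)
  haveI : IsCentralScalar K V := ⟨fun _ _ => rfl⟩
  (TrivSqZeroExt.fstHom K K V).toLinearMap ∘ₗ (trunc 𝒱).toLinearMap

/-- The projection `Sym V → Sym¹ V = V` to the cogenerators. -/
def cogen (𝒱 : ℤ → Submodule K V) : GSym 𝒱 →ₗ[K] V :=
  letI : Module Kᵐᵒᵖ V := Module.compHom _ ((RingHom.id K).fromOpposite mul_comm)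
  haveI : IsCentralScalar K V := ⟨fun _ _ => rfl⟩
  TrivSqZeroExt.sndHom K V ∘ₗ (trunc 𝒱).toLinearMap

@[simp]
theorem counit_one (𝒱 : ℤ → Submodule K V) : counit 𝒱 1 = 1 := by
  let : Module Kᵐᵒᵖ V := Module.compHom _ ((RingHom.id K).fromOpposite mul_comm)
  have : IsCentralScalar K V := ⟨fun _ _ => rfl⟩
  exact congrArg TrivSqZeroExt.fst (map_one (trunc 𝒱))

@[simp]
theorem cogen_one (𝒱 : ℤ → Submodule K V) : cogen 𝒱 1 = 0 := by
  let : Module Kᵐᵒᵖ V := Module.compHom _ ((RingHom.id K).fromOpposite mul_comm)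
  have : IsCentralScalar K V := ⟨fun _ _ => rfl⟩
  exact congrArg TrivSqZeroExt.snd (map_one (trunc 𝒱))

@[simp]
theorem counit_gen_mul (𝒱 : ℤ → Submodule K V) (x : V) (z : GSym 𝒱) :
    counit 𝒱 (gen 𝒱 x * z) = 0 := by
  simp [counit, trunc]

@[simp]
theorem cogen_gen_mul (𝒱 : ℤ → Submodule K V) (x : V) (z : GSym 𝒱) :
    cogen 𝒱 (gen 𝒱 x * z) = counit 𝒱 z • x := by
  let : Module Kᵐᵒᵖ V := Module.compHom _ ((RingHom.id K).fromOpposite mul_comm)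
  have : IsCentralScalar K V := ⟨fun _ _ => rfl⟩
  simp [cogen, counit, trunc]

@[simp]
theorem cogen_gen (𝒱 : ℤ → Submodule K V) (x : V) : cogen 𝒱 (gen 𝒱 x) = x := by
  simpa using cogen_gen_mul 𝒱 x 1

/-- The component `Fⁱₙ : Symⁿ V → Symⁱ W` of `F : Sym V → Sym W` (extended by `0`). -/
def component {𝒱 : ℤ → Submodule K V} {𝒲 : ℤ → Submodule K W}
    (F : GSym 𝒱 →ₗ[K] GSym 𝒲) (n i : ℕ) : GSym 𝒱 →ₗ[K] GSym 𝒲 :=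
  proj 𝒲 i ∘ₗ F ∘ₗ proj 𝒱 n

/-- The component `F¹ₙ : Symⁿ V → W` of `F : Sym V → Sym W` (extended by `0` to `Sym V`), where
`Sym¹ W` is identified with `W`. -/
def taylor {𝒱 : ℤ → Submodule K V} {𝒲 : ℤ → Submodule K W}
    (F : GSym 𝒱 →ₗ[K] GSym 𝒲) (n : ℕ) : GSym 𝒱 →ₗ[K] W :=
  cogen 𝒲 ∘ₗ component F n 1

/-- The linear part `F¹₁ : V → W` of `F : Sym V → Sym W`. -/
def linearPart {𝒱 : ℤ → Submodule K V} {𝒲 : ℤ → Submodule K W}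
    (F : GSym 𝒱 →ₗ[K] GSym 𝒲) : V →ₗ[K] W :=
  taylor F 1 ∘ₗ gen 𝒱

variable (𝒱 : ℤ → Submodule K V) [DirectSum.Decomposition 𝒱]

/-- The linear map on `V` acting on `𝒱 m` as `(-1)^{nm}`. -/
def degSign (n : ℤ) : V →ₗ[K] V :=
  DirectSum.toModule K ℤ V (fun m => (-1 : K) ^ (n * m) • (𝒱 m).subtype) ∘ₗ
    (DirectSum.decomposeLinearEquiv 𝒱).toLinearMap

theorem degSign_of_mem (n : ℤ) {m : ℤ} {x : V} (hx : x ∈ 𝒱 m) :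
    degSign 𝒱 n x = (-1 : K) ^ (n * m) • x := by
  lift x to 𝒱 m using hx
  simp [degSign, DirectSum.toModule_lof]

theorem degSign_hasDegree (n : ℤ) : HasDegree 𝒱 𝒱 0 (degSign 𝒱 n) := fun m x hx => by
  rw [degSign_of_mem 𝒱 n hx, add_zero]
  exact (𝒱 m).smul_mem _ hx

/-- The algebra morphism of `Sym V` acting on elements of total degree `m` as `(-1)^{nm}`. -/
def twist (n : ℤ) : GSym 𝒱 →ₐ[K] GSym 𝒱 :=
  symMap (degSign 𝒱 n) (degSign_hasDegree 𝒱 n)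

theorem twist_gen (n : ℤ) {m : ℤ} {x : V} (hx : x ∈ 𝒱 m) :
    twist 𝒱 n (gen 𝒱 x) = (-1 : K) ^ (n * m) • gen 𝒱 x := by
  simp [twist, symMap, degSign_of_mem 𝒱 n hx]

theorem twist_twist (m n : ℤ) (z : GSym 𝒱) : twist 𝒱 m (twist 𝒱 n z) = twist 𝒱 n (twist 𝒱 m z) := by
  have h : (twist 𝒱 m).comp (twist 𝒱 n) = (twist 𝒱 n).comp (twist 𝒱 m) := by
    refine gsym_hom_ext fun x => ?_
    induction x using DirectSum.Decomposition.inductionOn 𝒱 with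
    | zero => simp
    | homogeneous x =>
      simp only [AlgHom.comp_apply, twist_gen 𝒱 _ x.2, map_smul]
      rw [smul_comm]
    | add x y hx hy => simp only [map_add, hx, hy]
  exact DFunLike.congr_fun h z

/-- The action of `v ∈ V` on `Sym V ⊗ Sym V` by left multiplication with `v ⊗ 1 + 1 ⊗ v`, with
Koszul sign: for `v` of degree `m`, `a ⊗ b ↦ (v ∨ a) ⊗ b + (-1)^{m|a|} a ⊗ (v ∨ b)`. -/
def primAct : V →ₗ[K] Module.End K (GSym 𝒱 ⊗[K] GSym 𝒱) :=
  DirectSum.toModule K ℤ _ (fun m =>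
    ((TensorProduct.mapBilinear (RingHom.id K) (GSym 𝒱) (GSym 𝒱) (GSym 𝒱) (GSym 𝒱)).flip LinearMap.id ∘ₗ
        LinearMap.mul K (GSym 𝒱) ∘ₗ gen 𝒱 +
      (TensorProduct.mapBilinear (RingHom.id K) (GSym 𝒱) (GSym 𝒱) (GSym 𝒱) (GSym 𝒱)) (twist 𝒱 m).toLinearMap ∘ₗ
        LinearMap.mul K (GSym 𝒱) ∘ₗ gen 𝒱) ∘ₗ (𝒱 m).subtype) ∘ₗ
    (DirectSum.decomposeLinearEquiv 𝒱).toLinearMap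

theorem primAct_of_mem {m : ℤ} {v : V} (hv : v ∈ 𝒱 m) (a b : GSym 𝒱) :
    primAct 𝒱 v (a ⊗ₜ b) = (gen 𝒱 v * a) ⊗ₜ b + twist 𝒱 m a ⊗ₜ (gen 𝒱 v * b) := by
  lift v to 𝒱 m using hv
  simp [primAct, DirectSum.toModule_lof]

theorem primAct_comm (m n : ℤ) (v w : V) (hv : v ∈ 𝒱 m) (hw : w ∈ 𝒱 n) :
    primAct 𝒱 v * primAct 𝒱 w = (-1 : K) ^ (m * n) • (primAct 𝒱 w * primAct 𝒱 v) := by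
  refine TensorProduct.ext' fun a b => ?_
  have hs : (-1 : K) ^ (m * n) * (-1 : K) ^ (m * n) = 1 := by
    rw [← zpow_add₀ (by simp), ← two_mul]
    exact (even_two_mul _).neg_one_zpow
  simp only [Module.End.mul_apply, LinearMap.smul_apply, primAct_of_mem 𝒱 hv,
    primAct_of_mem 𝒱 hw, map_add, map_mul, twist_gen 𝒱 m hw, twist_gen 𝒱 n hv, smul_add,
    smul_mul_assoc, ← TensorProduct.smul_tmul', smul_smul, mul_comm n m, hs, one_smul,
    ← mul_assoc, gen_mul_gen 𝒱 hv hw, twist_twist 𝒱 m n, TensorProduct.tmul_smul]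
  abel

/-- The coproduct of `Sym V`, i.e. the symmetrized deconcatenation
`Δ (x₁ ∨ ⋯ ∨ xₙ) = ∑ₖ ∑_{σ ∈ Sh(k,n-k)} ε(σ) (x_σ(1) ∨ ⋯ ∨ x_σ(k)) ⊗ (x_σ(k+1) ∨ ⋯ ∨ x_σ(n))`.
It is given by `Δ 1 = 1 ⊗ 1` and
`Δ (v ∨ x) = (v ⊗ 1 + 1 ⊗ v) Δ x` (in an unshuffle the first letter is the first one of the left
factor, or the first one of the right factor and then it has passed the whole left factor). -/
def comul : GSym 𝒱 →ₗ[K] GSym 𝒱 ⊗[K] GSym 𝒱 :=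
  LinearMap.applyₗ ((1 : GSym 𝒱) ⊗ₜ[K] (1 : GSym 𝒱)) ∘ₗ
    (lift 𝒱 (primAct 𝒱) (primAct_comm 𝒱)).toLinearMap

theorem comul_one : comul 𝒱 1 = 1 ⊗ₜ 1 := by
  simp [comul]

theorem comul_gen_mul (v : V) (x : GSym 𝒱) :
    comul 𝒱 (gen 𝒱 v * x) = primAct 𝒱 v (comul 𝒱 x) := by
  simp [comul]

/-- The operator `x₁ ∨ ⋯ ∨ xₙ ↦ ∑ₖ ∑_{σ ∈ Sh(k,n-k)} ε(σ)
f (x_σ(1) ∨ ⋯ ∨ x_σ(k)) ∨ g (x_σ(k+1) ∨ ⋯ ∨ x_σ(n))` (here `g` is of degree `0`, so that there is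
no further sign). -/
def conv {𝒱 : ℤ → Submodule K V} [DirectSum.Decomposition 𝒱] {𝒲 : ℤ → Submodule K W}
    (f g : GSym 𝒱 →ₗ[K] GSym 𝒲) : GSym 𝒱 →ₗ[K] GSym 𝒲 :=
  LinearMap.mul' K (GSym 𝒲) ∘ₗ TensorProduct.map f g ∘ₗ comul 𝒱

/-- The coderivation of `Sym V` with structure maps `q : Sym V → V`,
`x₁ ∨ ⋯ ∨ xₙ ↦ ∑ₖ ∑_{σ ∈ Sh(k,n-k)} ε(σ) q (x_σ(1) ∨ ⋯ ∨ x_σ(k)) ∨ x_σ(k+1) ∨ ⋯ ∨ x_σ(n)`. -/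
def coderivation {𝒱 : ℤ → Submodule K V} [DirectSum.Decomposition 𝒱] (q : GSym 𝒱 →ₗ[K] V) :
    GSym 𝒱 →ₗ[K] GSym 𝒱 :=
  conv (gen 𝒱 ∘ₗ q) LinearMap.id

/-- A counital coalgebra morphism `Sym V → Sym W` of degree `0` with `F 1 = 1`. -/
structure IsCoalgebraMorphism {𝒱 : ℤ → Submodule K V} {𝒲 : ℤ → Submodule K W}
    [DirectSum.Decomposition 𝒱] [DirectSum.Decomposition 𝒲] (F : GSym 𝒱 →ₗ[K] GSym 𝒲) : Prop where
  comul_comp : comul 𝒲 ∘ₗ F = TensorProduct.map F F ∘ₗ comul 𝒱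
  counit_comp : counit 𝒲 ∘ₗ F = counit 𝒱
  map_one : F 1 = 1
  degree : HasDegree (totalDegree 𝒱) (totalDegree 𝒲) 0 F

end Symmetric

/-! ### Cohomology of cochain complexes of vector spaces -/

section Cohomology

variable {K V W : Type*} [Field K] [AddCommGroup V] [Module K V] [AddCommGroup W] [Module K W]

/-- The `n`-cocycles `Zⁿ` of `(V, δ)`. -/
def cocycles (𝒱 : ℤ → Submodule K V) (δ : V →ₗ[K] V) (n : ℤ) : Submodule K V :=
  LinearMap.ker δ ⊓ 𝒱 n

/-- The `n`-coboundaries `Bⁿ` of `(V, δ)`. -/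
def coboundaries (𝒱 : ℤ → Submodule K V) (δ : V →ₗ[K] V) (n : ℤ) : Submodule K V :=
  (𝒱 (n - 1)).map δ

/-- The cohomology `Hⁿ(V, δ) = Zⁿ / Bⁿ`. -/
abbrev Cohomology (𝒱 : ℤ → Submodule K V) (δ : V →ₗ[K] V) (n : ℤ) : Type _ :=
  cocycles 𝒱 δ n ⧸ (coboundaries 𝒱 δ n).submoduleOf (cocycles 𝒱 δ n)

/-- `f : (V, δ) → (W, δ')` is a morphism of cochain complexes. -/
structure IsCochainMap (𝒱 : ℤ → Submodule K V) (𝒲 : ℤ → Submodule K W)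
    (δ : V →ₗ[K] V) (δ' : W →ₗ[K] W) (f : V →ₗ[K] W) : Prop where
  degree : HasDegree 𝒱 𝒲 0 f
  comm : f ∘ₗ δ = δ' ∘ₗ f

variable {𝒱 : ℤ → Submodule K V} {𝒲 : ℤ → Submodule K W} {δ : V →ₗ[K] V} {δ' : W →ₗ[K] W}
  {f : V →ₗ[K] W}

theorem IsCochainMap.mem_cocycles (hf : IsCochainMap 𝒱 𝒲 δ δ' f) (n : ℤ) (x : V)
    (hx : x ∈ cocycles 𝒱 δ n) : f x ∈ cocycles 𝒲 δ' n := by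
  refine ⟨?_, by simpa using hf.degree n x hx.2⟩
  have h := LinearMap.congr_fun hf.comm x
  simp only [LinearMap.comp_apply, LinearMap.mem_ker.1 hx.1, map_zero] at h
  exact h.symm

/-- The map `Hⁿ(f) : Hⁿ(V, δ) → Hⁿ(W, δ')` induced by a morphism of cochain complexes. -/
def cohomologyMap (hf : IsCochainMap 𝒱 𝒲 δ δ' f) (n : ℤ) :
    Cohomology 𝒱 δ n →ₗ[K] Cohomology 𝒲 δ' n :=
  Submodule.mapQ _ _ (f.restrict (hf.mem_cocycles n)) (by
    rintro ⟨x, hx⟩ ⟨y, hy, hyx⟩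
    exact ⟨f y, by simpa using hf.degree _ y hy, by
      have h := LinearMap.congr_fun hf.comm y
      simp only [LinearMap.comp_apply] at h
      rw [← h, hyx]
      rfl⟩)

/-- `f : (V, δ) → (W, δ')` is a quasi-isomorphism of cochain complexes. -/
def IsQuasiIsomorphism (𝒱 : ℤ → Submodule K V) (𝒲 : ℤ → Submodule K W)
    (δ : V →ₗ[K] V) (δ' : W →ₗ[K] W) (f : V →ₗ[K] W) : Prop :=
  ∃ hf : IsCochainMap 𝒱 𝒲 δ δ' f, ∀ n : ℤ, Function.Bijective (cohomologyMap hf n)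

end Cohomology

/-! ### `L∞`-morphisms

An `L∞`-structure on a graded space `𝔏` is a codifferential `Q` of `Sym (𝔏[1])`, and `(𝔏[1], Q¹₁)`
is its underlying complex. Here `𝒱` stands for the graded space `𝔏[1]`. -/

section LInfinity

variable {K V W : Type*} [Field K] [AddCommGroup V] [Module K V] [AddCommGroup W] [Module K W]
  {𝒱 : ℤ → Submodule K V} [DirectSum.Decomposition 𝒱]
  {𝒲 : ℤ → Submodule K W} [DirectSum.Decomposition 𝒲]

/-- `F` is an `L∞`-morphism with respect to the codifferentials `Q` and `Q'`. -/
structure IsLInfinityMorphism (Q : GSym 𝒱 →ₗ[K] GSym 𝒱) (Q' : GSym 𝒲 →ₗ[K] GSym 𝒲)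
    (F : GSym 𝒱 →ₗ[K] GSym 𝒲) : Prop where
  coalgebraMorphism : IsCoalgebraMorphism F
  comm : F ∘ₗ Q = Q' ∘ₗ F

/-- `F` is an `L∞`-quasi-isomorphism: an `L∞`-morphism whose linear part is a quasi-isomorphism. -/
structure IsLInfinityQuasiIso (Q : GSym 𝒱 →ₗ[K] GSym 𝒱) (Q' : GSym 𝒲 →ₗ[K] GSym 𝒲)
    (F : GSym 𝒱 →ₗ[K] GSym 𝒲) : Prop where
  morphism : IsLInfinityMorphism Q Q' F
  quasiIso : IsQuasiIsomorphism 𝒱 𝒲 (linearPart Q) (linearPart Q') (linearPart F)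

/-- The `L∞`-quasi-isomorphisms `F` and `G` are quasi-inverse to each other: their linear parts
induce mutually inverse maps in cohomology. -/
structure AreLInfinityQuasiInverse (Q : GSym 𝒱 →ₗ[K] GSym 𝒱) (Q' : GSym 𝒲 →ₗ[K] GSym 𝒲)
    (F : GSym 𝒱 →ₗ[K] GSym 𝒲) (G : GSym 𝒲 →ₗ[K] GSym 𝒱) : Prop where
  left : IsLInfinityQuasiIso Q Q' F
  right : IsLInfinityQuasiIso Q' Q G
  inverse : ∀ (hF : IsCochainMap 𝒱 𝒲 (linearPart Q) (linearPart Q') (linearPart F))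
    (hG : IsCochainMap 𝒲 𝒱 (linearPart Q') (linearPart Q) (linearPart G)) (n : ℤ),
    cohomologyMap hG n ∘ₗ cohomologyMap hF n = LinearMap.id ∧
      cohomologyMap hF n ∘ₗ cohomologyMap hG n = LinearMap.id

end LInfinity

/-! ### Differential graded Lie algebras -/

/-- A differential graded Lie algebra structure on the graded vector space `(A, 𝒜)`. -/
structure DGLA {K A : Type*} [Field K] [AddCommGroup A] [Module K A]
    (𝒜 : ℤ → Submodule K A) where
  d : A →ₗ[K] A
  bracket : A →ₗ[K] A →ₗ[K] A
  d_degree : HasDegree 𝒜 𝒜 1 d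
  d_d : ∀ x, d (d x) = 0
  bracket_degree : ∀ (m n : ℤ) (x y : A), x ∈ 𝒜 m → y ∈ 𝒜 n → bracket x y ∈ 𝒜 (m + n)
  bracket_skew : ∀ (m n : ℤ) (x y : A), x ∈ 𝒜 m → y ∈ 𝒜 n →
    bracket x y = -((-1 : K) ^ (m * n) • bracket y x)
  d_bracket : ∀ (m : ℤ) (x y : A), x ∈ 𝒜 m →
    d (bracket x y) = bracket (d x) y + (-1 : K) ^ m • bracket x (d y)
  jacobi : ∀ (m n : ℤ) (x y z : A), x ∈ 𝒜 m → y ∈ 𝒜 n →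
    bracket x (bracket y z) =
      bracket (bracket x y) z + (-1 : K) ^ (m * n) • bracket y (bracket x z)

/-- A morphism of differential graded Lie algebras. -/
structure IsDGLAMorphism {K A B : Type*} [Field K] [AddCommGroup A] [Module K A] [AddCommGroup B]
    [Module K B] {𝒜 : ℤ → Submodule K A} {ℬ : ℤ → Submodule K B}
    (LA : DGLA 𝒜) (LB : DGLA ℬ) (f : A →ₗ[K] B) : Prop where
  degree : HasDegree 𝒜 ℬ 0 f
  map_d : ∀ x, f (LA.d x) = LB.d (f x)
  map_bracket : ∀ x y, f (LA.bracket x y) = LB.bracket (f x) (f y)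

namespace DGLA

variable {K A : Type*} [Field K] [AddCommGroup A] [Module K A]
  {𝒜 : ℤ → Submodule K A} (L : DGLA 𝒜)

/-- The structure map `Q₁ = -d` on `Sym¹ (A[1])` (extended by `0` to `Sym (A[1])`). -/
def Q₁ : GSym (shift 𝒜) →ₗ[K] A :=
  -(L.d ∘ₗ cogen (shift 𝒜))

theorem Q₁_gen (x : A) : L.Q₁ (gen (shift 𝒜) x) = -L.d x := by
  simp [Q₁]

variable [DirectSum.Decomposition 𝒜]

/-- The structure map `Q₂ (x ∨ y) = -(-1)^{|x|} [x, y]` on `Sym² (A[1])` (extended by `0` to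
`Sym (A[1])`), where `|x|` is the degree in `A[1]`. Since the component of `Δ (x ∨ y)` in
`A[1] ⊗ A[1]` is `x ⊗ y + (-1)^{|x||y|} y ⊗ x`, on which `-(-1)^{|x|} [x, y]` takes twice the
wanted value, there is a factor `1/2`; see `Q₂_gen_mul_gen`. -/
def Q₂ : GSym (shift 𝒜) →ₗ[K] A :=
  (2 : K)⁻¹ • (TensorProduct.lift (-(L.bracket ∘ₗ degSign (shift 𝒜) 1)) ∘ₗ
    TensorProduct.map (cogen (shift 𝒜)) (cogen (shift 𝒜)) ∘ₗ comul (shift 𝒜))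

theorem Q₂_gen_mul_gen [CharZero K] {m : ℤ} {x : A} (hx : x ∈ shift 𝒜 m) (y : A) :
    L.Q₂ (gen (shift 𝒜) x * gen (shift 𝒜) y) = -((-1 : K) ^ m • L.bracket x y) := by
  have h2 : (2 : K) ≠ 0 := two_ne_zero
  induction y using DirectSum.Decomposition.inductionOn (shift 𝒜) with
  | zero => simp
  | @homogeneous n y =>
    have hskew := L.bracket_skew (n + 1) (m + 1) y x y.2 hx
    have hpow : (-1 : K) ^ (m * n) * (-1 : K) ^ n * (-1 : K) ^ ((n + 1) * (m + 1)) =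
        -(-1 : K) ^ m := by
      simp only [← zpow_add₀ (neg_ne_zero.2 (one_ne_zero (α := K)))]
      have : m * n + n + (n + 1) * (m + 1) = 2 * (m * n + n) + (m + 1) := by ring
      rw [this, zpow_add₀ (by simp), zpow_add₀ (by simp), (even_two_mul _).neg_one_zpow]
      simp
    have hx1 : degSign (shift 𝒜) 1 x = (-1 : K) ^ m • x := by
      rw [degSign_of_mem _ _ hx, one_mul]
    have hy1 : degSign (shift 𝒜) 1 (y : A) = (-1 : K) ^ n • (y : A) := by
      rw [degSign_of_mem _ _ y.2, one_mul]
    have hc : comul (shift 𝒜) (gen (shift 𝒜) (y : A)) =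
        gen (shift 𝒜) (y : A) ⊗ₜ 1 + 1 ⊗ₜ gen (shift 𝒜) (y : A) := by
      rw [← mul_one (gen (shift 𝒜) (y : A)), comul_gen_mul, comul_one, primAct_of_mem _ y.2]
      simp
    have hcx : counit (shift 𝒜) (gen (shift 𝒜) (y : A)) = 0 := by
      rw [← mul_one (gen (shift 𝒜) (y : A)), counit_gen_mul]
    rw [Q₂, LinearMap.smul_apply, LinearMap.comp_apply, LinearMap.comp_apply, comul_gen_mul, hc,
      map_add, primAct_of_mem _ hx, primAct_of_mem _ hx, twist_gen _ _ y.2]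
    simp only [map_add, TensorProduct.map_tmul, TensorProduct.lift.tmul, cogen_gen_mul, hcx,
      cogen_one, map_one, mul_one, cogen_gen, map_smul, zero_smul, map_zero, LinearMap.neg_apply, LinearMap.comp_apply, hx1, hy1, LinearMap.smul_apply, hskew, add_zero,
      zero_add, smul_neg, neg_neg, smul_smul, hpow]
    rw [neg_smul, ← neg_add, ← two_smul K, smul_neg, smul_smul, inv_mul_cancel₀ h2, one_smul]
  | add y z hy hz =>
    rw [map_add, mul_add, map_add, hy, hz, map_add, smul_add, neg_add]

/-- The codifferential `Q` on `Sym (A[1])` with structure maps `Q₁` and `Q₂`. -/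
def Q : GSym (shift 𝒜) →ₗ[K] GSym (shift 𝒜) :=
  coderivation (L.Q₁ + L.Q₂)

end DGLA

/-! ### Deformation retracts -/

/-- A deformation retract `(i, p, h)` of `(A, d_A)`: degree zero cochain maps `i : A → B` and
`p : B → A` and a homotopy `h : B → B[-1]` with `h d_B + d_B h = id - i p`, `p i = id` and
`h² = h i = p h = 0`. -/
structure DeformationRetract {K A B : Type*} [Field K] [AddCommGroup A] [Module K A]
    [AddCommGroup B] [Module K B] {𝒜 : ℤ → Submodule K A} {ℬ : ℤ → Submodule K B}
    (LA : DGLA 𝒜) (LB : DGLA ℬ) where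
  i : A →ₗ[K] B
  p : B →ₗ[K] A
  h : B →ₗ[K] B
  i_degree : HasDegree 𝒜 ℬ 0 i
  p_degree : HasDegree ℬ 𝒜 0 p
  h_degree : HasDegree ℬ ℬ (-1) h
  i_d : ∀ x, i (LA.d x) = LB.d (i x)
  p_d : ∀ x, p (LB.d x) = LA.d (p x)
  homotopy : ∀ x, h (LB.d x) + LB.d (h x) = x - i (p x)
  p_i : ∀ x, p (i x) = x
  h_h : ∀ x, h (h x) = 0
  h_i : ∀ x, h (i x) = 0
  p_h : ∀ x, p (h x) = 0

namespace DeformationRetract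

variable {K A B : Type*} [Field K] [AddCommGroup A] [Module K A] [AddCommGroup B] [Module K B]
  {𝒜 : ℤ → Submodule K A} {ℬ : ℤ → Submodule K B} {LA : DGLA 𝒜} {LB : DGLA ℬ}

theorem ip_degree (r : DeformationRetract LA LB) : HasDegree ℬ ℬ 0 (r.i ∘ₗ r.p) := fun n x hx => by
  have h := r.i_degree _ _ (r.p_degree n x hx)
  rwa [add_zero] at h

variable [DirectSum.Decomposition 𝒜] [DirectSum.Decomposition ℬ] (r : DeformationRetract LA LB)

/-- The coderivation `x₁ ∨ ⋯ ∨ xₙ ↦ -∑_{σ ∈ Sh(1,n-1)} ε(σ) h x_σ(1) ∨ x_σ(2) ∨ ⋯ ∨ x_σ(n)` of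
`Sym (B[1])` extending `-h`. -/
def Htilde : GSym (shift ℬ) →ₗ[K] GSym (shift ℬ) :=
  coderivation (-(r.h ∘ₗ cogen (shift ℬ)))

/-- The operator
`Kₙ (x₁ ∨ ⋯ ∨ xₙ) = 1/n! ∑_{j=0}^{n-1} ∑_{σ ∈ Sₙ} ε(σ)/(n-j)
  ip x_σ(1) ∨ ⋯ ∨ ip x_σ(j) ∨ x_σ(j+1) ∨ ⋯ ∨ x_σ(n)` on `Symⁿ (B[1])` (extended by `0`).
The sum over `Sₙ` is `j! (n-j)!` times the sum over the shuffles `Sh(j,n-j)`, which is given by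
the convolution. -/
def Kop (n : ℕ) : GSym (shift ℬ) →ₗ[K] GSym (shift ℬ) :=
  (n.factorial : K)⁻¹ • ∑ j ∈ Finset.range n,
    ((j.factorial * (n - j).factorial : ℕ) / ((n - j : ℕ) : K)) •
      conv ((symMap (r.i ∘ₗ r.p) r.ip_degree.shift).toLinearMap ∘ₗ proj (shift ℬ) j)
        (proj (shift ℬ) (n - j))

/-- The extension `Hₙ = Kₙ ∘ H̃ₙ` of the homotopy `h` to `Symⁿ (B[1])` (extended by `0`). -/
def H (n : ℕ) : GSym (shift ℬ) →ₗ[K] GSym (shift ℬ) :=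
  r.Kop n ∘ₗ r.Htilde ∘ₗ proj (shift ℬ) n

end DeformationRetract

section Projection

variable {K A B : Type*} [Field K] [AddCommGroup A] [Module K A] [AddCommGroup B] [Module K B]
  {𝒜 : ℤ → Submodule K A} {ℬ : ℤ → Submodule K B}
  [DirectSum.Decomposition 𝒜] [DirectSum.Decomposition ℬ]

/-- `L_{∞,k+1}(F) = Q¹_{A,2} ∘ F²_{k+1} - F¹_k ∘ Qᵏ_{B,k+1} : Symᵏ⁺¹ (B[1]) → A[1]` (extended by
`0` to `Sym (B[1])`) for `F : Sym (B[1]) → Sym (A[1])`. -/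
def linfty (LA : DGLA 𝒜) (LB : DGLA ℬ) (F : GSym (shift ℬ) →ₗ[K] GSym (shift 𝒜)) (k : ℕ) :
    GSym (shift ℬ) →ₗ[K] A :=
  LA.Q₂ ∘ₗ component F (k + 1) 2 - taylor F k ∘ₗ component LB.Q (k + 1) k

/-- `P : Sym (B[1]) → Sym (A[1])` is a coalgebra morphism with structure maps `P¹₁ = p` and
`P¹_{k+1} = L_{∞,k+1}(P) ∘ H_{k+1}` for `k ≥ 1`. -/
structure IsProjection {LA : DGLA 𝒜} {LB : DGLA ℬ} (r : DeformationRetract LA LB)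
    (P : GSym (shift ℬ) →ₗ[K] GSym (shift 𝒜)) : Prop where
  coalgebraMorphism : IsCoalgebraMorphism P
  linear : linearPart P = r.p
  succ : ∀ k : ℕ, 1 ≤ k → taylor P (k + 1) = linfty LA LB P k ∘ₗ r.H (k + 1)

end Projection

end GradedCoalg

open GradedCoalg

namespace GradedCoalg

/-! ### Degrees of linear maps -/

section Basics

variable {K V W X : Type*} [Field K] [AddCommGroup V] [Module K V] [AddCommGroup W] [Module K W]
  [AddCommGroup X] [Module K X]

/-! Let `N` be the coderivation extending the identity; it is multiplication by n on Symⁿ. A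
coalgebra morphism F with cogenerator part f satisfies the exponential equation N F = f * F for the
convolution product. In characteristic 0 this equation and the counit determine F from f
(`eq_zero_of_number`). Conversely, for f of degree 0 with f(1) = 0, the convolution exponential
solves it, and any counital solution of degree 0 is comultiplicative (`comul_comp_of_number`). So P
amounts to such a map f on Sym(B[1]). The recursion says f = obs(f) ∘ H in each weight k + 1 ≥ 2,
where obs(f) = ½ [f, f] Δ − f Q₂ on the shifted spaces. In weight k + 1, obs(f) sees only the
components of f of weight at most k (`obstruction_congr`). This gives existence and uniqueness.

The operators H are homotopies. Let D be the coderivation extending e = ip. The anticommutator of Q₁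
and H̃ is N − D, since dh + hd = 1 − ip on generators. Let S_j be the sum of the ways to apply e to
j of the letters. As e is idempotent, S_j D = j S_j + (j+1) S_{j+1}, and with the weights in Kₙ the
sum Kₙ(N − D) telescopes to S₀ − Sₙ = id − Sym(ip). Since Kₙ commutes with Q₁, Q₁H + HQ₁ = id −
Sym(ip) in positive weight (`homotopy_H`).

From h i = 0 follows H Sym(i) = 0, hence P Sym(i) = id. Because i respects brackets, obs(f) then
vanishes on the image of Sym(i), in particular on that of Sym(ip).

Put E = Q_A P − P Q_B. It is an odd coderivation along P, so it vanishes as soon as its cogenerator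
part ε does. Both codifferentials square to zero, so Q_A E + E Q_B = 0. If ε vanishes in all weights
below that of y, this reduces to −d ε(y) + ε(Q₁ y) = 0 (`d_cogen_sub`). For y = Hx, the recursion,
the homotopy formula and the vanishing of obs(f) on the image of Sym(ip) turn the left side into
ε(x), so ε = 0 by induction on the weight (`IsProjection.cogen_sub_eq_zero`). The statements about
cohomology concern only p, i and h. -/

theorem HasDegree.comp {𝒱 : ℤ → Submodule K V} {𝒲 : ℤ → Submodule K W} {𝒳 : ℤ → Submodule K X}
    {r s : ℤ} {g : W →ₗ[K] X} {f : V →ₗ[K] W} (hg : HasDegree 𝒲 𝒳 s g) (hf : HasDegree 𝒱 𝒲 r f) :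
    HasDegree 𝒱 𝒳 (r + s) (g ∘ₗ f) := fun n x hx => by
  rw [← add_assoc]
  exact hg _ _ (hf n x hx)

theorem HasDegree.id (𝒱 : ℤ → Submodule K V) : HasDegree 𝒱 𝒱 0 LinearMap.id := fun n x hx => by
  rwa [add_zero]

theorem HasDegree.add {𝒱 : ℤ → Submodule K V} {𝒲 : ℤ → Submodule K W} {r : ℤ} {f g : V →ₗ[K] W}
    (hf : HasDegree 𝒱 𝒲 r f) (hg : HasDegree 𝒱 𝒲 r g) : HasDegree 𝒱 𝒲 r (f + g) :=
  fun n x hx => (𝒲 _).add_mem (hf n x hx) (hg n x hx)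

theorem HasDegree.neg {𝒱 : ℤ → Submodule K V} {𝒲 : ℤ → Submodule K W} {r : ℤ} {f : V →ₗ[K] W}
    (hf : HasDegree 𝒱 𝒲 r f) : HasDegree 𝒱 𝒲 r (-f) :=
  fun n x hx => (𝒲 _).neg_mem (hf n x hx)

theorem HasDegree.sub {𝒱 : ℤ → Submodule K V} {𝒲 : ℤ → Submodule K W} {r : ℤ} {f g : V →ₗ[K] W}
    (hf : HasDegree 𝒱 𝒲 r f) (hg : HasDegree 𝒱 𝒲 r g) : HasDegree 𝒱 𝒲 r (f - g) :=
  fun n x hx => (𝒲 _).sub_mem (hf n x hx) (hg n x hx)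

theorem HasDegree.smul {𝒱 : ℤ → Submodule K V} {𝒲 : ℤ → Submodule K W} {r : ℤ} {f : V →ₗ[K] W}
    (hf : HasDegree 𝒱 𝒲 r f) (c : K) : HasDegree 𝒱 𝒲 r (c • f) :=
  fun n x hx => (𝒲 _).smul_mem c (hf n x hx)

theorem HasDegree.sum {ι : Type*} {𝒱 : ℤ → Submodule K V} {𝒲 : ℤ → Submodule K W} {r : ℤ}
    (s : Finset ι) {f : ι → V →ₗ[K] W} (hf : ∀ j ∈ s, HasDegree 𝒱 𝒲 r (f j)) :
    HasDegree 𝒱 𝒲 r (∑ j ∈ s, f j) := fun n x hx => by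
  rw [LinearMap.sum_apply]
  exact Submodule.sum_mem _ fun j hj => hf j hj n x hx

/-! ### Induction principles -/

theorem gsym_induction_gen {𝒱 : ℤ → Submodule K V} {p : GSym 𝒱 → Prop} (one : p 1)
    (add : ∀ x y, p x → p y → p (x + y)) (smul : ∀ (c : K) x, p x → p (c • x))
    (gen_mul : ∀ v x, p x → p (gen 𝒱 v * x)) (x : GSym 𝒱) : p x := by
  let π : TensorAlgebra K V →ₐ[K] GSym 𝒱 := RingQuot.mkAlgHom K (SymRel 𝒱)
  -- Quantifying over the right factor x lets the product case compose two left multiplications.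
  have key : ∀ (y : TensorAlgebra K V) (x : GSym 𝒱), p x → p (π y * x) := by
    intro y
    induction y using TensorAlgebra.induction with
    | algebraMap c =>
      intro x hx
      rw [AlgHom.commutes]
      have h := smul c x hx
      rw [Algebra.smul_def] at h
      exact h
    | ι v => exact fun x hx => gen_mul v x hx
    | mul a b ha hb =>
      intro x hx
      rw [map_mul, mul_assoc]
      exact ha _ (hb _ hx)
    | add a b ha hb =>
      intro x hx
      rw [map_add, add_mul]
      exact add _ _ (ha _ hx) (hb _ hx)
  obtain ⟨y, hy⟩ := RingQuot.mkAlgHom_surjective K (SymRel 𝒱) x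
  have h := key y 1 one
  rw [mul_one] at h
  exact hy ▸ h

theorem gsym_induction {𝒱 : ℤ → Submodule K V} [DirectSum.Decomposition 𝒱] {p : GSym 𝒱 → Prop}
    (one : p 1) (add : ∀ x y, p x → p y → p (x + y)) (smul : ∀ (c : K) x, p x → p (c • x))
    (gen_mul : ∀ m, ∀ v ∈ 𝒱 m, ∀ x, p x → p (gen 𝒱 v * x)) (x : GSym 𝒱) : p x := by
  refine gsym_induction_gen one add smul (fun v x hx => ?_) x
  induction v using DirectSum.Decomposition.inductionOn 𝒱 with
  | zero =>
    have h := smul 0 1 one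
    simpa using h
  | homogeneous v => exact gen_mul _ _ v.2 x hx
  | add v w hv hw =>
    rw [map_add, add_mul]
    exact add _ _ hv hw

theorem gsym_linearMap_ext {𝒱 : ℤ → Submodule K V} [DirectSum.Decomposition 𝒱]
    {F G : GSym 𝒱 →ₗ[K] X} (one : F 1 = G 1)
    (gen_mul : ∀ m, ∀ v ∈ 𝒱 m, ∀ x, F x = G x → F (gen 𝒱 v * x) = G (gen 𝒱 v * x)) : F = G := by
  refine LinearMap.ext fun x => gsym_induction one (fun x y hx hy => ?_) (fun c x hx => ?_)
    gen_mul x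
  · rw [map_add, map_add, hx, hy]
  · rw [map_smul, map_smul, hx]

/-! ### The grading by weight -/

section Weight

variable (𝒱 : ℤ → Submodule K V)

theorem one_mem_symPow : (1 : GSym 𝒱) ∈ symPow 𝒱 0 := by
  rw [symPow, pow_zero]
  exact Submodule.one_le.1 le_rfl

theorem mem_symPow_zero {x : GSym 𝒱} (hx : x ∈ symPow 𝒱 0) : ∃ c : K, x = c • 1 := by
  rw [symPow, pow_zero, Submodule.mem_one] at hx
  obtain ⟨c, rfl⟩ := hx
  exact ⟨c, Algebra.algebraMap_eq_smul_one c⟩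

variable {𝒱} in
theorem gen_mul_mem_symPow (v : V) {n : ℕ} {x : GSym 𝒱} (hx : x ∈ symPow 𝒱 n) :
    gen 𝒱 v * x ∈ symPow 𝒱 (n + 1) := by
  rw [symPow, pow_succ']
  exact Submodule.mul_mem_mul ⟨v, rfl⟩ hx

theorem gen_mem_symPow (v : V) : gen 𝒱 v ∈ symPow 𝒱 1 := by
  simpa using gen_mul_mem_symPow v (one_mem_symPow 𝒱)

theorem mem_symPow_one {x : GSym 𝒱} (hx : x ∈ symPow 𝒱 1) : ∃ v, x = gen 𝒱 v := by
  rw [symPow, pow_one] at hx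
  obtain ⟨v, rfl⟩ := hx
  exact ⟨v, rfl⟩

variable {𝒱}

theorem symPow_succ_le {n : ℕ} {q : Submodule K (GSym 𝒱)}
    (h : ∀ v, ∀ x ∈ symPow 𝒱 n, gen 𝒱 v * x ∈ q) : symPow 𝒱 (n + 1) ≤ q := by
  rw [symPow, pow_succ', Submodule.mul_le]
  rintro _ ⟨v, rfl⟩ x hx
  exact h v x hx

theorem symPow_induction {p : GSym 𝒱 → Prop}
    (mem : ∀ n, ∀ x ∈ symPow 𝒱 n, p x) (add : ∀ x y, p x → p y → p (x + y)) (x : GSym 𝒱) : p x := by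
  suffices h : x ∈ ⨆ n, symPow 𝒱 n by
    refine Submodule.iSup_induction (motive := p) _ h mem ?_ add
    exact mem 0 0 (zero_mem _)
  induction x using gsym_induction_gen with
  | one => exact Submodule.mem_iSup_of_mem 0 (one_mem_symPow 𝒱)
  | add x y hx hy => exact add_mem hx hy
  | smul c x hx => exact Submodule.smul_mem _ c hx
  | gen_mul v x hx =>
    refine Submodule.iSup_induction (motive := fun x => gen 𝒱 v * x ∈ ⨆ n, symPow 𝒱 n) _ hx
      ?_ ?_ ?_
    · exact fun n x hx => Submodule.mem_iSup_of_mem (n + 1) (gen_mul_mem_symPow v hx)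
    · simp
    · intro x y hx hy
      rw [mul_add]
      exact add_mem hx hy

theorem symPow_linearMap_ext {F G : GSym 𝒱 →ₗ[K] X} (h : ∀ n, ∀ x ∈ symPow 𝒱 n, F x = G x) :
    F = G := by
  refine LinearMap.ext fun x => symPow_induction h (fun x y hx hy => ?_) x
  rw [map_add, map_add, hx, hy]

variable (𝒱)

theorem proj_of_mem_self {n : ℕ} {x : GSym 𝒱} (hx : x ∈ symPow 𝒱 n) : proj 𝒱 n x = x := by
  rw [proj_of_mem 𝒱 n n x hx, if_pos rfl]

theorem proj_of_mem_ne {m n : ℕ} (hmn : m ≠ n) {x : GSym 𝒱} (hx : x ∈ symPow 𝒱 m) :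
    proj 𝒱 n x = 0 := by
  rw [proj_of_mem 𝒱 m n x hx, if_neg hmn]

theorem proj_mem (n : ℕ) (x : GSym 𝒱) : proj 𝒱 n x ∈ symPow 𝒱 n := by
  induction x using symPow_induction with
  | mem m x hx =>
    rw [proj_of_mem 𝒱 m n x hx]
    split_ifs with h
    · exact h ▸ hx
    · exact zero_mem _
  | add x y hx hy =>
    rw [map_add]
    exact add_mem hx hy

theorem proj_gen_mul_succ (n : ℕ) (v : V) (x : GSym 𝒱) :
    proj 𝒱 (n + 1) (gen 𝒱 v * x) = gen 𝒱 v * proj 𝒱 n x := by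
  induction x using symPow_induction with
  | mem m x hx =>
    rw [proj_of_mem 𝒱 m n x hx, proj_of_mem 𝒱 (m + 1) (n + 1) _ (gen_mul_mem_symPow v hx)]
    by_cases h : m = n <;> simp [h]
  | add x y hx hy => rw [mul_add, map_add, map_add, hx, hy, mul_add]

theorem proj_zero_gen_mul (v : V) (x : GSym 𝒱) : proj 𝒱 0 (gen 𝒱 v * x) = 0 := by
  induction x using symPow_induction with
  | mem m x hx => exact proj_of_mem_ne 𝒱 m.succ_ne_zero (gen_mul_mem_symPow v hx)
  | add x y hx hy => rw [mul_add, map_add, hx, hy, add_zero]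

theorem proj_zero_apply (x : GSym 𝒱) : proj 𝒱 0 x = counit 𝒱 x • 1 := by
  induction x using gsym_induction_gen with
  | one => rw [counit_one, one_smul, proj_of_mem_self 𝒱 (one_mem_symPow 𝒱)]
  | add x y hx hy => rw [map_add, map_add, hx, hy, add_smul]
  | smul c x hx => rw [map_smul, map_smul, hx, smul_assoc]
  | gen_mul v x hx => rw [proj_zero_gen_mul, counit_gen_mul, zero_smul]

theorem counit_of_mem {n : ℕ} (hn : n ≠ 0) {x : GSym 𝒱} (hx : x ∈ symPow 𝒱 n) :
    counit 𝒱 x = 0 := by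
  obtain ⟨n, rfl⟩ := Nat.exists_eq_succ_of_ne_zero hn
  exact (symPow_succ_le (q := LinearMap.ker (counit 𝒱)) fun v x _ => counit_gen_mul 𝒱 v x) hx

theorem cogen_of_mem {n : ℕ} (hn : n ≠ 1) {x : GSym 𝒱} (hx : x ∈ symPow 𝒱 n) :
    cogen 𝒱 x = 0 := by
  rcases n with _ | n
  · obtain ⟨c, rfl⟩ := mem_symPow_zero 𝒱 hx
    rw [map_smul, cogen_one, smul_zero]
  · refine (symPow_succ_le (q := LinearMap.ker (cogen 𝒱)) fun v x hx => ?_) hx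
    rw [LinearMap.mem_ker, cogen_gen_mul, counit_of_mem 𝒱 (by lia) hx, zero_smul]

theorem gen_cogen (x : GSym 𝒱) : gen 𝒱 (cogen 𝒱 x) = proj 𝒱 1 x := by
  induction x using symPow_induction with
  | mem n x hx =>
    by_cases hn : n = 1
    · subst hn
      rw [proj_of_mem_self 𝒱 hx]
      obtain ⟨v, rfl⟩ := mem_symPow_one 𝒱 hx
      rw [cogen_gen]
    · rw [proj_of_mem_ne 𝒱 hn hx, cogen_of_mem 𝒱 hn hx, map_zero]
  | add x y hx hy => rw [map_add, map_add, map_add, hx, hy]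

theorem cogen_proj_one (x : GSym 𝒱) : cogen 𝒱 (proj 𝒱 1 x) = cogen 𝒱 x := by
  rw [← gen_cogen, cogen_gen]

/-- Evaluating the weight polynomial at t = 1 recovers x, so x vanishes with its coefficients. -/
theorem eq_zero_of_proj (x : GSym 𝒱) (h : ∀ n, proj 𝒱 n x = 0) : x = 0 := by
  have hx : weight 𝒱 x = 0 := Polynomial.ext fun n => h n
  have hc : (Polynomial.leval (1 : GSym 𝒱)).restrictScalars K ∘ₗ (weight 𝒱).toLinearMap =
      LinearMap.id := symPow_linearMap_ext fun n x hx => by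
    simp [weight_of_mem 𝒱 n x hx]
  have := LinearMap.congr_fun hc x
  simpa [hx] using this.symm

theorem exists_sum_proj (x : GSym 𝒱) :
    ∃ M, ∀ m, M ≤ m → ∑ n ∈ Finset.range m, proj 𝒱 n x = x := by
  induction x using symPow_induction with
  | mem n x hx =>
    refine ⟨n + 1, fun m hm => ?_⟩
    rw [Finset.sum_eq_single n, proj_of_mem_self 𝒱 hx]
    · exact fun k _ hk => proj_of_mem_ne 𝒱 hk.symm hx
    · intro h
      rw [Finset.mem_range] at h
      lia
  | add x y hx hy =>
    obtain ⟨M, hM⟩ := hx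
    obtain ⟨N, hN⟩ := hy
    refine ⟨max M N, fun m hm => ?_⟩
    simp only [map_add, Finset.sum_add_distrib]
    rw [hM m (le_trans (le_max_left _ _) hm), hN m (le_trans (le_max_right _ _) hm)]

/-- The linear map on `Sym V` given by `G n` on `Symⁿ V`. -/
def assemble (G : ℕ → GSym 𝒱 →ₗ[K] X) : GSym 𝒱 →ₗ[K] X where
  toFun x := (weight 𝒱 x).sum fun n y => G n y
  map_add' x y := by
    rw [map_add]
    exact Polynomial.sum_add_index _ _ _ (fun n => map_zero _) fun n a b => map_add _ a b
  map_smul' c x := by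
    rw [map_smul, RingHom.id_apply, Polynomial.sum_def, Polynomial.sum_def, Finset.smul_sum]
    -- The support of c • x may be smaller (for c = 0), so the sums are compared over nested
    -- supports.
    refine Finset.sum_subset_zero_on_sdiff ?_ ?_ ?_
    · intro n hn
      rw [Polynomial.mem_support_iff] at hn ⊢
      contrapose! hn
      rw [Polynomial.coeff_smul, hn, smul_zero]
    · intro n hn
      rw [Finset.mem_sdiff, Polynomial.notMem_support_iff, Polynomial.coeff_smul] at hn
      rw [← map_smul, hn.2, map_zero]
    · intro n hn
      rw [Polynomial.coeff_smul, map_smul]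

variable {𝒱} in
theorem assemble_of_mem (G : ℕ → GSym 𝒱 →ₗ[K] X) {n : ℕ} {x : GSym 𝒱} (hx : x ∈ symPow 𝒱 n) :
    assemble 𝒱 G x = G n x := by
  change (weight 𝒱 x).sum _ = _
  rw [weight_of_mem 𝒱 n x hx, Polynomial.sum_monomial_index x _ (map_zero (G n))]

end Weight

/-! ### The grading by total degree -/

section TotalDegree

variable (𝒱 : ℤ → Submodule K V)

theorem one_mem_totalDegree : (1 : GSym 𝒱) ∈ totalDegree 𝒱 0 :=
  Submodule.subset_span ⟨[], by simp, by simp⟩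

variable {𝒱}

theorem gen_mul_mem_totalDegree {m n : ℤ} {v : V} (hv : v ∈ 𝒱 m) {x : GSym 𝒱}
    (hx : x ∈ totalDegree 𝒱 n) : gen 𝒱 v * x ∈ totalDegree 𝒱 (m + n) := by
  induction hx using Submodule.span_induction with
  | mem x hx =>
    obtain ⟨l, rfl, rfl⟩ := hx
    exact Submodule.subset_span ⟨⟨m, v, hv⟩ :: l, by simp, by simp⟩
  | zero => simp
  | add x y _ _ hx hy =>
    rw [mul_add]
    exact add_mem hx hy
  | smul c x _ hx =>
    rw [mul_smul_comm]
    exact Submodule.smul_mem _ c hx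

theorem gen_mem_totalDegree {m : ℤ} {v : V} (hv : v ∈ 𝒱 m) : gen 𝒱 v ∈ totalDegree 𝒱 m := by
  simpa using gen_mul_mem_totalDegree hv (one_mem_totalDegree 𝒱)

theorem gen_hasDegree : HasDegree 𝒱 (totalDegree 𝒱) 0 (gen 𝒱) := fun m v hv => by
  rw [add_zero]
  exact gen_mem_totalDegree hv

/-- To check that a linear map has a given degree it suffices to check products of homogeneous
elements, inductively. -/
theorem hasDegree_of_gen_mul {𝒳 : ℤ → Submodule K X} {r : ℤ} {F : GSym 𝒱 →ₗ[K] X}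
    (one : F 1 ∈ 𝒳 r)
    (gen_mul : ∀ m n, ∀ v ∈ 𝒱 m, ∀ x ∈ totalDegree 𝒱 n, F x ∈ 𝒳 (n + r) →
      F (gen 𝒱 v * x) ∈ 𝒳 (m + n + r)) : HasDegree (totalDegree 𝒱) 𝒳 r F := by
  intro n x hx
  induction hx using Submodule.span_induction with
  | mem x hx =>
    obtain ⟨l, rfl, rfl⟩ := hx
    induction l with
    | nil => simpa using one
    | cons a l ih =>
      simp only [List.map_cons, List.sum_cons, List.prod_cons]
      exact gen_mul _ _ _ a.2.2 _ (Submodule.subset_span ⟨l, rfl, rfl⟩) ih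
  | zero => simp
  | add x y _ _ hx hy =>
    rw [map_add]
    exact add_mem hx hy
  | smul c x _ hx =>
    rw [map_smul]
    exact Submodule.smul_mem _ c hx

theorem totalDegree_induction [DirectSum.Decomposition 𝒱] {p : GSym 𝒱 → Prop}
    (mem : ∀ n, ∀ x ∈ totalDegree 𝒱 n, p x) (add : ∀ x y, p x → p y → p (x + y)) (x : GSym 𝒱) :
    p x := by
  suffices h : x ∈ ⨆ n, totalDegree 𝒱 n by
    refine Submodule.iSup_induction (motive := p) _ h mem ?_ add
    exact mem 0 0 (zero_mem _)
  induction x using gsym_induction with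
  | one => exact Submodule.mem_iSup_of_mem 0 (one_mem_totalDegree 𝒱)
  | add x y hx hy => exact add_mem hx hy
  | smul c x hx => exact Submodule.smul_mem _ c hx
  | gen_mul m v hv x hx =>
    refine Submodule.iSup_induction (motive := fun x => gen 𝒱 v * x ∈ ⨆ n, totalDegree 𝒱 n) _ hx
      ?_ ?_ ?_
    · exact fun n x hx => Submodule.mem_iSup_of_mem (m + n) (gen_mul_mem_totalDegree hv hx)
    · simp
    · intro x y hx hy
      rw [mul_add]
      exact add_mem hx hy

theorem counit_of_mem_totalDegree {n : ℤ} (hn : n ≠ 0) {x : GSym 𝒱} (hx : x ∈ totalDegree 𝒱 n) :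
    counit 𝒱 x = 0 := by
  induction hx using Submodule.span_induction with
  | mem x hx =>
    obtain ⟨l, rfl, rfl⟩ := hx
    cases l with
    | nil => simp at hn
    | cons a l => simp
  | zero => simp
  | add x y _ _ hx hy => rw [map_add, hx, hy, add_zero]
  | smul c x _ hx => rw [map_smul, hx, smul_zero]

theorem cogen_hasDegree : HasDegree (totalDegree 𝒱) 𝒱 0 (cogen 𝒱) := by
  refine hasDegree_of_gen_mul (by simp) fun m n v hv x hx _ => ?_
  rw [cogen_gen_mul]
  by_cases hn : n = 0
  · subst hn
    simpa using Submodule.smul_mem _ _ hv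
  · rw [counit_of_mem_totalDegree hn hx, zero_smul]
    exact zero_mem _

theorem proj_hasDegree (j : ℕ) : HasDegree (totalDegree 𝒱) (totalDegree 𝒱) 0 (proj 𝒱 j) := by
  -- The monomials spanning `totalDegree` are also homogeneous for the weight, so a projection keeps
  -- or kills each of them.
  suffices h : ∀ (l : List (Σ m : ℤ, 𝒱 m)),
      (l.map fun x => gen 𝒱 (x.2 : V)).prod ∈ symPow 𝒱 l.length by
    intro n x hx
    rw [add_zero]
    induction hx using Submodule.span_induction with
    | mem x hx =>
      obtain ⟨l, rfl, rfl⟩ := hx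
      rw [proj_of_mem 𝒱 _ j _ (h l)]
      split_ifs
      · exact Submodule.subset_span ⟨l, rfl, rfl⟩
      · exact zero_mem _
    | zero => simp
    | add x y _ _ hx hy =>
      rw [map_add]
      exact add_mem hx hy
    | smul c x _ hx =>
      rw [map_smul]
      exact Submodule.smul_mem _ c hx
  intro l
  induction l with
  | nil => exact one_mem_symPow 𝒱
  | cons a l ih => exact gen_mul_mem_symPow _ ih

theorem assemble_hasDegree {𝒳 : ℤ → Submodule K X} {r : ℤ} {G : ℕ → GSym 𝒱 →ₗ[K] X}
    (hG : ∀ n, HasDegree (totalDegree 𝒱) 𝒳 r (G n)) :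
    HasDegree (totalDegree 𝒱) 𝒳 r (assemble 𝒱 G) := by
  intro n x hx
  refine Submodule.sum_mem _ fun m _ => ?_
  have hp := proj_hasDegree m n x hx
  rw [add_zero] at hp
  exact hG m n _ hp

theorem symMap_gen {𝒲 : ℤ → Submodule K W} (f : V →ₗ[K] W) (hf : HasDegree 𝒱 𝒲 0 f) (v : V) :
    symMap f hf (gen 𝒱 v) = gen 𝒲 (f v) := by
  simp [symMap]

theorem symMap_hasDegree {𝒲 : ℤ → Submodule K W} (f : V →ₗ[K] W) (hf : HasDegree 𝒱 𝒲 0 f) :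
    HasDegree (totalDegree 𝒱) (totalDegree 𝒲) 0 (symMap f hf).toLinearMap := by
  refine hasDegree_of_gen_mul (by simpa using one_mem_totalDegree 𝒲) fun m n v hv x _ ih => ?_
  simp only [AlgHom.toLinearMap_apply, map_mul, symMap_gen, add_zero] at ih ⊢
  exact gen_mul_mem_totalDegree (by simpa using hf m v hv) ih

theorem symMap_mem_symPow {𝒲 : ℤ → Submodule K W} (f : V →ₗ[K] W) (hf : HasDegree 𝒱 𝒲 0 f) {n : ℕ}
    {x : GSym 𝒱} (hx : x ∈ symPow 𝒱 n) : symMap f hf x ∈ symPow 𝒲 n := by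
  induction n generalizing x with
  | zero =>
    obtain ⟨c, rfl⟩ := mem_symPow_zero 𝒱 hx
    rw [map_smul, map_one]
    exact Submodule.smul_mem _ c (one_mem_symPow 𝒲)
  | succ n ih =>
    refine (symPow_succ_le (q := (symPow 𝒲 (n + 1)).comap (symMap f hf).toLinearMap)
      fun v x hx => ?_) hx
    rw [Submodule.mem_comap, AlgHom.toLinearMap_apply, map_mul, symMap_gen]
    exact gen_mul_mem_symPow _ (ih hx)

variable (𝒱) [DirectSum.Decomposition 𝒱]

theorem twist_of_mem (r : ℤ) {n : ℤ} {x : GSym 𝒱} (hx : x ∈ totalDegree 𝒱 n) :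
    twist 𝒱 r x = (-1 : K) ^ (r * n) • x := by
  induction hx using Submodule.span_induction with
  | mem x hx =>
    obtain ⟨l, rfl, rfl⟩ := hx
    induction l with
    | nil => simp
    | cons a l ih =>
      simp only [List.map_cons, List.sum_cons, List.prod_cons, map_mul, ih, twist_gen 𝒱 r a.2.2]
      rw [smul_mul_smul_comm, ← zpow_add₀ (by simp), mul_add]
  | zero => simp
  | add x y _ _ hx hy => rw [map_add, hx, hy, smul_add]
  | smul c x _ hx => rw [map_smul, hx, smul_comm]

theorem twist_hasDegree (r : ℤ) :
    HasDegree (totalDegree 𝒱) (totalDegree 𝒱) 0 (twist 𝒱 r).toLinearMap :=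
  symMap_hasDegree _ _

variable {𝒱} in
/-- Homogeneous maps commute with the sign operators up to sign. -/
theorem HasDegree.twist_comm {𝒲 : ℤ → Submodule K W} [DirectSum.Decomposition 𝒲] {r : ℤ}
    {F : GSym 𝒱 →ₗ[K] GSym 𝒲} (hF : HasDegree (totalDegree 𝒱) (totalDegree 𝒲) r F) (m : ℤ)
    (x : GSym 𝒱) : twist 𝒲 m (F x) = (-1 : K) ^ (m * r) • F (twist 𝒱 m x) := by
  induction x using totalDegree_induction with
  | mem n x hx =>
    rw [twist_of_mem 𝒱 m hx, twist_of_mem 𝒲 m (hF n x hx), map_smul, smul_smul,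
      ← zpow_add₀ (by simp), mul_add, add_comm]
  | add x y hx hy => simp only [map_add, hx, hy, smul_add]

theorem cogen_twist (r : ℤ) (x : GSym 𝒱) : cogen 𝒱 (twist 𝒱 r x) = degSign 𝒱 r (cogen 𝒱 x) := by
  induction x using totalDegree_induction with
  | mem n x hx =>
    rw [twist_of_mem 𝒱 r hx, degSign_of_mem 𝒱 r (by simpa using cogen_hasDegree n x hx), map_smul]
  | add x y hx hy => simp only [map_add, hx, hy]

theorem counit_twist (r : ℤ) (x : GSym 𝒱) : counit 𝒱 (twist 𝒱 r x) = counit 𝒱 x := by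
  induction x using totalDegree_induction with
  | mem n x hx =>
    rw [twist_of_mem 𝒱 r hx, map_smul]
    by_cases hn : n = 0
    · simp [hn]
    · rw [counit_of_mem_totalDegree hn hx, smul_zero]
  | add x y hx hy => simp only [map_add, hx, hy]

theorem twist_add (r s : ℤ) (x : GSym 𝒱) : twist 𝒱 (r + s) x = twist 𝒱 r (twist 𝒱 s x) := by
  induction x using totalDegree_induction with
  | mem n x hx =>
    rw [twist_of_mem 𝒱 s hx, map_smul, twist_of_mem 𝒱 r hx, twist_of_mem 𝒱 _ hx, smul_smul,
      ← zpow_add₀ (by simp), add_mul, add_comm]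
  | add x y hx hy => simp only [map_add, hx, hy]

theorem neg_one_zpow_mul_self (n : ℤ) : (-1 : K) ^ n * (-1 : K) ^ n = 1 := by
  rw [← zpow_add₀ (by simp), ← two_mul]
  exact (even_two_mul _).neg_one_zpow

theorem twist_zero (x : GSym 𝒱) : twist 𝒱 0 x = x := by
  induction x using totalDegree_induction with
  | mem n x hx => simp [twist_of_mem 𝒱 0 hx]
  | add x y hx hy => simp only [map_add, hx, hy]

theorem twist_one_twist_one (x : GSym 𝒱) : twist 𝒱 1 (twist 𝒱 1 x) = x := by
  induction x using totalDegree_induction with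
  | mem n x hx =>
    rw [twist_of_mem 𝒱 1 hx, map_smul, twist_of_mem 𝒱 1 hx, smul_smul, neg_one_zpow_mul_self,
      one_smul]
  | add x y hx hy => simp only [map_add, hx, hy]

theorem twist_mem_symPow (r : ℤ) {n : ℕ} {x : GSym 𝒱} (hx : x ∈ symPow 𝒱 n) :
    twist 𝒱 r x ∈ symPow 𝒱 n :=
  symMap_mem_symPow _ _ hx

/-- Graded commutativity of a generator with an arbitrary element: `twist 𝒱 m` supplies the Koszul
sign of moving v across x. -/
theorem twist_mul_gen {m : ℤ} {v : V} (hv : v ∈ 𝒱 m) (x : GSym 𝒱) :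
    twist 𝒱 m x * gen 𝒱 v = gen 𝒱 v * x := by
  induction x using gsym_induction with
  | one => simp
  | add x y hx hy => rw [map_add, add_mul, hx, hy, mul_add]
  | smul c x hx => rw [map_smul, smul_mul_assoc, hx, mul_smul_comm]
  | gen_mul n w hw x hx =>
    rw [map_mul, mul_assoc, hx, twist_gen 𝒱 m hw, smul_mul_assoc, ← mul_assoc, ← mul_assoc,
      gen_mul_gen 𝒱 hv hw, smul_mul_assoc]

end TotalDegree

end Basics

section Coalgebra

variable {K V W X : Type*} [Field K] [AddCommGroup V] [Module K V] [AddCommGroup W] [Module K W]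
  [AddCommGroup X] [Module K X]

/-! ### The gradings of `Sym V ⊗ Sym V` -/

/-- The subspace `⨁ Symⁱ V ⊗ Symʲ V`, `i + j = n`, of `Sym V ⊗ Sym V`. -/
def tensorPow (𝒱 : ℤ → Submodule K V) (n : ℕ) : Submodule K (GSym 𝒱 ⊗[K] GSym 𝒱) :=
  Submodule.span K {z | ∃ i j a b, i + j = n ∧ a ∈ symPow 𝒱 i ∧ b ∈ symPow 𝒱 j ∧ a ⊗ₜ b = z}

/-- The subspace of `Sym V ⊗ Sym V` of elements of total degree `n`. -/
def tensorDegree (𝒱 : ℤ → Submodule K V) (n : ℤ) : Submodule K (GSym 𝒱 ⊗[K] GSym 𝒱) :=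
  Submodule.span K
    {z | ∃ i j a b, i + j = n ∧ a ∈ totalDegree 𝒱 i ∧ b ∈ totalDegree 𝒱 j ∧ a ⊗ₜ b = z}

/-- Since Δ sends Symⁿ into `tensorPow 𝒱 n`, a term behind Δ vanishes once it does on Symⁱ ⊗ Symʲ
with i + j = n. The weight inductions below discard terms in this way. -/
theorem tensorPow_le_ker {𝒱 : ℤ → Submodule K V} {n : ℕ} {F : GSym 𝒱 ⊗[K] GSym 𝒱 →ₗ[K] X}
    (h : ∀ i j, i + j = n → ∀ a ∈ symPow 𝒱 i, ∀ b ∈ symPow 𝒱 j, F (a ⊗ₜ b) = 0)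
    {z : GSym 𝒱 ⊗[K] GSym 𝒱} (hz : z ∈ tensorPow 𝒱 n) : F z = 0 := by
  have hle : tensorPow 𝒱 n ≤ LinearMap.ker F := by
    refine Submodule.span_le.2 ?_
    rintro _ ⟨i, j, a, b, hij, ha, hb, rfl⟩
    exact h i j hij a ha b hb
  exact hle hz

theorem tensorPow_eq {𝒱 : ℤ → Submodule K V} {n : ℕ} {F G : GSym 𝒱 ⊗[K] GSym 𝒱 →ₗ[K] X}
    (h : ∀ i j, i + j = n → ∀ a ∈ symPow 𝒱 i, ∀ b ∈ symPow 𝒱 j, F (a ⊗ₜ b) = G (a ⊗ₜ b))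
    {z : GSym 𝒱 ⊗[K] GSym 𝒱} (hz : z ∈ tensorPow 𝒱 n) : F z = G z := by
  rw [← sub_eq_zero, ← LinearMap.sub_apply]
  refine tensorPow_le_ker (fun i j hij a ha b hb => ?_) hz
  rw [LinearMap.sub_apply, h i j hij a ha b hb, sub_self]

variable {𝒱 : ℤ → Submodule K V} [DirectSum.Decomposition 𝒱]

/-- Once the first factor is homogeneous, `twist` encodes the sign of the graded flip for an
arbitrary second factor, so only one factor has to be decomposed. -/
theorem tensor_ext_totalDegree {F G : GSym 𝒱 ⊗[K] W →ₗ[K] X}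
    (h : ∀ m, ∀ a ∈ totalDegree 𝒱 m, ∀ b, F (a ⊗ₜ b) = G (a ⊗ₜ b)) : F = G := by
  refine TensorProduct.ext' fun a b => ?_
  induction a using totalDegree_induction with
  | mem n x hx => exact h n x hx b
  | add x y hx hy => rw [TensorProduct.add_tmul, map_add, map_add, hx, hy]

theorem tensor_ext_totalDegree₃ {F G : (GSym 𝒱 ⊗[K] GSym 𝒱) ⊗[K] GSym 𝒱 →ₗ[K] X}
    (h : ∀ m, ∀ a ∈ totalDegree 𝒱 m, ∀ b d, F ((a ⊗ₜ b) ⊗ₜ d) = G ((a ⊗ₜ b) ⊗ₜ d)) : F = G :=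
  TensorProduct.ext (tensor_ext_totalDegree fun m a ha b => LinearMap.ext fun d => h m a ha b d)

theorem comul_mem_tensorPow {n : ℕ} {x : GSym 𝒱} (hx : x ∈ symPow 𝒱 n) :
    comul 𝒱 x ∈ tensorPow 𝒱 n := by
  induction n generalizing x with
  | zero =>
    obtain ⟨c, rfl⟩ := mem_symPow_zero 𝒱 hx
    rw [map_smul, comul_one]
    exact Submodule.smul_mem _ c (Submodule.subset_span
      ⟨0, 0, 1, 1, rfl, one_mem_symPow 𝒱, one_mem_symPow 𝒱, rfl⟩)
  | succ n ih =>
    refine (symPow_succ_le (q := (tensorPow 𝒱 (n + 1)).comap (comul 𝒱)) fun v x hx => ?_) hx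
    rw [Submodule.mem_comap, comul_gen_mul]
    induction v using DirectSum.Decomposition.inductionOn 𝒱 with
    | zero => simp
    | @homogeneous m v =>
      have hle : tensorPow 𝒱 n ≤ (tensorPow 𝒱 (n + 1)).comap (primAct 𝒱 (v : V)) := by
        refine Submodule.span_le.2 ?_
        rintro _ ⟨i, j, a, b, rfl, ha, hb, rfl⟩
        rw [SetLike.mem_coe, Submodule.mem_comap, primAct_of_mem 𝒱 v.2]
        refine add_mem (Submodule.subset_span ?_) (Submodule.subset_span ?_)
        · exact ⟨i + 1, j, _, _, by lia, gen_mul_mem_symPow _ ha, hb, rfl⟩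
        · exact ⟨i, j + 1, _, _, by lia, twist_mem_symPow 𝒱 m ha, gen_mul_mem_symPow _ hb, rfl⟩
      exact hle (ih hx)
    | add v w hv hw =>
      rw [map_add, LinearMap.add_apply]
      exact add_mem hv hw

theorem comul_hasDegree : HasDegree (totalDegree 𝒱) (tensorDegree 𝒱) 0 (comul 𝒱) := by
  refine hasDegree_of_gen_mul ?_ fun m n v hv x _ ih => ?_
  · rw [comul_one]
    exact Submodule.subset_span
      ⟨0, 0, 1, 1, by simp, one_mem_totalDegree 𝒱, one_mem_totalDegree 𝒱, rfl⟩
  · rw [comul_gen_mul]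
    rw [add_zero] at ih ⊢
    have hle : tensorDegree 𝒱 n ≤ (tensorDegree 𝒱 (m + n)).comap (primAct 𝒱 v) := by
      refine Submodule.span_le.2 ?_
      rintro _ ⟨i, j, a, b, rfl, ha, hb, rfl⟩
      rw [SetLike.mem_coe, Submodule.mem_comap, primAct_of_mem 𝒱 hv]
      refine add_mem (Submodule.subset_span ?_) (Submodule.subset_span ?_)
      · exact ⟨m + i, j, _, _, by ring, gen_mul_mem_totalDegree hv ha, hb, rfl⟩
      · exact ⟨i, m + j, _, _, by ring, by simpa using twist_hasDegree 𝒱 m i a ha,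
          gen_mul_mem_totalDegree hv hb, rfl⟩
    exact hle ih

theorem lift_comul_hasDegree {𝒳 : ℤ → Submodule K X} {r : ℤ} {β : GSym 𝒱 →ₗ[K] GSym 𝒱 →ₗ[K] X}
    (h : ∀ i j, ∀ a ∈ totalDegree 𝒱 i, ∀ b ∈ totalDegree 𝒱 j, β a b ∈ 𝒳 (i + j + r)) :
    HasDegree (totalDegree 𝒱) 𝒳 r (TensorProduct.lift β ∘ₗ comul 𝒱) := by
  rw [← zero_add r]
  refine HasDegree.comp (fun n z hz => ?_) comul_hasDegree
  have hle : tensorDegree 𝒱 n ≤ (𝒳 (n + r)).comap (TensorProduct.lift β) := by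
    refine Submodule.span_le.2 ?_
    rintro _ ⟨i, j, a, b, rfl, ha, hb, rfl⟩
    exact h i j a ha b hb
  exact hle hz

theorem mul_mem_totalDegree {𝒱 : ℤ → Submodule K V} {m n : ℤ} {x y : GSym 𝒱}
    (hx : x ∈ totalDegree 𝒱 m) (hy : y ∈ totalDegree 𝒱 n) :
    x * y ∈ totalDegree 𝒱 (m + n) := by
  refine (hasDegree_of_gen_mul (F := LinearMap.mulRight K y) (𝒳 := totalDegree 𝒱) (r := n) ?_ ?_)
    m x hx
  · simpa using hy
  · intro m k v hv x _ ih
    rw [LinearMap.mulRight_apply, mul_assoc, add_assoc]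
    exact gen_mul_mem_totalDegree hv ih

theorem conv_apply {𝒲 : ℤ → Submodule K W} (f g : GSym 𝒱 →ₗ[K] GSym 𝒲) :
    conv f g = TensorProduct.lift ((LinearMap.mul K (GSym 𝒲)).compl₁₂ f g) ∘ₗ comul 𝒱 := by
  rw [conv, ← LinearMap.comp_assoc]
  congr 1
  exact TensorProduct.ext' fun a b => by simp

theorem conv_hasDegree {𝒲 : ℤ → Submodule K W} {r s : ℤ} {f g : GSym 𝒱 →ₗ[K] GSym 𝒲}
    (hf : HasDegree (totalDegree 𝒱) (totalDegree 𝒲) r f)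
    (hg : HasDegree (totalDegree 𝒱) (totalDegree 𝒲) s g) :
    HasDegree (totalDegree 𝒱) (totalDegree 𝒲) (r + s) (conv f g) := by
  rw [conv_apply]
  refine lift_comul_hasDegree fun i j a ha b hb => ?_
  rw [add_add_add_comm]
  exact mul_mem_totalDegree (hf i a ha) (hg j b hb)

theorem coderivation_hasDegree {q : GSym 𝒱 →ₗ[K] V} {r : ℤ} (hq : HasDegree (totalDegree 𝒱) 𝒱 r q) :
    HasDegree (totalDegree 𝒱) (totalDegree 𝒱) r (coderivation q) := by
  have h := conv_hasDegree (gen_hasDegree.comp hq) (HasDegree.id (totalDegree 𝒱))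
  rwa [add_zero, add_zero] at h

/-! ### Counit, coassociativity and cocommutativity -/

variable (𝒱) in
theorem comul_twist (r : ℤ) (x : GSym 𝒱) :
    comul 𝒱 (twist 𝒱 r x) =
      TensorProduct.map (twist 𝒱 r).toLinearMap (twist 𝒱 r).toLinearMap (comul 𝒱 x) := by
  induction x using gsym_induction with
  | one => simp [comul_one]
  | add x y hx hy => simp only [map_add, hx, hy]
  | smul c x hx => simp only [map_smul, hx]
  | gen_mul m v hv x hx =>
    rw [map_mul, twist_gen 𝒱 r hv, smul_mul_assoc, map_smul, comul_gen_mul, comul_gen_mul, hx]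
    generalize comul 𝒱 x = z
    induction z using TensorProduct.induction_on with
    | zero => simp
    | add y z hy hz => simp only [map_add, smul_add, hy, hz]
    | tmul a b =>
      simp only [TensorProduct.map_tmul, AlgHom.toLinearMap_apply, primAct_of_mem 𝒱 hv, map_add,
        map_mul, twist_gen 𝒱 r hv, smul_mul_assoc, TensorProduct.tmul_smul, smul_add,
        ← TensorProduct.smul_tmul', twist_twist 𝒱 m r]

variable (𝒱) in
-- The counit kills multiples of generators, so only the summand of `primAct` with v in the right
-- factor survives, and its sign operator does not change the counit.
theorem counit_comul_left :
    TensorProduct.lift ((LinearMap.lsmul K (GSym 𝒱)).comp (counit 𝒱)) ∘ₗ comul 𝒱 =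
      LinearMap.id := by
  refine gsym_linearMap_ext (by simp [comul_one]) fun m v hv x hx => ?_
  rw [LinearMap.comp_apply] at hx
  rw [LinearMap.comp_apply, comul_gen_mul, LinearMap.id_apply]
  conv_rhs => rw [← LinearMap.id_apply (R := K) x, ← hx]
  generalize comul 𝒱 x = z
  induction z using TensorProduct.induction_on with
  | zero => simp
  | add y z hy hz => simp only [map_add, mul_add, hy, hz]
  | tmul a b => simp [primAct_of_mem 𝒱 hv, counit_twist]

variable (𝒱) in
theorem counit_comul_right :
    TensorProduct.lift ((LinearMap.lsmul K (GSym 𝒱)).comp (counit 𝒱)).flip ∘ₗ comul 𝒱 =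
      LinearMap.id := by
  refine gsym_linearMap_ext (by simp [comul_one]) fun m v hv x hx => ?_
  rw [LinearMap.comp_apply] at hx
  rw [LinearMap.comp_apply, comul_gen_mul, LinearMap.id_apply]
  conv_rhs => rw [← LinearMap.id_apply (R := K) x, ← hx]
  generalize comul 𝒱 x = z
  induction z using TensorProduct.induction_on with
  | zero => simp
  | add y z hy hz => simp only [map_add, mul_add, hy, hz]
  | tmul a b => simp [primAct_of_mem 𝒱 hv]

/-- A map of the form `a ⊗ b ↦ ε(b) φ(a)` sends `Δ x` to `φ x`. -/
theorem lift_comul_of_counit_right {β : GSym 𝒱 →ₗ[K] GSym 𝒱 →ₗ[K] X} {φ : GSym 𝒱 →ₗ[K] X}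
    (h : ∀ a b, β a b = counit 𝒱 b • φ a) (x : GSym 𝒱) :
    TensorProduct.lift β (comul 𝒱 x) = φ x := by
  have h2 : TensorProduct.lift β =
      φ ∘ₗ TensorProduct.lift ((LinearMap.lsmul K (GSym 𝒱)).comp (counit 𝒱)).flip :=
    TensorProduct.ext' fun a b => by simp [h]
  rw [h2]
  exact congrArg φ (LinearMap.congr_fun (counit_comul_right 𝒱) x)

variable (𝒱) in
-- Both iterated coproducts turn left multiplication by v into the same operator on the triple
-- tensor product: v is inserted in the first, second or third factor with its Koszul sign.
-- Induction on the letters finishes.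
theorem comul_coassoc (x : GSym 𝒱) :
    TensorProduct.assoc K _ _ _ (TensorProduct.map (comul 𝒱) LinearMap.id (comul 𝒱 x)) =
      TensorProduct.map LinearMap.id (comul 𝒱) (comul 𝒱 x) := by
  induction x using gsym_induction with
  | one => simp [comul_one]
  | add x y hx hy => simp only [map_add, hx, hy]
  | smul c x hx => simp only [map_smul, hx]
  | gen_mul m v hv x hx =>
    let P : Module.End K (GSym 𝒱 ⊗[K] (GSym 𝒱 ⊗[K] GSym 𝒱)) :=
      TensorProduct.map (LinearMap.mulLeft K (gen 𝒱 v)) LinearMap.id +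
        TensorProduct.map (twist 𝒱 m).toLinearMap (primAct 𝒱 v)
    have h1 : ∀ z, TensorProduct.map LinearMap.id (comul 𝒱) (primAct 𝒱 v z) =
        P (TensorProduct.map LinearMap.id (comul 𝒱) z) := by
      intro z
      induction z using TensorProduct.induction_on with
      | zero => simp
      | add y z hy hz => simp only [map_add, hy, hz]
      | tmul a b => simp [P, primAct_of_mem 𝒱 hv, comul_gen_mul]
    have h2 : ∀ z, TensorProduct.assoc K _ _ _
        (TensorProduct.map (comul 𝒱) LinearMap.id (primAct 𝒱 v z)) =
        P (TensorProduct.assoc K _ _ _ (TensorProduct.map (comul 𝒱) LinearMap.id z)) := by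
      intro z
      induction z using TensorProduct.induction_on with
      | zero => simp
      | add y z hy hz => simp only [map_add, hy, hz]
      | tmul a b =>
        simp only [primAct_of_mem 𝒱 hv, map_add, TensorProduct.map_tmul, comul_gen_mul,
          LinearMap.id_apply, comul_twist]
        generalize comul 𝒱 a = w
        induction w using TensorProduct.induction_on with
        | zero => simp
        | add y z hy hz =>
          simp only [map_add, TensorProduct.add_tmul, ← hy, ← hz]
          abel
        | tmul c d =>
          simp [P, primAct_of_mem 𝒱 hv, TensorProduct.add_tmul, TensorProduct.tmul_add, add_assoc]
    rw [comul_gen_mul, h1, h2, hx]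

variable (𝒱) in
/-- The graded flip `a ⊗ b ↦ (-1)^{|a||b|} b ⊗ a`. -/
def braid : Module.End K (GSym 𝒱 ⊗[K] GSym 𝒱) :=
  let σ := (TensorProduct.comm K (GSym 𝒱) (GSym 𝒱)).toLinearMap
  let t := TensorProduct.map (twist 𝒱 1).toLinearMap (LinearMap.id (R := K) (M := GSym 𝒱))
  (2 : K)⁻¹ • (σ + t ∘ₗ σ + σ ∘ₗ t - t ∘ₗ σ ∘ₗ t)

/-- The recursion Δ(v ∨ z) = v · Δ z, applied with v = q(x₍₁₎) and z = G(x₍₂₎). -/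
theorem comul_conv {𝒲 : ℤ → Submodule K W} [DirectSum.Decomposition 𝒲] (q : GSym 𝒱 →ₗ[K] W)
    (G : GSym 𝒱 →ₗ[K] GSym 𝒲) :
    comul 𝒲 ∘ₗ conv (gen 𝒲 ∘ₗ q) G =
      TensorProduct.lift ((primAct 𝒲 ∘ₗ q).compl₂ (comul 𝒲 ∘ₗ G)) ∘ₗ comul 𝒱 := by
  rw [conv_apply, ← LinearMap.comp_assoc]
  congr 1
  exact TensorProduct.ext' fun a b => by simp [comul_gen_mul]

variable [CharZero K]

/-- The four summands of `braid` combine to the Koszul sign because 1 + (-1)^m + (-1)^n − (-1)^{m+n}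
= 2 (-1)^{mn}. -/
theorem braid_of_mem {m : ℤ} {a : GSym 𝒱} (ha : a ∈ totalDegree 𝒱 m) (b : GSym 𝒱) :
    braid 𝒱 (a ⊗ₜ b) = twist 𝒱 m b ⊗ₜ a := by
  have h2 : (2 : K) ≠ 0 := two_ne_zero
  have hT : twist 𝒱 1 a = (-1 : K) ^ m • a := by rw [twist_of_mem 𝒱 1 ha, one_mul]
  simp only [braid, LinearMap.smul_apply, LinearMap.add_apply, LinearMap.sub_apply,
    LinearMap.comp_apply, TensorProduct.map_tmul, LinearEquiv.coe_coe, TensorProduct.comm_tmul,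
    LinearMap.id_apply, AlgHom.toLinearMap_apply, hT,
    ← TensorProduct.smul_tmul', map_smul]
  rcases Int.even_or_odd m with h | h
  · have hb : twist 𝒱 m b = b := by
      induction b using totalDegree_induction with
      | mem n x hx => rw [twist_of_mem 𝒱 m hx, (h.mul_right n).neg_one_zpow, one_smul]
      | add x y hx hy => rw [map_add, hx, hy]
    have : ∀ p q : GSym 𝒱 ⊗[K] GSym 𝒱, p + q + p - q = (2 : K) • p := fun p q => by
      rw [two_smul]; abel
    rw [h.neg_one_zpow, hb, one_smul, one_smul, this, smul_smul, inv_mul_cancel₀ h2, one_smul]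
  · have hb : twist 𝒱 m b = twist 𝒱 1 b := by
      induction b using totalDegree_induction with
      | mem n x hx =>
        rw [twist_of_mem 𝒱 m hx, twist_of_mem 𝒱 1 hx]
        obtain ⟨k, rfl⟩ := h
        have : (2 * k + 1) * n = 2 * (k * n) + 1 * n := by ring
        rw [this, zpow_add₀ (by simp), (even_two_mul _).neg_one_zpow, one_mul]
      | add x y hx hy => rw [map_add, map_add, hx, hy]
    rw [h.neg_one_zpow, hb]
    simp only [neg_smul, one_smul]
    have : ∀ p q : GSym 𝒱 ⊗[K] GSym 𝒱, p + q + -p - -q = (2 : K) • q := fun p q => by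
      rw [two_smul]; abel
    rw [this, smul_smul, inv_mul_cancel₀ h2, one_smul]

variable (𝒱) in
-- Cocommutativity: the graded flip commutes with the action of v, exchanging the summands that put
-- v in the left and in the right factor.
theorem braid_comul (x : GSym 𝒱) : braid 𝒱 (comul 𝒱 x) = comul 𝒱 x := by
  induction x using gsym_induction with
  | one =>
    rw [comul_one, braid_of_mem (one_mem_totalDegree 𝒱), map_one]
  | add x y hx hy => simp only [map_add, hx, hy]
  | smul c x hx => simp only [map_smul, hx]
  | gen_mul m v hv x hx =>
    have h : braid 𝒱 ∘ₗ primAct 𝒱 v = primAct 𝒱 v ∘ₗ braid 𝒱 := by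
      refine tensor_ext_totalDegree fun n a ha b => ?_
      have hs : twist 𝒱 m a ∈ totalDegree 𝒱 n := by simpa using twist_hasDegree 𝒱 m n a ha
      rw [LinearMap.comp_apply, LinearMap.comp_apply, braid_of_mem ha, primAct_of_mem 𝒱 hv,
        primAct_of_mem 𝒱 hv, map_add, braid_of_mem (gen_mul_mem_totalDegree hv ha),
        braid_of_mem hs, twist_of_mem 𝒱 m ha, map_mul, twist_gen 𝒱 n hv, smul_mul_assoc,
        TensorProduct.tmul_smul, TensorProduct.smul_tmul', smul_smul, mul_comm n m,
        neg_one_zpow_mul_self, one_smul, twist_add, add_comm]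
    rw [comul_gen_mul, ← LinearMap.comp_apply, h, LinearMap.comp_apply, hx]

/-! ### Coderivations -/

/-- The operator `x ↦ ∑ primAct (q x₍₁₎) ((G ⊗ G) Δ x₍₂₎)` in terms of the convolution of `q` and
`G`. -/
theorem lift_primAct_comul {𝒲 : ℤ → Submodule K W} [DirectSum.Decomposition 𝒲] {r : ℤ}
    {q : GSym 𝒱 →ₗ[K] W} (hq : HasDegree (totalDegree 𝒱) 𝒲 r q)
    (G : GSym 𝒱 →ₗ[K] GSym 𝒲) (hG : HasDegree (totalDegree 𝒱) (totalDegree 𝒲) 0 G) :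
    TensorProduct.lift ((primAct 𝒲 ∘ₗ q).compl₂ (TensorProduct.map G G ∘ₗ comul 𝒱)) ∘ₗ comul 𝒱 =
      TensorProduct.map (conv (gen 𝒲 ∘ₗ q) G) G ∘ₗ comul 𝒱 +
      TensorProduct.map ((twist 𝒲 r).toLinearMap ∘ₗ G) (conv (gen 𝒲 ∘ₗ q) G) ∘ₗ comul 𝒱 := by
  set c := LinearMap.mul' K (GSym 𝒲) ∘ₗ TensorProduct.map (gen 𝒲 ∘ₗ q) G with hc
  have hconv : conv (gen 𝒲 ∘ₗ q) G = c ∘ₗ comul 𝒱 := by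
    rw [hc, LinearMap.comp_assoc, conv]
  set Ψ := TensorProduct.lift ((primAct 𝒲 ∘ₗ q).compl₂ (TensorProduct.map G G))
  set Bq := TensorProduct.map ((twist 𝒲 r).toLinearMap ∘ₗ G) c ∘ₗ
    (TensorProduct.assoc K (GSym 𝒱) (GSym 𝒱) (GSym 𝒱)).toLinearMap
  have h1 : TensorProduct.lift ((primAct 𝒲 ∘ₗ q).compl₂ (TensorProduct.map G G ∘ₗ comul 𝒱)) =
      Ψ ∘ₗ TensorProduct.map LinearMap.id (comul 𝒱) :=
    TensorProduct.ext' fun a b => by simp [Ψ]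
  -- In the second summand q(a) has passed b with sign (-1)^{(|a|+r)|b|}. The part |a||b| is the
  -- sign of braiding a with b; the part r|b| remains as `twist 𝒲 r`.
  have h2 : Ψ ∘ₗ (TensorProduct.assoc K (GSym 𝒱) (GSym 𝒱) (GSym 𝒱)).toLinearMap =
      TensorProduct.map c G + Bq ∘ₗ TensorProduct.map (braid 𝒱) LinearMap.id := by
    refine tensor_ext_totalDegree₃ fun m a ha b d => ?_
    have hqa := hq m a ha
    simp only [LinearMap.comp_apply,
      LinearMap.add_apply, TensorProduct.map_tmul, LinearEquiv.coe_coe, TensorProduct.assoc_tmul,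
      braid_of_mem ha, Ψ, Bq, TensorProduct.lift.tmul, LinearMap.compl₂_apply,
      primAct_of_mem 𝒲 hqa, hc, LinearMap.mul'_apply, LinearMap.id_apply, AlgHom.toLinearMap_apply]
    have h3 := hG.twist_comm m b
    rw [mul_zero, zpow_zero, one_smul] at h3
    rw [← h3, ← twist_add, add_comm r m]
  refine LinearMap.ext fun x => ?_
  rw [h1, LinearMap.comp_apply, LinearMap.comp_apply, ← comul_coassoc]
  have h3 := LinearMap.congr_fun h2 (TensorProduct.map (comul 𝒱) LinearMap.id (comul 𝒱 x))
  rw [LinearMap.comp_apply, LinearEquiv.coe_coe] at h3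
  -- Cocommutativity removes the braiding.
  have h4 : TensorProduct.map (braid 𝒱) LinearMap.id
      (TensorProduct.map (comul 𝒱) LinearMap.id (comul 𝒱 x)) =
      TensorProduct.map (comul 𝒱) LinearMap.id (comul 𝒱 x) := by
    rw [← LinearMap.comp_apply, ← TensorProduct.map_comp, LinearMap.id_comp]
    congr 2
    exact LinearMap.ext (braid_comul 𝒱)
  rw [h3, LinearMap.add_apply, LinearMap.comp_apply, h4, hconv, LinearMap.add_apply]
  congr 1
  · rw [← LinearMap.comp_apply, ← TensorProduct.map_comp, LinearMap.comp_id, LinearMap.comp_apply]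
  · simp only [Bq]
    rw [LinearMap.comp_apply, LinearEquiv.coe_coe, comul_coassoc, ← LinearMap.comp_apply,
      ← TensorProduct.map_comp, LinearMap.comp_id, LinearMap.comp_apply]

/-- The case G = id of `lift_primAct_comul`: an operator of degree r passes the left factor a at the
cost of (-1)^{r|a|}. -/
theorem comul_coderivation {q : GSym 𝒱 →ₗ[K] V} {r : ℤ} (hq : HasDegree (totalDegree 𝒱) 𝒱 r q) :
    comul 𝒱 ∘ₗ coderivation q =
      TensorProduct.map (coderivation q) LinearMap.id ∘ₗ comul 𝒱 +
      TensorProduct.map (twist 𝒱 r).toLinearMap (coderivation q) ∘ₗ comul 𝒱 := by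
  have h := lift_primAct_comul hq LinearMap.id (HasDegree.id _)
  rw [TensorProduct.map_id, LinearMap.id_comp, LinearMap.comp_id] at h
  rw [coderivation, comul_conv, LinearMap.comp_id, h]

end Coalgebra

section Morphisms

variable {K V W X : Type*} [Field K] [AddCommGroup V] [Module K V] [AddCommGroup W] [Module K W]
  [AddCommGroup X] [Module K X]
  {𝒱 : ℤ → Submodule K V} [DirectSum.Decomposition 𝒱] {𝒲 : ℤ → Submodule K W}

/-! ### Convolution with a map to the cogenerators -/

theorem conv_apply_one (f g : GSym 𝒱 →ₗ[K] GSym 𝒲) : conv f g 1 = f 1 * g 1 := by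
  simp [conv, comul_one]

theorem conv_sub_right (f g g' : GSym 𝒱 →ₗ[K] GSym 𝒲) : conv f (g - g') = conv f g - conv f g' := by
  have h : TensorProduct.map f (g - g') = TensorProduct.map f g - TensorProduct.map f g' :=
    TensorProduct.ext' fun a b => by simp [TensorProduct.tmul_sub]
  rw [conv, h, LinearMap.sub_comp, LinearMap.comp_sub, conv, conv]

theorem conv_sum_right {ι : Type*} (s : Finset ι) (f : GSym 𝒱 →ₗ[K] GSym 𝒲)
    (g : ι → GSym 𝒱 →ₗ[K] GSym 𝒲) : conv f (∑ n ∈ s, g n) = ∑ n ∈ s, conv f (g n) := by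
  classical
  induction s using Finset.induction_on with
  | empty => simp [conv]
  | insert a s ha ih =>
    rw [Finset.sum_insert ha, Finset.sum_insert ha, ← ih, conv, TensorProduct.map_add_right,
      LinearMap.add_comp, LinearMap.comp_add, conv, conv]

theorem conv_add_left (f f' g : GSym 𝒱 →ₗ[K] GSym 𝒲) :
    conv (f + f') g = conv f g + conv f' g := by
  rw [conv, TensorProduct.map_add_left, LinearMap.add_comp, LinearMap.comp_add, conv, conv]

theorem conv_comp_of_comul {U : Type*} [AddCommGroup U] [Module K U] {𝒰 : ℤ → Submodule K U}
    [DirectSum.Decomposition 𝒰] {F F' F'' : GSym 𝒰 →ₗ[K] GSym 𝒱}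
    (hF : comul 𝒱 ∘ₗ F = TensorProduct.map F' F'' ∘ₗ comul 𝒰) (f g : GSym 𝒱 →ₗ[K] GSym 𝒲) :
    conv f g ∘ₗ F = conv (f ∘ₗ F') (g ∘ₗ F'') := by
  rw [conv, conv, TensorProduct.map_comp, LinearMap.comp_assoc, LinearMap.comp_assoc, hF]
  rfl

theorem conv_comp_of_comul_add {U : Type*} [AddCommGroup U] [Module K U] {𝒰 : ℤ → Submodule K U}
    [DirectSum.Decomposition 𝒰] {F F₁ F₂ F₃ F₄ : GSym 𝒰 →ₗ[K] GSym 𝒱}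
    (hF : comul 𝒱 ∘ₗ F = TensorProduct.map F₁ F₂ ∘ₗ comul 𝒰 + TensorProduct.map F₃ F₄ ∘ₗ comul 𝒰)
    (f g : GSym 𝒱 →ₗ[K] GSym 𝒲) :
    conv f g ∘ₗ F = conv (f ∘ₗ F₁) (g ∘ₗ F₂) + conv (f ∘ₗ F₃) (g ∘ₗ F₄) := by
  rw [conv, conv, conv, TensorProduct.map_comp, TensorProduct.map_comp, LinearMap.comp_assoc,
    LinearMap.comp_assoc, hF, LinearMap.comp_add, LinearMap.comp_add]
  rfl

theorem counit_conv (q : GSym 𝒱 →ₗ[K] W) (G : GSym 𝒱 →ₗ[K] GSym 𝒲) (x : GSym 𝒱) :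
    counit 𝒲 (conv (gen 𝒲 ∘ₗ q) G x) = 0 := by
  have h : counit 𝒲 ∘ₗ conv (gen 𝒲 ∘ₗ q) G = 0 := by
    rw [conv_apply, ← LinearMap.comp_assoc]
    have : counit 𝒲 ∘ₗ TensorProduct.lift
        ((LinearMap.mul K (GSym 𝒲)).compl₁₂ (gen 𝒲 ∘ₗ q) G) = 0 :=
      TensorProduct.ext' fun a b => by simp
    rw [this, LinearMap.zero_comp]
  exact LinearMap.congr_fun h x

/-- On v ∨ b the cogenerator map gives the counit of b times v, so by the counit axiom only q
remains. -/
theorem cogen_conv (q : GSym 𝒱 →ₗ[K] W) {G : GSym 𝒱 →ₗ[K] GSym 𝒲}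
    (hG : counit 𝒲 ∘ₗ G = counit 𝒱) (x : GSym 𝒱) : cogen 𝒲 (conv (gen 𝒲 ∘ₗ q) G x) = q x := by
  have h : cogen 𝒲 ∘ₗ TensorProduct.lift ((LinearMap.mul K (GSym 𝒲)).compl₁₂ (gen 𝒲 ∘ₗ q) G) =
      TensorProduct.lift
        (((LinearMap.mul K (GSym 𝒲)).compl₁₂ (gen 𝒲 ∘ₗ q) G).compr₂ (cogen 𝒲)) :=
    TensorProduct.ext' fun a b => by simp
  rw [conv_apply, ← LinearMap.comp_apply, ← LinearMap.comp_assoc, h, LinearMap.comp_apply]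
  refine lift_comul_of_counit_right (fun a b => ?_) x
  have hb := LinearMap.congr_fun hG b
  rw [LinearMap.comp_apply] at hb
  simp [hb]

theorem cogen_coderivation (q : GSym 𝒱 →ₗ[K] V) (x : GSym 𝒱) :
    cogen 𝒱 (coderivation q x) = q x :=
  cogen_conv q (LinearMap.comp_id _) x

theorem counit_coderivation (q : GSym 𝒱 →ₗ[K] V) (x : GSym 𝒱) :
    counit 𝒱 (coderivation q x) = 0 :=
  counit_conv q _ x

theorem coderivation_one {q : GSym 𝒱 →ₗ[K] V} (hq : q 1 = 0) : coderivation q 1 = 0 := by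
  rw [coderivation, conv_apply_one, LinearMap.comp_apply, hq, map_zero, zero_mul]

theorem coderivation_add (q q' : GSym 𝒱 →ₗ[K] V) :
    coderivation (q + q') = coderivation q + coderivation q' := by
  rw [coderivation, LinearMap.comp_add, conv_add_left, coderivation, coderivation]

/-- A coderivation whose only structure map is linear is a derivation. -/
theorem coderivation_linear_gen_mul {r : ℤ} {φ : V →ₗ[K] V} (hφ : HasDegree 𝒱 𝒱 r φ) {m : ℤ} {v : V}
    (hv : v ∈ 𝒱 m) (x : GSym 𝒱) :
    coderivation (φ ∘ₗ cogen 𝒱) (gen 𝒱 v * x) =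
      gen 𝒱 (φ v) * x + (-1 : K) ^ (r * m) • (gen 𝒱 v * coderivation (φ ∘ₗ cogen 𝒱) x) := by
  -- The sign from v passing w inside Δ cancels the one from moving v back; what is left is
  -- (-1)^{rm} from v passing φ.
  have hcomm : ∀ w, gen 𝒱 (φ (degSign 𝒱 m w)) * gen 𝒱 v =
      (-1 : K) ^ (r * m) • (gen 𝒱 v * gen 𝒱 (φ w)) := by
    intro w
    induction w using DirectSum.Decomposition.inductionOn 𝒱 with
    | zero => simp
    | @homogeneous n w =>
      rw [degSign_of_mem 𝒱 m w.2, map_smul, map_smul, smul_mul_assoc,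
        gen_mul_gen 𝒱 (hφ n w w.2) hv, smul_smul, add_mul, zpow_add₀ (by simp), ← mul_assoc,
        mul_comm n m, neg_one_zpow_mul_self, one_mul]
    | add w w' hw hw' => simp only [map_add, add_mul, hw, hw', mul_add, smul_add]
  have hx : x = TensorProduct.lift ((LinearMap.lsmul K (GSym 𝒱)).comp (counit 𝒱)) (comul 𝒱 x) :=
    (LinearMap.congr_fun (counit_comul_left 𝒱) x).symm
  have key : ∀ z, LinearMap.mul' K (GSym 𝒱)
      (TensorProduct.map (gen 𝒱 ∘ₗ φ ∘ₗ cogen 𝒱) LinearMap.id (primAct 𝒱 v z)) =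
      gen 𝒱 (φ v) * TensorProduct.lift ((LinearMap.lsmul K (GSym 𝒱)).comp (counit 𝒱)) z +
      (-1 : K) ^ (r * m) • (gen 𝒱 v * LinearMap.mul' K (GSym 𝒱)
        (TensorProduct.map (gen 𝒱 ∘ₗ φ ∘ₗ cogen 𝒱) LinearMap.id z)) := by
    intro z
    induction z using TensorProduct.induction_on with
    | zero => simp
    | add y z hy hz =>
      simp only [map_add, hy, hz, mul_add, smul_add]
      abel
    | tmul a b =>
      simp only [primAct_of_mem 𝒱 hv, map_add, TensorProduct.map_tmul, LinearMap.comp_apply,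
        LinearMap.mul'_apply, cogen_gen_mul, map_smul, LinearMap.id_apply, TensorProduct.lift.tmul,
        LinearMap.lsmul_apply, smul_mul_assoc, mul_smul_comm, cogen_twist, ← mul_assoc, hcomm]
  conv_rhs => enter [1]; rw [hx]
  simp only [coderivation, conv, LinearMap.comp_apply, comul_gen_mul]
  exact key _

theorem coderivation_linear_one (φ : V →ₗ[K] V) : coderivation (φ ∘ₗ cogen 𝒱) 1 = 0 :=
  coderivation_one (by simp)

theorem coderivation_linear_mem_symPow {r : ℤ} {φ : V →ₗ[K] V} (hφ : HasDegree 𝒱 𝒱 r φ) {n : ℕ}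
    {x : GSym 𝒱} (hx : x ∈ symPow 𝒱 n) : coderivation (φ ∘ₗ cogen 𝒱) x ∈ symPow 𝒱 n := by
  induction n generalizing x with
  | zero =>
    obtain ⟨c, rfl⟩ := mem_symPow_zero 𝒱 hx
    rw [map_smul, coderivation_linear_one, smul_zero]
    exact zero_mem _
  | succ n ih =>
    refine (symPow_succ_le (q := (symPow 𝒱 (n + 1)).comap (coderivation (φ ∘ₗ cogen 𝒱)))
      fun v x hx => ?_) hx
    rw [Submodule.mem_comap]
    induction v using DirectSum.Decomposition.inductionOn 𝒱 with
    | zero => simp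
    | @homogeneous m v =>
      rw [coderivation_linear_gen_mul hφ v.2]
      exact add_mem (gen_mul_mem_symPow _ hx)
        (Submodule.smul_mem _ _ (gen_mul_mem_symPow _ (ih hx)))
    | add v w hv hw =>
      rw [map_add, add_mul, map_add]
      exact add_mem hv hw

/-! ### The weight operator -/

theorem number_gen_mul (v : V) (x : GSym 𝒱) :
    coderivation (cogen 𝒱) (gen 𝒱 v * x) =
      gen 𝒱 v * x + gen 𝒱 v * coderivation (cogen 𝒱) x := by
  induction v using DirectSum.Decomposition.inductionOn 𝒱 with
  | zero => simp
  | @homogeneous m v =>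
    have h := coderivation_linear_gen_mul (HasDegree.id 𝒱) v.2 x
    simpa [LinearMap.id_comp] using h
  | add v w hv hw =>
    simp only [map_add, add_mul, hv, hw]
    abel

/-- The coderivation extending the identity acts on `Symⁿ V` as multiplication by `n`. -/
theorem number_of_mem {n : ℕ} {x : GSym 𝒱} (hx : x ∈ symPow 𝒱 n) :
    coderivation (cogen 𝒱) x = (n : K) • x := by
  induction n generalizing x with
  | zero =>
    obtain ⟨c, rfl⟩ := mem_symPow_zero 𝒱 hx
    rw [map_smul, coderivation_one (cogen_one 𝒱), smul_zero, Nat.cast_zero, zero_smul]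
  | succ n ih =>
    have h := symPow_succ_le (q := LinearMap.ker
      (coderivation (cogen 𝒱) - ((n + 1 : ℕ) : K) • LinearMap.id)) (fun v x hx => by
        rw [LinearMap.mem_ker, LinearMap.sub_apply, number_gen_mul, ih hx, LinearMap.smul_apply,
          LinearMap.id_apply, mul_smul_comm, Nat.cast_add, Nat.cast_one, add_smul, one_smul]
        abel) hx
    rw [LinearMap.mem_ker, LinearMap.sub_apply, sub_eq_zero] at h
    exact h

theorem proj_number (n : ℕ) (x : GSym 𝒱) :
    proj 𝒱 n (coderivation (cogen 𝒱) x) = (n : K) • proj 𝒱 n x := by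
  induction x using symPow_induction with
  | mem m x hx =>
    rw [number_of_mem hx, map_smul]
    by_cases h : m = n
    · rw [h]
    · rw [proj_of_mem_ne 𝒱 h hx, smul_zero, smul_zero]
  | add x y hx hy => rw [map_add, map_add, map_add, hx, hy, smul_add]

theorem proj_conv_succ (n : ℕ) (q : GSym 𝒱 →ₗ[K] W) (G : GSym 𝒱 →ₗ[K] GSym 𝒲) (x : GSym 𝒱) :
    proj 𝒲 (n + 1) (conv (gen 𝒲 ∘ₗ q) G x) = conv (gen 𝒲 ∘ₗ q) (proj 𝒲 n ∘ₗ G) x := by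
  simp only [conv, LinearMap.comp_apply]
  generalize comul 𝒱 x = z
  induction z using TensorProduct.induction_on with
  | zero => simp
  | add y z hy hz => simp only [map_add, hy, hz]
  | tmul a b => simp [proj_gen_mul_succ]

/-- The weight operator is cogen * id, and precomposing a convolution with a comultiplicative map
inserts that map in both factors. The result is the differential equation of an exponential. -/
theorem IsCoalgebraMorphism.number_comp [DirectSum.Decomposition 𝒲] {F : GSym 𝒱 →ₗ[K] GSym 𝒲}
    (hF : IsCoalgebraMorphism F) :
    coderivation (cogen 𝒲) ∘ₗ F = conv (gen 𝒲 ∘ₗ cogen 𝒲 ∘ₗ F) F := by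
  rw [coderivation, conv_comp_of_comul hF.comul_comp, LinearMap.id_comp, LinearMap.comp_assoc]

theorem tensor_eq_zero_of_proj {𝒱 : ℤ → Submodule K V} (z : GSym 𝒱 ⊗[K] GSym 𝒱)
    (h : ∀ a b, TensorProduct.map (proj 𝒱 a) (proj 𝒱 b) z = 0) : z = 0 := by
  have key : ∃ M, ∀ m, M ≤ m →
      TensorProduct.map (∑ n ∈ Finset.range m, proj 𝒱 n) (∑ n ∈ Finset.range m, proj 𝒱 n) z =
        z := by
    clear h
    induction z using TensorProduct.induction_on with
    | zero => exact ⟨0, by simp⟩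
    | tmul x y =>
      obtain ⟨M, hM⟩ := exists_sum_proj 𝒱 x
      obtain ⟨N, hN⟩ := exists_sum_proj 𝒱 y
      refine ⟨max M N, fun m hm => ?_⟩
      rw [TensorProduct.map_tmul, LinearMap.sum_apply, LinearMap.sum_apply,
        hM m (le_trans (le_max_left _ _) hm), hN m (le_trans (le_max_right _ _) hm)]
    | add x y hx hy =>
      obtain ⟨M, hM⟩ := hx
      obtain ⟨N, hN⟩ := hy
      refine ⟨max M N, fun m hm => ?_⟩
      rw [map_add, hM m (le_trans (le_max_left _ _) hm), hN m (le_trans (le_max_right _ _) hm)]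
  obtain ⟨M, hM⟩ := key
  rw [← hM M le_rfl]
  have h2 : ∀ (s t : Finset ℕ), TensorProduct.map (∑ n ∈ s, proj 𝒱 n) (∑ n ∈ t, proj 𝒱 n) =
      ∑ a ∈ s, ∑ b ∈ t, TensorProduct.map (proj 𝒱 a) (proj 𝒱 b) := by
    intro s t
    refine TensorProduct.ext' fun x y => ?_
    simp only [TensorProduct.map_tmul, LinearMap.sum_apply, TensorProduct.sum_tmul,
      TensorProduct.tmul_sum]
    exact Finset.sum_comm
  rw [h2, LinearMap.sum_apply]
  refine Finset.sum_eq_zero fun a _ => ?_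
  rw [LinearMap.sum_apply]
  exact Finset.sum_eq_zero fun b _ => h a b

variable (𝒱) in
theorem map_counit_comul (x : GSym 𝒱) :
    TensorProduct.map (counit 𝒱) (counit 𝒱) (comul 𝒱 x) = counit 𝒱 x ⊗ₜ 1 := by
  have h2 : TensorProduct.map (counit 𝒱) (counit 𝒱) =
      TensorProduct.lift ((TensorProduct.mk K K K).compl₁₂ (counit 𝒱) (counit 𝒱)) :=
    TensorProduct.ext' fun a b => by simp
  rw [h2]
  refine lift_comul_of_counit_right
    (φ := (TensorProduct.mk K K K).flip 1 ∘ₗ counit 𝒱) (fun a b => ?_) x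
  change counit 𝒱 a ⊗ₜ counit 𝒱 b = counit 𝒱 b • (counit 𝒱 a ⊗ₜ (1 : K))
  rw [← TensorProduct.tmul_smul, smul_eq_mul, mul_one]

/-- The weight operator of `Sym V ⊗ Sym V`. -/
def tensorNumber (𝒱 : ℤ → Submodule K V) [DirectSum.Decomposition 𝒱] :
    Module.End K (GSym 𝒱 ⊗[K] GSym 𝒱) :=
  TensorProduct.map (coderivation (cogen 𝒱)) LinearMap.id +
    TensorProduct.map LinearMap.id (coderivation (cogen 𝒱))

theorem proj_tensorNumber (a b : ℕ) (z : GSym 𝒱 ⊗[K] GSym 𝒱) :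
    TensorProduct.map (proj 𝒱 a) (proj 𝒱 b) (tensorNumber 𝒱 z) =
      ((a + b : ℕ) : K) • TensorProduct.map (proj 𝒱 a) (proj 𝒱 b) z := by
  induction z using TensorProduct.induction_on with
  | zero => simp
  | add y z hy hz => simp only [map_add, hy, hz, smul_add]
  | tmul x y =>
    simp [tensorNumber, proj_number, add_smul, TensorProduct.smul_tmul', TensorProduct.tmul_smul]

/-! ### The convolution exponential -/

/-- The summand `f^{*n} / n!` of the convolution exponential of `f`. -/
def expTerm (f : GSym 𝒱 →ₗ[K] W) : ℕ → GSym 𝒱 →ₗ[K] GSym 𝒲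
  | 0 => Algebra.linearMap K (GSym 𝒲) ∘ₗ counit 𝒱
  | n + 1 => ((n + 1 : ℕ) : K)⁻¹ • conv (gen 𝒲 ∘ₗ f) (expTerm f n)

/-- The convolution exponential of `f`, the coalgebra morphism with structure maps `f`. -/
def coexp (𝒲 : ℤ → Submodule K W) (f : GSym 𝒱 →ₗ[K] W) : GSym 𝒱 →ₗ[K] GSym 𝒲 :=
  assemble 𝒱 fun m => ∑ n ∈ Finset.range (m + 1), expTerm f n

variable {f : GSym 𝒱 →ₗ[K] W}

theorem expTerm_mem (n : ℕ) (x : GSym 𝒱) : (expTerm f n x : GSym 𝒲) ∈ symPow 𝒲 n := by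
  induction n generalizing x with
  | zero =>
    rw [expTerm, LinearMap.comp_apply, Algebra.linearMap_apply, Algebra.algebraMap_eq_smul_one]
    exact Submodule.smul_mem _ _ (one_mem_symPow 𝒲)
  | succ n ih =>
    rw [expTerm, LinearMap.smul_apply, conv, LinearMap.comp_apply, LinearMap.comp_apply]
    refine Submodule.smul_mem _ _ ?_
    generalize comul 𝒱 x = z
    induction z using TensorProduct.induction_on with
    | zero => simp
    | add y z hy hz =>
      rw [map_add, map_add]
      exact add_mem hy hz
    | tmul a b => exact gen_mul_mem_symPow _ (ih b)

/-- As f kills constants, each of the n convolution factors uses up at least one letter. This makes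
the exponential series finite on every Symᵐ. -/
theorem expTerm_of_lt (hf1 : f 1 = 0) {m n : ℕ} (hmn : m < n) {x : GSym 𝒱} (hx : x ∈ symPow 𝒱 m) :
    (expTerm f n x : GSym 𝒲) = 0 := by
  induction n generalizing m x with
  | zero => lia
  | succ n ih =>
    rw [expTerm, LinearMap.smul_apply, conv_apply, LinearMap.comp_apply]
    rw [tensorPow_le_ker (fun i j hij a ha b hb => ?_) (comul_mem_tensorPow hx), smul_zero]
    rw [TensorProduct.lift.tmul, LinearMap.compl₁₂_apply]
    rcases i with _ | i
    · obtain ⟨c, rfl⟩ := mem_symPow_zero 𝒱 ha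
      rw [map_smul, LinearMap.comp_apply, hf1, map_zero, smul_zero, map_zero, LinearMap.zero_apply]
    · rw [ih (show j < n by lia) hb, map_zero]

theorem coexp_of_mem (hf1 : f 1 = 0) {m M : ℕ} (hm : m < M) {x : GSym 𝒱} (hx : x ∈ symPow 𝒱 m) :
    coexp 𝒲 f x = (∑ n ∈ Finset.range M, expTerm f n) x := by
  rw [coexp, assemble_of_mem _ hx, LinearMap.sum_apply, LinearMap.sum_apply]
  refine Finset.sum_subset (Finset.range_subset_range.2 hm) fun n _ hn => ?_
  rw [Finset.mem_range, not_lt] at hn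
  exact expTerm_of_lt hf1 hn hx

theorem coexp_hasDegree (hf : HasDegree (totalDegree 𝒱) 𝒲 0 f) :
    HasDegree (totalDegree 𝒱) (totalDegree 𝒲) 0 (coexp 𝒲 f) := by
  have ht : ∀ n, HasDegree (totalDegree 𝒱) (totalDegree 𝒲) 0 (expTerm f n) := by
    intro n
    induction n with
    | zero =>
      intro n x hx
      rw [expTerm, LinearMap.comp_apply, Algebra.linearMap_apply, Algebra.algebraMap_eq_smul_one]
      by_cases hn : n = 0
      · rw [hn]
        exact Submodule.smul_mem _ _ (one_mem_totalDegree 𝒲)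
      · rw [counit_of_mem_totalDegree hn hx, zero_smul]
        exact zero_mem _
    | succ n ih =>
      have h := (conv_hasDegree (gen_hasDegree.comp hf) ih).smul ((n + 1 : ℕ) : K)⁻¹
      exact h
  exact assemble_hasDegree fun m => HasDegree.sum _ fun j _ => ht j

theorem counit_coexp (hf1 : f 1 = 0) : counit 𝒲 ∘ₗ coexp 𝒲 f = counit 𝒱 := by
  refine symPow_linearMap_ext fun m x hx => ?_
  rw [LinearMap.comp_apply, coexp_of_mem hf1 (Nat.lt_succ_self m) hx, LinearMap.sum_apply, map_sum,
    Finset.sum_range_succ', Finset.sum_eq_zero, zero_add, expTerm, LinearMap.comp_apply,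
    Algebra.linearMap_apply, Algebra.algebraMap_eq_smul_one, map_smul, counit_one, smul_eq_mul,
    mul_one]
  exact fun n _ => counit_of_mem 𝒲 n.succ_ne_zero (expTerm_mem (n + 1) x)

variable [CharZero K] [DirectSum.Decomposition 𝒲]

/-- The component of weight n + 1 of the equation reads (n+1) E_{n+1} = f * E_n, so in
characteristic 0 all components vanish with E₀, and E₀ is the counit part. It serves for differences
of coalgebra morphisms, for Q² and for Q_A P − P Q_B. -/
theorem eq_zero_of_number {E : GSym 𝒱 →ₗ[K] GSym 𝒲} {f : GSym 𝒱 →ₗ[K] W}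
    (h : coderivation (cogen 𝒲) ∘ₗ E = conv (gen 𝒲 ∘ₗ f) E) (h0 : counit 𝒲 ∘ₗ E = 0) : E = 0 := by
  have key : ∀ n, proj 𝒲 n ∘ₗ E = 0 := by
    intro n
    induction n with
    | zero =>
      refine LinearMap.ext fun x => ?_
      have hx := LinearMap.congr_fun h0 x
      rw [LinearMap.comp_apply, LinearMap.zero_apply] at hx
      rw [LinearMap.comp_apply, proj_zero_apply, hx, zero_smul, LinearMap.zero_apply]
    | succ n ih =>
      refine LinearMap.ext fun x => ?_
      have hx := congrArg (proj 𝒲 (n + 1)) (LinearMap.congr_fun h x)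
      rw [LinearMap.comp_apply, proj_number, proj_conv_succ, ih] at hx
      have hz : conv (gen 𝒲 ∘ₗ f) (0 : GSym 𝒱 →ₗ[K] GSym 𝒲) = 0 := by
        rw [conv, TensorProduct.map_zero_right, LinearMap.zero_comp, LinearMap.comp_zero]
      rw [hz, LinearMap.zero_apply] at hx
      exact (smul_eq_zero.1 hx).resolve_left (Nat.cast_ne_zero.2 n.succ_ne_zero)
  exact LinearMap.ext fun x => eq_zero_of_proj 𝒲 _ fun n => LinearMap.congr_fun (key n) x

/-- Coalgebra morphisms are determined by their structure maps. -/
theorem IsCoalgebraMorphism.ext_cogen {F G : GSym 𝒱 →ₗ[K] GSym 𝒲} (hF : IsCoalgebraMorphism F)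
    (hG : IsCoalgebraMorphism G) (h : cogen 𝒲 ∘ₗ F = cogen 𝒲 ∘ₗ G) : F = G := by
  rw [← sub_eq_zero]
  refine eq_zero_of_number (f := cogen 𝒲 ∘ₗ F) ?_ ?_
  · rw [LinearMap.comp_sub, hF.number_comp, hG.number_comp, conv_sub_right, h]
  · rw [LinearMap.comp_sub, hF.counit_comp, hG.counit_comp, sub_self]

/-! ### The coalgebra morphism with given structure maps -/

/-- The operator is multiplication by a + b on Symᵃ ⊗ Symᵇ, hence injective except on Sym⁰ ⊗ Sym⁰,
which the counits detect. -/
theorem eq_zero_of_tensorNumber {z : GSym 𝒱 ⊗[K] GSym 𝒱} (h : tensorNumber 𝒱 z = 0)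
    (h0 : TensorProduct.map (counit 𝒱) (counit 𝒱) z = 0) : z = 0 := by
  refine tensor_eq_zero_of_proj z fun a b => ?_
  by_cases hab : a + b = 0
  · obtain ⟨rfl, rfl⟩ := Nat.add_eq_zero_iff.1 hab
    have hp : proj 𝒱 0 = Algebra.linearMap K (GSym 𝒱) ∘ₗ counit 𝒱 := LinearMap.ext fun x => by
      rw [proj_zero_apply, LinearMap.comp_apply, Algebra.linearMap_apply,
        Algebra.algebraMap_eq_smul_one]
    rw [hp, TensorProduct.map_comp, LinearMap.comp_apply, h0, map_zero]
  · have h2 := proj_tensorNumber a b z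
    rw [h, map_zero] at h2
    exact (smul_eq_zero.1 h2.symm).resolve_left (Nat.cast_ne_zero.2 hab)

variable (𝒱) in
theorem comul_number :
    comul 𝒱 ∘ₗ coderivation (cogen 𝒱) = tensorNumber 𝒱 ∘ₗ comul 𝒱 := by
  have h := comul_coderivation (cogen_hasDegree (𝒱 := 𝒱))
  have ht : (twist 𝒱 0).toLinearMap = LinearMap.id := LinearMap.ext (twist_zero 𝒱)
  rw [ht] at h
  rw [h, tensorNumber, LinearMap.add_comp]

/-- A map which satisfies the differential equation of the exponential of `f` respects the
coproducts. -/
theorem comul_comp_of_number {F : GSym 𝒱 →ₗ[K] GSym 𝒲} {f : GSym 𝒱 →ₗ[K] W}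
    (hf : HasDegree (totalDegree 𝒱) 𝒲 0 f) (hF : HasDegree (totalDegree 𝒱) (totalDegree 𝒲) 0 F)
    (hN : coderivation (cogen 𝒲) ∘ₗ F = conv (gen 𝒲 ∘ₗ f) F) (hf1 : f 1 = 0)
    (hc : counit 𝒲 ∘ₗ F = counit 𝒱) :
    comul 𝒲 ∘ₗ F = TensorProduct.map F F ∘ₗ comul 𝒱 := by
  have ht : (twist 𝒲 0).toLinearMap = LinearMap.id := LinearMap.ext (twist_zero 𝒲)
  have hX : tensorNumber 𝒲 ∘ₗ comul 𝒲 ∘ₗ F =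
      TensorProduct.lift ((primAct 𝒲 ∘ₗ f).compl₂ (comul 𝒲 ∘ₗ F)) ∘ₗ comul 𝒱 := by
    rw [← comul_conv, ← hN, ← LinearMap.comp_assoc, ← comul_number, LinearMap.comp_assoc]
  have hY : tensorNumber 𝒲 ∘ₗ TensorProduct.map F F ∘ₗ comul 𝒱 =
      TensorProduct.lift ((primAct 𝒲 ∘ₗ f).compl₂ (TensorProduct.map F F ∘ₗ comul 𝒱)) ∘ₗ
        comul 𝒱 := by
    rw [lift_primAct_comul hf F hF, ← hN, ht, LinearMap.id_comp, ← LinearMap.add_comp,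
      ← LinearMap.comp_assoc, tensorNumber, LinearMap.add_comp, ← TensorProduct.map_comp,
      ← TensorProduct.map_comp, LinearMap.id_comp]
  -- Both terms satisfy the same equation, linear in them, so Z satisfies it too. As f kills
  -- constants, the equation involves Z only on shorter elements, and strong induction on the weight
  -- gives Z = 0.
  set Z := comul 𝒲 ∘ₗ F - TensorProduct.map F F ∘ₗ comul 𝒱 with hZdef
  have hZ : tensorNumber 𝒲 ∘ₗ Z =
      TensorProduct.lift ((primAct 𝒲 ∘ₗ f).compl₂ Z) ∘ₗ comul 𝒱 := by
    rw [hZdef, LinearMap.comp_sub, hX, hY, ← LinearMap.sub_comp]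
    congr 1
    exact TensorProduct.ext' fun a b => by simp
  have hZ0 : TensorProduct.map (counit 𝒲) (counit 𝒲) ∘ₗ Z = 0 := by
    refine LinearMap.ext fun x => ?_
    have h1 : TensorProduct.map (counit 𝒲) (counit 𝒲) (TensorProduct.map F F (comul 𝒱 x)) =
        TensorProduct.map (counit 𝒱) (counit 𝒱) (comul 𝒱 x) := by
      rw [← LinearMap.comp_apply, ← TensorProduct.map_comp, hc]
    rw [LinearMap.comp_apply, hZdef, LinearMap.sub_apply, LinearMap.comp_apply,
      LinearMap.comp_apply, LinearMap.map_sub, h1, map_counit_comul, map_counit_comul, ← hc,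
      LinearMap.comp_apply, LinearMap.zero_apply]
    exact sub_self _
  have key : ∀ n, ∀ x ∈ symPow 𝒱 n, Z x = 0 := by
    intro n
    induction n using Nat.strong_induction_on with
    | _ n ih =>
      intro x hx
      refine eq_zero_of_tensorNumber ?_ (LinearMap.congr_fun hZ0 x)
      have h2 := LinearMap.congr_fun hZ x
      rw [LinearMap.comp_apply, LinearMap.comp_apply] at h2
      rw [h2]
      refine tensorPow_le_ker (fun i j hij a ha b hb => ?_) (comul_mem_tensorPow hx)
      rw [TensorProduct.lift.tmul, LinearMap.compl₂_apply]
      rcases i with _ | i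
      · obtain ⟨c, rfl⟩ := mem_symPow_zero 𝒱 ha
        rw [map_smul, LinearMap.comp_apply, hf1, map_zero, smul_zero, LinearMap.zero_apply]
      · rw [ih j (by lia) b hb, map_zero]
  rw [← sub_eq_zero, ← hZdef]
  exact symPow_linearMap_ext key

theorem number_coexp (hf1 : f 1 = 0) :
    coderivation (cogen 𝒲) ∘ₗ coexp 𝒲 f = conv (gen 𝒲 ∘ₗ f) (coexp 𝒲 f) := by
  refine symPow_linearMap_ext fun m x hx => ?_
  have h1 : conv (gen 𝒲 ∘ₗ f) (coexp 𝒲 f) x =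
      conv (gen 𝒲 ∘ₗ f) (∑ n ∈ Finset.range (m + 1), expTerm f n) x := by
    rw [conv_apply, conv_apply, LinearMap.comp_apply, LinearMap.comp_apply]
    refine tensorPow_eq (fun i j hij a ha b hb => ?_) (comul_mem_tensorPow hx)
    rw [TensorProduct.lift.tmul, TensorProduct.lift.tmul, LinearMap.compl₁₂_apply,
      LinearMap.compl₁₂_apply, coexp_of_mem hf1 (show j < m + 1 by lia) hb]
  -- The cutoff is m + 2 on the left and m + 1 on the right: the weight operator kills the zeroth
  -- term, and the n-th term on the right matches the (n+1)-st on the left.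
  rw [h1, LinearMap.comp_apply, coexp_of_mem hf1 (show m < m + 2 by lia) hx, LinearMap.sum_apply,
    map_sum, Finset.sum_range_succ', conv_sum_right, LinearMap.sum_apply,
    number_of_mem (expTerm_mem 0 x), Nat.cast_zero, zero_smul, add_zero]
  refine Finset.sum_congr rfl fun n _ => ?_
  rw [number_of_mem (expTerm_mem (n + 1) x), expTerm, LinearMap.smul_apply, smul_smul,
    mul_inv_cancel₀ (Nat.cast_ne_zero.2 n.succ_ne_zero), one_smul]

/-- The weight operator N fixes the cogenerator part, so with F the exponential, cogen F = cogen N F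
= cogen (f * F) = f. -/
theorem cogen_coexp (hf1 : f 1 = 0) : cogen 𝒲 ∘ₗ coexp 𝒲 f = f := by
  refine LinearMap.ext fun x => ?_
  rw [LinearMap.comp_apply, ← cogen_coderivation, ← LinearMap.comp_apply (coderivation _),
    number_coexp hf1, cogen_conv f (counit_coexp hf1)]

theorem isCoalgebraMorphism_coexp (hf : HasDegree (totalDegree 𝒱) 𝒲 0 f) (hf1 : f 1 = 0) :
    IsCoalgebraMorphism (coexp 𝒲 f) where
  comul_comp := comul_comp_of_number hf (coexp_hasDegree hf) (number_coexp hf1) hf1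
    (counit_coexp hf1)
  counit_comp := counit_coexp hf1
  map_one := by
    rw [coexp_of_mem hf1 zero_lt_one (one_mem_symPow 𝒱), Finset.sum_range_one, expTerm,
      LinearMap.comp_apply, counit_one, Algebra.linearMap_apply, _root_.map_one]
  degree := coexp_hasDegree hf

end Morphisms

/-! ### The codifferential of a differential graded Lie algebra -/

namespace DGLA

variable {K A : Type*} [Field K] [AddCommGroup A] [Module K A]
  {𝒜 : ℤ → Submodule K A} (L : DGLA 𝒜)

theorem neg_d_hasDegree : HasDegree (shift 𝒜) (shift 𝒜) 1 (-L.d) :=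
  L.d_degree.shift.neg

theorem Q₁_eq : L.Q₁ = (-L.d) ∘ₗ cogen (shift 𝒜) := by
  rw [Q₁, LinearMap.neg_comp]

theorem Q₁_hasDegree : HasDegree (totalDegree (shift 𝒜)) (shift 𝒜) 1 L.Q₁ := by
  rw [Q₁_eq, ← zero_add 1]
  exact L.neg_d_hasDegree.comp cogen_hasDegree

theorem Q₁_one : L.Q₁ 1 = 0 := by simp [Q₁]

variable [DirectSum.Decomposition 𝒜]

/-- The bracket of `A[1]`, the graded symmetric map `x ⊗ y ↦ -(-1)^{|x|} [x, y]`. -/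
def shiftBracket : A ⊗[K] A →ₗ[K] A :=
  TensorProduct.lift (-(L.bracket ∘ₗ degSign (shift 𝒜) 1))

theorem Q₂_eq : L.Q₂ = (2 : K)⁻¹ • (L.shiftBracket ∘ₗ
    TensorProduct.map (cogen (shift 𝒜)) (cogen (shift 𝒜)) ∘ₗ comul (shift 𝒜)) :=
  rfl

theorem shiftBracket_tmul {m : ℤ} {x : A} (hx : x ∈ shift 𝒜 m) (y : A) :
    L.shiftBracket (x ⊗ₜ y) = -((-1 : K) ^ m • L.bracket x y) := by
  rw [shiftBracket, TensorProduct.lift.tmul, LinearMap.neg_apply, LinearMap.comp_apply,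
    degSign_of_mem _ _ hx, one_mul, map_smul, LinearMap.neg_apply, LinearMap.smul_apply]

theorem shiftBracket_mem {m n : ℤ} {x y : A} (hx : x ∈ shift 𝒜 m) (hy : y ∈ shift 𝒜 n) :
    L.shiftBracket (x ⊗ₜ y) ∈ shift 𝒜 (m + n + 1) := by
  rw [shiftBracket_tmul L hx]
  refine Submodule.neg_mem _ (Submodule.smul_mem _ _ ?_)
  have h := L.bracket_degree _ _ x y hx hy
  have e : m + 1 + (n + 1) = m + n + 1 + 1 := by ring
  rw [e] at h
  exact h

/-- The factor (-1)^{|x|} converts skew symmetry in the degrees m + 1 and n + 1 of A into graded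
symmetry in the shifted degrees m and n. -/
theorem shiftBracket_comm {m n : ℤ} {x y : A} (hx : x ∈ shift 𝒜 m) (hy : y ∈ shift 𝒜 n) :
    L.shiftBracket (x ⊗ₜ y) = (-1 : K) ^ (m * n) • L.shiftBracket (y ⊗ₜ x) := by
  rw [L.shiftBracket_tmul hx, L.shiftBracket_tmul hy, L.bracket_skew _ _ x y hx hy, smul_neg,
    neg_neg, smul_neg, smul_smul, smul_smul, ← neg_smul]
  congr 1
  have e : m + (m + 1) * (n + 1) = m + m + (m * n + n + 1) := by ring
  rw [← zpow_add₀ (by simp), ← zpow_add₀ (by simp), e, zpow_add₀ (by simp), zpow_add₀ (by simp),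
    neg_one_zpow_mul_self, zpow_add_one₀ (by simp)]
  ring

theorem Q₂_hasDegree : HasDegree (totalDegree (shift 𝒜)) (shift 𝒜) 1 L.Q₂ := by
  rw [Q₂_eq, ← LinearMap.comp_assoc]
  refine HasDegree.smul ?_ _
  have h : L.shiftBracket ∘ₗ TensorProduct.map (cogen (shift 𝒜)) (cogen (shift 𝒜)) =
      TensorProduct.lift ((TensorProduct.mk K A A).compl₁₂ (cogen (shift 𝒜))
        (cogen (shift 𝒜)) |>.compr₂ L.shiftBracket) := TensorProduct.ext' fun a b => by simp
  rw [h]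
  refine lift_comul_hasDegree fun i j a ha b hb => ?_
  exact L.shiftBracket_mem (by simpa using cogen_hasDegree i a ha)
    (by simpa using cogen_hasDegree j b hb)

theorem Q_hasDegree : HasDegree (totalDegree (shift 𝒜)) (totalDegree (shift 𝒜)) 1 L.Q :=
  coderivation_hasDegree (L.Q₁_hasDegree.add L.Q₂_hasDegree)

theorem Q₂_of_mem {n : ℕ} (hn : n ≠ 2) {x : GSym (shift 𝒜)} (hx : x ∈ symPow (shift 𝒜) n) :
    L.Q₂ x = 0 := by
  rw [Q₂_eq, ← LinearMap.comp_assoc, LinearMap.smul_apply, LinearMap.comp_apply]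
  rw [tensorPow_le_ker (fun i j hij a ha b hb => ?_) (comul_mem_tensorPow hx), smul_zero]
  rw [LinearMap.comp_apply, TensorProduct.map_tmul]
  by_cases hi : i = 1
  · rw [cogen_of_mem _ (show j ≠ 1 by lia) hb, TensorProduct.tmul_zero, map_zero]
  · rw [cogen_of_mem _ hi ha, TensorProduct.zero_tmul, map_zero]

theorem Q₂_one : L.Q₂ 1 = 0 :=
  L.Q₂_of_mem (by decide) (one_mem_symPow _)

theorem Q_eq : L.Q = coderivation L.Q₁ + coderivation L.Q₂ :=
  coderivation_add _ _

theorem Q_one : L.Q 1 = 0 :=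
  coderivation_one (by rw [LinearMap.add_apply, Q₁_one, Q₂_one, add_zero])

theorem coderivation_Q₁_mem {n : ℕ} {x : GSym (shift 𝒜)} (hx : x ∈ symPow (shift 𝒜) n) :
    coderivation L.Q₁ x ∈ symPow (shift 𝒜) n := by
  rw [Q₁_eq]
  exact coderivation_linear_mem_symPow L.neg_d_hasDegree hx

/-- The map Q₂ consumes exactly two letters and returns one. -/
theorem coderivation_Q₂_mem {n : ℕ} {x : GSym (shift 𝒜)} (hx : x ∈ symPow (shift 𝒜) (n + 1)) :
    coderivation L.Q₂ x ∈ symPow (shift 𝒜) n := by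
  rw [coderivation, conv, LinearMap.comp_apply, LinearMap.comp_apply]
  have hle : tensorPow (shift 𝒜) (n + 1) ≤ (symPow (shift 𝒜) n).comap
      (LinearMap.mul' K _ ∘ₗ TensorProduct.map (gen (shift 𝒜) ∘ₗ L.Q₂) LinearMap.id) := by
    refine Submodule.span_le.2 ?_
    rintro _ ⟨i, j, a, b, hij, ha, hb, rfl⟩
    rw [SetLike.mem_coe, Submodule.mem_comap, LinearMap.comp_apply, TensorProduct.map_tmul,
      LinearMap.mul'_apply, LinearMap.comp_apply]
    by_cases hi : i = 2
    · obtain rfl : n = j + 1 := by lia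
      exact gen_mul_mem_symPow _ hb
    · rw [L.Q₂_of_mem hi ha, map_zero, zero_mul]
      exact zero_mem _
  exact hle (comul_mem_tensorPow hx)

theorem coderivation_Q₁_gen_mul {m : ℤ} {v : A} (hv : v ∈ shift 𝒜 m) (x : GSym (shift 𝒜)) :
    coderivation L.Q₁ (gen (shift 𝒜) v * x) =
      -(gen (shift 𝒜) (L.d v) * x) + (-1 : K) ^ m • (gen (shift 𝒜) v * coderivation L.Q₁ x) := by
  rw [Q₁_eq, coderivation_linear_gen_mul L.neg_d_hasDegree hv, one_mul, LinearMap.neg_apply,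
    map_neg, neg_mul]

theorem coderivation_Q₁_coderivation_Q₁ (x : GSym (shift 𝒜)) :
    coderivation L.Q₁ (coderivation L.Q₁ x) = 0 := by
  induction x using gsym_induction with
  | one => rw [coderivation_one L.Q₁_one, map_zero]
  | add x y hx hy => rw [map_add, map_add, hx, hy, add_zero]
  | smul c x hx => rw [map_smul, map_smul, hx, smul_zero]
  | gen_mul m v hv x hx =>
    have hdv : L.d v ∈ shift 𝒜 (m + 1) := L.d_degree.shift m v hv
    rw [L.coderivation_Q₁_gen_mul hv, map_add, map_neg, map_smul, L.coderivation_Q₁_gen_mul hv,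
      L.coderivation_Q₁_gen_mul hdv, hx, L.d_d, map_zero, mul_zero, smul_zero, zero_mul,
      zpow_add_one₀ (by simp)]
    simp

variable [CharZero K]

theorem comul_Q : comul (shift 𝒜) ∘ₗ L.Q =
    TensorProduct.map L.Q LinearMap.id ∘ₗ comul (shift 𝒜) +
    TensorProduct.map (twist (shift 𝒜) 1).toLinearMap L.Q ∘ₗ comul (shift 𝒜) :=
  comul_coderivation (L.Q₁_hasDegree.add L.Q₂_hasDegree)

/-! ### The codifferential squares to zero -/

/-- The shifted Leibniz rule: −d anticommutes with the bracket, which has degree one after the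
shift, and passing x costs (-1)^m. -/
theorem shiftBracket_d {m : ℤ} {x : A} (hx : x ∈ shift 𝒜 m) (y : A) :
    L.shiftBracket ((-L.d x) ⊗ₜ y) + L.shiftBracket (((-1 : K) ^ m • x) ⊗ₜ (-L.d y)) =
      L.d (L.shiftBracket (x ⊗ₜ y)) := by
  have hdx : -L.d x ∈ shift 𝒜 (m + 1) := L.neg_d_hasDegree m x hx
  have hs : (-1 : K) ^ m • x ∈ shift 𝒜 m := Submodule.smul_mem _ _ hx
  rw [L.shiftBracket_tmul hdx, L.shiftBracket_tmul hs, L.shiftBracket_tmul hx, map_neg L.d,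
    map_smul L.d, L.d_bracket (m + 1) x y hx, zpow_add_one₀ (by simp)]
  simp only [map_neg, map_smul, LinearMap.neg_apply, LinearMap.smul_apply, smul_neg, smul_smul, smul_add,
    mul_neg, mul_one, neg_smul, neg_one_zpow_mul_self, one_smul]
  abel

/-- The Jacobi identity in cyclic form; the coefficients are the Koszul signs of the rotations of x
⊗ y ⊗ z. -/
theorem shiftBracket_jacobi {m n k : ℤ} {x y z : A} (hx : x ∈ shift 𝒜 m) (hy : y ∈ shift 𝒜 n)
    (hz : z ∈ shift 𝒜 k) :
    L.shiftBracket (L.shiftBracket (x ⊗ₜ y) ⊗ₜ z) +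
      (-1 : K) ^ (k * (m + n)) • L.shiftBracket (L.shiftBracket (z ⊗ₜ x) ⊗ₜ y) +
      (-1 : K) ^ (m * (n + k)) • L.shiftBracket (L.shiftBracket (y ⊗ₜ z) ⊗ₜ x) = 0 := by
  rw [L.shiftBracket_tmul (L.shiftBracket_mem hx hy), L.shiftBracket_tmul (L.shiftBracket_mem hz hx),
    L.shiftBracket_tmul (L.shiftBracket_mem hy hz), L.shiftBracket_tmul hx,
    L.shiftBracket_tmul hy, L.shiftBracket_tmul hz]
  have h1 := L.jacobi (m + 1) (n + 1) x y z hx hy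
  have h2 := L.bracket_skew (m + 1) (n + 1 + (k + 1)) x (L.bracket y z) hx
    (L.bracket_degree _ _ y z hy hz)
  have h3 := L.bracket_skew (m + 1) (k + 1) x z hx hz
  have h4 := L.bracket_skew (n + 1) (k + 1 + (m + 1)) y (L.bracket z x) hy
    (L.bracket_degree _ _ z x hz hx)
  rw [h2, h3, map_neg, map_smul, h4] at h1
  simp only [map_neg, map_smul, LinearMap.neg_apply, LinearMap.smul_apply, smul_neg, neg_neg,
    smul_smul] at h1 ⊢
  rw [← sub_eq_iff_eq_add] at h1
  rw [← h1]
  have hne : (-1 : K) ≠ 0 := by simp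
  have hpm : ∀ a : ℤ, (-1 : K) ^ a = 1 ∨ (-1 : K) ^ a = -1 := fun a =>
    (Int.even_or_odd a).imp Even.neg_one_zpow Odd.neg_one_zpow
  simp only [zpow_add₀ hne, mul_add, add_mul, zpow_mul]
  -- Only the parities of m, n and k matter now, which leaves eight cases.
  rcases hpm m with hm | hm <;> rcases hpm n with hn | hn <;> rcases hpm k with hk | hk <;>
    (simp [hm, hn, hk]; try abel)

/-- The iterated coproduct is invariant under the graded cyclic permutation. -/
theorem cyclic_comul {V : Type*} [AddCommGroup V] [Module K V] (𝒱 : ℤ → Submodule K V)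
    [DirectSum.Decomposition 𝒱] (x : GSym 𝒱) :
    TensorProduct.map (braid 𝒱) LinearMap.id ((TensorProduct.assoc K _ _ _).symm
      (TensorProduct.map LinearMap.id (braid 𝒱) (TensorProduct.assoc K _ _ _
        (TensorProduct.map (comul 𝒱) LinearMap.id (comul 𝒱 x))))) =
      TensorProduct.map (comul 𝒱) LinearMap.id (comul 𝒱 x) := by
  have hb : braid 𝒱 ∘ₗ comul 𝒱 = comul 𝒱 := LinearMap.ext (braid_comul 𝒱)
  have h1 : TensorProduct.map LinearMap.id (braid 𝒱)
      (TensorProduct.map LinearMap.id (comul 𝒱) (comul 𝒱 x)) =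
      TensorProduct.map LinearMap.id (comul 𝒱) (comul 𝒱 x) := by
    rw [← LinearMap.comp_apply, ← TensorProduct.map_comp, LinearMap.id_comp, hb]
  rw [comul_coassoc, h1, ← comul_coassoc, LinearEquiv.symm_apply_apply, ← LinearMap.comp_apply,
    ← TensorProduct.map_comp, LinearMap.id_comp, hb]

/-- The iterated coproduct w is invariant under the cyclic permutation σ, so 3 J(w) = J(w) + J(σw) +
J(σ²w), which is zero by Jacobi. This is the part of Q² with three inputs. -/
theorem shiftBracket_Q₂_cogen (x : GSym (shift 𝒜)) :
    L.shiftBracket (TensorProduct.map L.Q₂ (cogen (shift 𝒜)) (comul (shift 𝒜) x)) = 0 := by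
  let c := cogen (shift 𝒜)
  let α := (TensorProduct.assoc K (GSym (shift 𝒜)) (GSym (shift 𝒜)) (GSym (shift 𝒜)))
  let J := L.shiftBracket ∘ₗ TensorProduct.map (L.shiftBracket ∘ₗ TensorProduct.map c c) c
  let σ := TensorProduct.map (braid (shift 𝒜)) LinearMap.id ∘ₗ α.symm.toLinearMap ∘ₗ
    TensorProduct.map LinearMap.id (braid (shift 𝒜)) ∘ₗ α.toLinearMap
  set w := TensorProduct.map (comul (shift 𝒜)) LinearMap.id (comul (shift 𝒜) x) with hw
  have hσ : σ w = w := cyclic_comul (shift 𝒜) x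
  have hσt : ∀ m n k, ∀ a ∈ totalDegree (shift 𝒜) m, ∀ b ∈ totalDegree (shift 𝒜) n,
      ∀ d ∈ totalDegree (shift 𝒜) k,
      σ ((a ⊗ₜ b) ⊗ₜ d) = (-1 : K) ^ (k * (m + n)) • ((d ⊗ₜ a) ⊗ₜ b) := by
    intro m n k a ha b hb d hd
    simp only [σ, α, LinearMap.comp_apply, LinearEquiv.coe_coe, TensorProduct.assoc_tmul,
      TensorProduct.map_tmul, LinearMap.id_apply, braid_of_mem hb, twist_of_mem _ n hd,
      TensorProduct.tmul_smul, ← TensorProduct.smul_tmul', map_smul,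
      TensorProduct.assoc_symm_tmul, braid_of_mem ha, twist_of_mem _ m hd, smul_smul]
    rw [← zpow_add₀ (by simp), mul_add, mul_comm k, mul_comm k, add_comm]
  have hJ : J + J ∘ₗ σ + J ∘ₗ σ ∘ₗ σ = 0 := by
    refine tensor_ext_totalDegree₃ fun m a ha b d => ?_
    induction b using totalDegree_induction with
    | add b b' hb hb' =>
      rw [TensorProduct.tmul_add, TensorProduct.add_tmul, map_add, map_add, hb, hb']
    | mem n b hb =>
      induction d using totalDegree_induction with
      | add d d' hd hd' => rw [TensorProduct.tmul_add, map_add, map_add, hd, hd']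
      | mem k d hd =>
        have ha' : c a ∈ shift 𝒜 m := by simpa using cogen_hasDegree m a ha
        have hb' : c b ∈ shift 𝒜 n := by simpa using cogen_hasDegree n b hb
        have hd' : c d ∈ shift 𝒜 k := by simpa using cogen_hasDegree k d hd
        have h := L.shiftBracket_jacobi ha' hb' hd'
        simp only [LinearMap.add_apply, LinearMap.comp_apply, hσt m n k a ha b hb d hd, map_smul,
          hσt k m n d hd a ha b hb, smul_smul, J, TensorProduct.map_tmul, LinearMap.zero_apply]
        rw [← h, ← zpow_add₀ (by simp)]
        have e : k * (m + n) + n * (k + m) = m * (n + k) + (k * n + k * n) := by ring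
        rw [e, zpow_add₀ (by simp) (m * (n + k)), zpow_add₀ (by simp) (k * n), neg_one_zpow_mul_self, mul_one]
  have h3 : (3 : K) • J w = 0 := by
    have h := LinearMap.congr_fun hJ w
    simp only [LinearMap.add_apply, LinearMap.comp_apply, hσ, LinearMap.zero_apply] at h
    rw [← h, show (3 : K) = 1 + 1 + 1 by norm_num, add_smul, add_smul, one_smul]
  have hJw : J w = 0 := (smul_eq_zero.1 h3).resolve_left (by norm_num)
  have hQ : TensorProduct.map L.Q₂ c = (2 : K)⁻¹ •
      (TensorProduct.map (L.shiftBracket ∘ₗ TensorProduct.map c c) c ∘ₗ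
        TensorProduct.map (comul (shift 𝒜)) LinearMap.id) := by
    rw [← TensorProduct.map_comp, ← TensorProduct.map_smul_left, LinearMap.comp_id]
    rfl
  rw [hQ, LinearMap.smul_apply, LinearMap.comp_apply, ← hw, map_smul]
  change (2 : K)⁻¹ • J w = 0
  rw [hJw, smul_zero]

/-- The cogenerator part of Q² splits: Q₁Q₁ vanishes by d² = 0, the mixed terms cancel by the
Leibniz rule, and Q₂Q₂ vanishes by Jacobi. The two positions of Q₂ inside the bracket differ by a
flip, which Δ absorbs. -/
theorem Q₁_add_Q₂_Q (x : GSym (shift 𝒜)) : (L.Q₁ + L.Q₂) (L.Q x) = 0 := by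
  have hcQ : cogen (shift 𝒜) ∘ₗ L.Q = L.Q₁ + L.Q₂ :=
    LinearMap.ext fun y => cogen_coderivation _ y
  have hd : ∀ z, L.shiftBracket
        (TensorProduct.map L.Q₁ (cogen (shift 𝒜)) z) +
      L.shiftBracket (TensorProduct.map
        (cogen (shift 𝒜) ∘ₗ (twist (shift 𝒜) 1).toLinearMap) L.Q₁ z) =
      L.d (L.shiftBracket (TensorProduct.map (cogen (shift 𝒜)) (cogen (shift 𝒜)) z)) := by
    intro z
    have h : L.shiftBracket ∘ₗ TensorProduct.map L.Q₁ (cogen (shift 𝒜)) +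
        L.shiftBracket ∘ₗ TensorProduct.map
          (cogen (shift 𝒜) ∘ₗ (twist (shift 𝒜) 1).toLinearMap) L.Q₁ =
        L.d ∘ₗ L.shiftBracket ∘ₗ
          TensorProduct.map (cogen (shift 𝒜)) (cogen (shift 𝒜)) := by
      refine tensor_ext_totalDegree fun m a ha b => ?_
      have ha' : cogen (shift 𝒜) a ∈ shift 𝒜 m := by simpa using cogen_hasDegree m a ha
      have h := L.shiftBracket_d ha' (cogen (shift 𝒜) b)
      simpa [Q₁, twist_of_mem _ 1 ha] using h
    exact LinearMap.congr_fun h z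
  have hs : ∀ z, L.shiftBracket (TensorProduct.map
        (cogen (shift 𝒜) ∘ₗ (twist (shift 𝒜) 1).toLinearMap) L.Q₂ z) =
      L.shiftBracket (TensorProduct.map L.Q₂ (cogen (shift 𝒜)) (braid (shift 𝒜) z)) := by
    intro z
    have h : L.shiftBracket ∘ₗ TensorProduct.map
          (cogen (shift 𝒜) ∘ₗ (twist (shift 𝒜) 1).toLinearMap) L.Q₂ =
        L.shiftBracket ∘ₗ TensorProduct.map L.Q₂ (cogen (shift 𝒜)) ∘ₗ braid (shift 𝒜) := by
      refine tensor_ext_totalDegree fun m a ha b => ?_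
      induction b using totalDegree_induction with
      | add b b' hb hb' => rw [TensorProduct.tmul_add, map_add, map_add, hb, hb']
      | mem n b hb =>
        have ha' : cogen (shift 𝒜) a ∈ shift 𝒜 m := by simpa using cogen_hasDegree m a ha
        simp only [LinearMap.comp_apply, TensorProduct.map_tmul, AlgHom.toLinearMap_apply,
          braid_of_mem ha, twist_of_mem _ 1 ha, twist_of_mem _ m hb, map_smul,
          ← TensorProduct.smul_tmul']
        rw [L.shiftBracket_comm ha' (L.Q₂_hasDegree n b hb), smul_smul, one_mul, mul_add, mul_one,
          zpow_add₀ (by simp), mul_comm, mul_assoc, neg_one_zpow_mul_self, mul_one]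
    exact LinearMap.congr_fun h z
  have h1 : L.Q₁ (L.Q x) = -L.d (L.Q₂ x) := by
    rw [Q₁, LinearMap.neg_apply, LinearMap.comp_apply, Q, cogen_coderivation, LinearMap.add_apply,
      map_add, Q₁, LinearMap.neg_apply, map_neg, LinearMap.comp_apply, L.d_d, neg_zero, zero_add]
  have h2 : L.Q₂ (L.Q x) = L.d (L.Q₂ x) := by
    have hc := LinearMap.congr_fun L.comul_Q x
    rw [LinearMap.comp_apply] at hc
    rw [Q₂_eq, LinearMap.smul_apply, LinearMap.comp_apply, LinearMap.comp_apply, hc,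
      LinearMap.add_apply, LinearMap.comp_apply, LinearMap.comp_apply, map_add,
      TensorProduct.map_map, TensorProduct.map_map, hcQ,
      LinearMap.comp_id, TensorProduct.map_add_left, TensorProduct.map_add_right,
      LinearMap.add_apply, LinearMap.add_apply, map_add, map_add, map_add, hs, braid_comul,
      L.shiftBracket_Q₂_cogen, add_zero, add_zero, hd, LinearMap.smul_apply, map_smul]
    rfl
  rw [LinearMap.add_apply, h1, h2, neg_add_cancel]

/-- `Q` is a codifferential. -/
theorem Q_comp_Q : L.Q ∘ₗ L.Q = 0 := by
  have htQ : (twist (shift 𝒜) 1).toLinearMap ∘ₗ L.Q =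
      -(L.Q ∘ₗ (twist (shift 𝒜) 1).toLinearMap) := by
    refine LinearMap.ext fun x => ?_
    have h := L.Q_hasDegree.twist_comm 1 x
    simpa using h
  have htt : (twist (shift 𝒜) 1).toLinearMap ∘ₗ (twist (shift 𝒜) 1).toLinearMap = LinearMap.id :=
    LinearMap.ext (twist_one_twist_one _)
  have hcc : cogen (shift 𝒜) ∘ₗ L.Q ∘ₗ L.Q = 0 := LinearMap.ext fun x => by
    rw [LinearMap.comp_apply, LinearMap.comp_apply, Q, cogen_coderivation]
    exact L.Q₁_add_Q₂_Q x
  -- Since Q is odd, it anticommutes with the sign operator, so the cross terms Q ⊗ Q cancel and Q²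
  -- is a coderivation without signs.
  have hc : comul (shift 𝒜) ∘ₗ L.Q ∘ₗ L.Q =
      TensorProduct.map (L.Q ∘ₗ L.Q) LinearMap.id ∘ₗ comul (shift 𝒜) +
      TensorProduct.map LinearMap.id (L.Q ∘ₗ L.Q) ∘ₗ comul (shift 𝒜) := by
    rw [← LinearMap.comp_assoc, comul_Q, LinearMap.add_comp, LinearMap.comp_assoc,
      LinearMap.comp_assoc, comul_Q, LinearMap.comp_add, LinearMap.comp_add,
      ← LinearMap.comp_assoc, ← LinearMap.comp_assoc, ← LinearMap.comp_assoc,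
      ← LinearMap.comp_assoc, ← TensorProduct.map_comp, ← TensorProduct.map_comp,
      ← TensorProduct.map_comp, ← TensorProduct.map_comp, htt, htQ, LinearMap.id_comp,
      LinearMap.id_comp]
    have hneg : TensorProduct.map (-(L.Q ∘ₗ (twist (shift 𝒜) 1).toLinearMap)) L.Q =
        -TensorProduct.map (L.Q ∘ₗ (twist (shift 𝒜) 1).toLinearMap) L.Q :=
      TensorProduct.ext' fun a b => by simp [TensorProduct.neg_tmul]
    rw [LinearMap.comp_id L.Q, hneg, LinearMap.neg_comp]
    abel
  -- As the cogenerator part of Q² is zero, only cogen * Q² is left on the right.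
  refine eq_zero_of_number (f := cogen (shift 𝒜)) ?_ ?_
  · have h0 : conv (gen (shift 𝒜) ∘ₗ cogen (shift 𝒜) ∘ₗ L.Q ∘ₗ L.Q)
        (LinearMap.id : GSym (shift 𝒜) →ₗ[K] GSym (shift 𝒜)) = 0 := by
      rw [hcc, LinearMap.comp_zero, conv, TensorProduct.map_zero_left, LinearMap.zero_comp,
        LinearMap.comp_zero]
    conv_lhs => rw [coderivation]
    rw [conv_comp_of_comul_add hc, LinearMap.comp_assoc, LinearMap.id_comp, LinearMap.comp_id, h0,
      zero_add, LinearMap.id_comp]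
  · refine LinearMap.ext fun x => ?_
    rw [LinearMap.comp_apply, LinearMap.comp_apply, Q, counit_coderivation, LinearMap.zero_apply]

end DGLA

/-! ### Symmetric powers of linear maps -/

section SymMap

variable {K V W : Type*} [Field K] [AddCommGroup V] [Module K V] [AddCommGroup W] [Module K W]
  {𝒱 : ℤ → Submodule K V} [DirectSum.Decomposition 𝒱]
  {𝒲 : ℤ → Submodule K W} [DirectSum.Decomposition 𝒲]

theorem symMap_twist (f : V →ₗ[K] W) (hf : HasDegree 𝒱 𝒲 0 f) (r : ℤ) (x : GSym 𝒱) :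
    symMap f hf (twist 𝒱 r x) = twist 𝒲 r (symMap f hf x) := by
  have h := (symMap_hasDegree f hf).twist_comm r x
  rw [mul_zero, zpow_zero, one_smul] at h
  exact h.symm

theorem counit_comp_symMap {𝒲 : ℤ → Submodule K W} (f : V →ₗ[K] W) (hf : HasDegree 𝒱 𝒲 0 f) :
    counit 𝒲 ∘ₗ (symMap f hf).toLinearMap = counit 𝒱 :=
  gsym_linearMap_ext (by simp) fun m v _ x _ => by simp [symMap_gen]

theorem cogen_comp_symMap {𝒲 : ℤ → Submodule K W} (f : V →ₗ[K] W) (hf : HasDegree 𝒱 𝒲 0 f) :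
    cogen 𝒲 ∘ₗ (symMap f hf).toLinearMap = f ∘ₗ cogen 𝒱 :=
  gsym_linearMap_ext (by simp) fun m v _ x _ => by
    have h := LinearMap.congr_fun (counit_comp_symMap f hf) x
    rw [LinearMap.comp_apply, AlgHom.toLinearMap_apply] at h
    simp [symMap_gen, h]

theorem isCoalgebraMorphism_symMap (f : V →ₗ[K] W) (hf : HasDegree 𝒱 𝒲 0 f) :
    IsCoalgebraMorphism (symMap f hf).toLinearMap where
  comul_comp := by
    refine gsym_linearMap_ext (by simp [comul_one]) fun m v hv x hx => ?_
    have hfv : f v ∈ 𝒲 m := by simpa using hf m v hv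
    rw [LinearMap.comp_apply, LinearMap.comp_apply, AlgHom.toLinearMap_apply] at hx ⊢
    rw [_root_.map_mul, symMap_gen, comul_gen_mul, comul_gen_mul, hx]
    generalize comul 𝒱 x = z
    induction z using TensorProduct.induction_on with
    | zero => simp
    | add y z hy hz => simp only [map_add, hy, hz]
    | tmul a b => simp [primAct_of_mem 𝒱 hv, primAct_of_mem 𝒲 hfv, symMap_gen, symMap_twist]
  counit_comp := counit_comp_symMap f hf
  map_one := by simp
  degree := symMap_hasDegree f hf

end SymMap

/-! ### The partial powers of an idempotent -/

section PartialPower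

variable {K V : Type*} [Field K] [AddCommGroup V] [Module K V]
  {𝒱 : ℤ → Submodule K V} {e : V →ₗ[K] V}

/-- The algebra morphism `Sym V → (Sym V)[t]` extending `v ↦ v + t e v`. -/
def powerSeriesMap (e : V →ₗ[K] V) (he : HasDegree 𝒱 𝒱 0 e) :
    GSym 𝒱 →ₐ[K] Polynomial (GSym 𝒱) :=
  lift 𝒱 (Polynomial.CAlgHom.toLinearMap ∘ₗ gen 𝒱 +
      (Polynomial.monomial 1).restrictScalars K ∘ₗ gen 𝒱 ∘ₗ e) fun m n x y hx hy => by
    have hex : e x ∈ 𝒱 m := by simpa using he m x hx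
    have hey : e y ∈ 𝒱 n := by simpa using he n y hy
    simp only [LinearMap.add_apply, LinearMap.comp_apply, AlgHom.toLinearMap_apply,
      Polynomial.CAlgHom_apply, LinearMap.restrictScalars_apply, mul_add, add_mul, ← Polynomial.C_mul,
      Polynomial.C_mul_monomial, Polynomial.monomial_mul_C, Polynomial.monomial_mul_monomial,
      gen_mul_gen 𝒱 hx hy, gen_mul_gen 𝒱 hx hey, gen_mul_gen 𝒱 hex hy, gen_mul_gen 𝒱 hex hey,
      smul_add, ← Polynomial.smul_monomial, ← Polynomial.smul_C]
    abel

/-- The operator `x₁ ∨ ⋯ ∨ xₙ ↦ ∑` of the products in which `e` is applied to `j` of the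
factors. -/
def partialPower (e : V →ₗ[K] V) (he : HasDegree 𝒱 𝒱 0 e) (j : ℕ) : GSym 𝒱 →ₗ[K] GSym 𝒱 :=
  (Polynomial.lcoeff (GSym 𝒱) j).restrictScalars K ∘ₗ (powerSeriesMap e he).toLinearMap

variable (he : HasDegree 𝒱 𝒱 0 e)

theorem powerSeriesMap_gen (v : V) : powerSeriesMap e he (gen 𝒱 v) =
    Polynomial.C (gen 𝒱 v) + Polynomial.X * Polynomial.C (gen 𝒱 (e v)) := by
  rw [powerSeriesMap, lift_gen, Polynomial.X_mul_C, Polynomial.C_mul_X_eq_monomial]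
  rfl

theorem partialPower_apply (j : ℕ) (x : GSym 𝒱) :
    partialPower e he j x = (powerSeriesMap e he x).coeff j :=
  rfl

theorem partialPower_zero (x : GSym 𝒱) : partialPower e he 0 x = x := by
  induction x using gsym_induction_gen with
  | one => simp [partialPower_apply]
  | add x y hx hy => rw [map_add, hx, hy]
  | smul c x hx => rw [map_smul, hx]
  | gen_mul v x hx =>
    rw [partialPower_apply] at hx
    rw [partialPower_apply, map_mul, powerSeriesMap_gen, Polynomial.mul_coeff_zero, hx]
    simp

theorem partialPower_succ_one (j : ℕ) : partialPower e he (j + 1) 1 = 0 := by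
  rw [partialPower_apply, map_one, Polynomial.coeff_one, if_neg j.succ_ne_zero]

theorem partialPower_succ_gen_mul (j : ℕ) (v : V) (x : GSym 𝒱) :
    partialPower e he (j + 1) (gen 𝒱 v * x) =
      gen 𝒱 v * partialPower e he (j + 1) x + gen 𝒱 (e v) * partialPower e he j x := by
  rw [partialPower_apply, map_mul, powerSeriesMap_gen, add_mul, Polynomial.coeff_add,
    Polynomial.coeff_C_mul, mul_assoc, Polynomial.coeff_X_mul, Polynomial.coeff_C_mul]
  rfl

variable [DirectSum.Decomposition 𝒱]

theorem coderivation_even_gen_mul {e : V →ₗ[K] V} (he : HasDegree 𝒱 𝒱 0 e) (v : V) (x : GSym 𝒱) :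
    coderivation (e ∘ₗ cogen 𝒱) (gen 𝒱 v * x) =
      gen 𝒱 (e v) * x + gen 𝒱 v * coderivation (e ∘ₗ cogen 𝒱) x := by
  induction v using DirectSum.Decomposition.inductionOn 𝒱 with
  | zero => simp
  | @homogeneous m v =>
    rw [coderivation_linear_gen_mul he v.2, zero_mul, zpow_zero, one_smul]
  | add v w hv hw =>
    simp only [map_add, add_mul, hv, hw]
    abel

/-- Both sides satisfy the same product rule, as 1 + t is central. On generators, idempotency gives
e v + t e e v = (1 + t) e v, which is 1 + t times the t-derivative of v + t e v. -/
theorem powerSeriesMap_coderivation (hee : ∀ v, e (e v) = e v) (x : GSym 𝒱) :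
    powerSeriesMap e he (coderivation (e ∘ₗ cogen 𝒱) x) =
      (1 + Polynomial.X) * Polynomial.derivative (powerSeriesMap e he x) := by
  induction x using gsym_induction with
  | one => rw [coderivation_linear_one, map_one, map_zero, Polynomial.derivative_one, mul_zero]
  | add x y hx hy => simp only [map_add, hx, hy, mul_add]
  | smul c x hx => rw [map_smul, map_smul, map_smul, hx, Polynomial.derivative_smul, mul_smul_comm]
  | gen_mul m v hv x hx =>
    rw [coderivation_even_gen_mul he, map_add, map_mul, map_mul, hx, map_mul,
      Polynomial.derivative_mul, powerSeriesMap_gen, powerSeriesMap_gen, hee]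
    have hc : ∀ p : Polynomial (GSym 𝒱), p * (1 + Polynomial.X) = (1 + Polynomial.X) * p :=
      fun p => by rw [mul_add, add_mul, mul_one, one_mul, Polynomial.X_mul]
    rw [← mul_assoc _ (1 + Polynomial.X), hc]
    simp only [Polynomial.derivative_add, Polynomial.derivative_C, Polynomial.derivative_mul,
      Polynomial.derivative_X, zero_add, one_mul, mul_zero, add_zero, mul_add, add_mul, mul_assoc]

/-- For an idempotent `e`, partial powers and the derivation `D` extending `e` satisfy
`S_j D = j S_j + (j + 1) S_{j+1}`. -/
theorem partialPower_coderivation (hee : ∀ v, e (e v) = e v) (j : ℕ) (x : GSym 𝒱) :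
    partialPower e he j (coderivation (e ∘ₗ cogen 𝒱) x) =
      (j : K) • partialPower e he j x + ((j + 1 : ℕ) : K) • partialPower e he (j + 1) x := by
  rw [partialPower_apply, powerSeriesMap_coderivation he hee, add_mul, one_mul,
    Polynomial.coeff_add, Polynomial.coeff_derivative, partialPower_apply, partialPower_apply,
    add_comm]
  have hn : ∀ (n : ℕ) (y : GSym 𝒱), y * (n : GSym 𝒱) = (n : K) • y := fun n y => by
    rw [Algebra.smul_def, map_natCast, Nat.cast_comm]
  congr 1
  · rcases j with _ | j
    · simp
    · rw [Polynomial.coeff_X_mul, Polynomial.coeff_derivative, ← hn]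
      push_cast
      rfl
  · rw [← hn]
    push_cast
    rfl

theorem coderivation_partialPower {r : ℤ} {φ : V →ₗ[K] V} (hφ : HasDegree 𝒱 𝒱 r φ)
    (hφe : ∀ v, φ (e v) = e (φ v)) (j : ℕ) (x : GSym 𝒱) :
    coderivation (φ ∘ₗ cogen 𝒱) (partialPower e he j x) =
      partialPower e he j (coderivation (φ ∘ₗ cogen 𝒱) x) := by
  induction x using gsym_induction generalizing j with
  | one =>
    rcases j with _ | j
    · rw [partialPower_zero, partialPower_zero]
    · rw [partialPower_succ_one, coderivation_linear_one, map_zero, map_zero]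
  | add x y hx hy => simp only [map_add, hx, hy]
  | smul c x hx => simp only [map_smul, hx]
  | gen_mul m v hv x hx =>
    rcases j with _ | j
    · rw [partialPower_zero, partialPower_zero]
    · have hev : e v ∈ 𝒱 m := by simpa using he m v hv
      rw [partialPower_succ_gen_mul, map_add, coderivation_linear_gen_mul hφ hv,
        coderivation_linear_gen_mul hφ hev, hx, hx, coderivation_linear_gen_mul hφ hv, map_add,
        map_smul, partialPower_succ_gen_mul, partialPower_succ_gen_mul, hφe, smul_add]
      abel

/-- An unshuffle with left block of size j chooses the letters that e hits. A new first letter joins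
the left block and gets e, or joins the right block and comes back across the left one, which
`twist` compensates. -/
theorem conv_symMap_proj (j : ℕ) :
    conv ((symMap e he).toLinearMap ∘ₗ proj 𝒱 j) LinearMap.id = partialPower e he j := by
  suffices h : ∀ x j, conv ((symMap e he).toLinearMap ∘ₗ proj 𝒱 j) LinearMap.id x =
      partialPower e he j x from LinearMap.ext fun x => h x j
  intro x
  induction x using gsym_induction with
  | one =>
    intro j
    rw [conv_apply_one, LinearMap.id_apply, mul_one, LinearMap.comp_apply,
      proj_of_mem 𝒱 0 j 1 (one_mem_symPow 𝒱)]
    rcases j with _ | j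
    · simp [partialPower_zero]
    · simp [partialPower_succ_one]
  | add x y hx hy => exact fun j => by simp only [map_add, hx, hy]
  | smul c x hx => exact fun j => by simp only [map_smul, hx]
  | gen_mul m v hv x hx =>
    have hG : ∀ (j : ℕ) (a : GSym 𝒱), symMap e he (proj 𝒱 j (twist 𝒱 m a)) * gen 𝒱 v =
        gen 𝒱 v * symMap e he (proj 𝒱 j a) := by
      intro j a
      have h := ((symMap_hasDegree e he).comp (proj_hasDegree j)).twist_comm m a
      rw [add_zero, mul_zero, zpow_zero, one_smul, LinearMap.comp_apply, LinearMap.comp_apply,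
        AlgHom.toLinearMap_apply, AlgHom.toLinearMap_apply] at h
      rw [← h, twist_mul_gen 𝒱 hv]
    intro j
    rcases j with _ | j
    · have h0 := hx 0
      rw [partialPower_zero] at h0 ⊢
      conv_rhs => rw [← h0]
      simp only [conv, LinearMap.comp_apply, comul_gen_mul]
      generalize comul 𝒱 x = z
      induction z using TensorProduct.induction_on with
      | zero => simp
      | add y z hy hz => simp only [map_add, hy, hz, mul_add]
      | tmul a b =>
        simp only [primAct_of_mem 𝒱 hv, map_add, TensorProduct.map_tmul, LinearMap.comp_apply,
          AlgHom.toLinearMap_apply, proj_zero_gen_mul, map_zero, TensorProduct.zero_tmul, zero_add,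
          LinearMap.mul'_apply, LinearMap.id_apply, ← mul_assoc, hG]
    · rw [partialPower_succ_gen_mul, ← hx, ← hx]
      simp only [conv, LinearMap.comp_apply, comul_gen_mul]
      generalize comul 𝒱 x = z
      induction z using TensorProduct.induction_on with
      | zero => simp
      | add y z hy hz =>
        simp only [map_add, hy, hz, mul_add]
        abel
      | tmul a b =>
        simp only [primAct_of_mem 𝒱 hv, map_add, TensorProduct.map_tmul, LinearMap.comp_apply,
          AlgHom.toLinearMap_apply, proj_gen_mul_succ, map_mul, symMap_gen,
          LinearMap.mul'_apply, LinearMap.id_apply, ← mul_assoc, hG]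
        rw [add_comm]

/-- On Symⁿ a left factor of weight j forces weight n − j on the right, so the second projection
changes nothing. This identifies the shuffle sums in `Kop` with partial powers. -/
theorem conv_symMap_proj_proj {n j : ℕ} (hj : j ≤ n) {x : GSym 𝒱} (hx : x ∈ symPow 𝒱 n) :
    conv ((symMap e he).toLinearMap ∘ₗ proj 𝒱 j) (proj 𝒱 (n - j)) x = partialPower e he j x := by
  rw [← conv_symMap_proj, conv_apply, conv_apply, LinearMap.comp_apply, LinearMap.comp_apply]
  refine tensorPow_eq (fun i k hik a ha b hb => ?_) (comul_mem_tensorPow hx)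
  simp only [TensorProduct.lift.tmul, LinearMap.compl₁₂_apply, LinearMap.comp_apply]
  by_cases hij : i = j
  · rw [show n - j = k by lia, proj_of_mem_self 𝒱 hb, LinearMap.id_apply]
  · rw [proj_of_mem_ne 𝒱 hij ha, map_zero, map_zero, LinearMap.zero_apply, LinearMap.zero_apply]

theorem partialPower_of_mem {n : ℕ} {x : GSym 𝒱} (hx : x ∈ symPow 𝒱 n) :
    partialPower e he n x = symMap e he x := by
  rw [← conv_symMap_proj_proj he le_rfl hx, conv_apply, LinearMap.comp_apply]
  refine lift_comul_of_counit_right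
    (φ := (symMap e he).toLinearMap ∘ₗ proj 𝒱 n) (fun a b => ?_) x |>.trans ?_
  · rw [LinearMap.compl₁₂_apply, Nat.sub_self, proj_zero_apply, LinearMap.mul_apply', mul_smul_comm,
      mul_one]
  · rw [LinearMap.comp_apply, proj_of_mem_self 𝒱 hx, AlgHom.toLinearMap_apply]

end PartialPower

/-! ### The homotopy of `Symⁿ (B[1])` -/

namespace DeformationRetract

variable {K A B : Type*} [Field K] [AddCommGroup A] [Module K A] [AddCommGroup B] [Module K B]
  {𝒜 : ℤ → Submodule K A} {ℬ : ℤ → Submodule K B} {LA : DGLA 𝒜} {LB : DGLA ℬ}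

theorem ip_ip (r : DeformationRetract LA LB) (v : B) :
    (r.i ∘ₗ r.p) ((r.i ∘ₗ r.p) v) = (r.i ∘ₗ r.p) v := by
  rw [LinearMap.comp_apply, LinearMap.comp_apply, r.p_i]

theorem neg_h_hasDegree (r : DeformationRetract LA LB) : HasDegree (shift ℬ) (shift ℬ) (-1) (-r.h) :=
  r.h_degree.shift.neg

variable [DirectSum.Decomposition ℬ] (r : DeformationRetract LA LB)

theorem Htilde_eq : r.Htilde = coderivation ((-r.h) ∘ₗ cogen (shift ℬ)) := by
  rw [Htilde, LinearMap.neg_comp]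

theorem Htilde_gen_mul {m : ℤ} {v : B} (hv : v ∈ shift ℬ m) (x : GSym (shift ℬ)) :
    r.Htilde (gen (shift ℬ) v * x) =
      -(gen (shift ℬ) (r.h v) * x) + (-1 : K) ^ m • (gen (shift ℬ) v * r.Htilde x) := by
  have hs : (-1 : K) ^ (-1 * m) = (-1 : K) ^ m := by
    rw [neg_one_mul, zpow_neg, ← inv_zpow, inv_neg_one]
  rw [Htilde_eq, coderivation_linear_gen_mul r.neg_h_hasDegree hv, hs, LinearMap.neg_apply,
    map_neg, neg_mul]

theorem Htilde_one : r.Htilde 1 = 0 := by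
  rw [Htilde_eq, coderivation_linear_one]

theorem Htilde_mem {n : ℕ} {x : GSym (shift ℬ)} (hx : x ∈ symPow (shift ℬ) n) :
    r.Htilde x ∈ symPow (shift ℬ) n := by
  rw [Htilde_eq]
  exact coderivation_linear_mem_symPow r.neg_h_hasDegree hx

theorem Htilde_hasDegree :
    HasDegree (totalDegree (shift ℬ)) (totalDegree (shift ℬ)) (-1) r.Htilde := by
  rw [Htilde_eq]
  refine coderivation_hasDegree ?_
  have h := r.neg_h_hasDegree.comp (cogen_hasDegree (𝒱 := shift ℬ))
  rwa [zero_add] at h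

/-- Two odd derivations have a derivation as anticommutator, so the generators decide: the two minus
signs of −d and −h cancel, and dh + hd = 1 − ip. -/
theorem anticommutator_Htilde (x : GSym (shift ℬ)) :
    coderivation LB.Q₁ (r.Htilde x) + r.Htilde (coderivation LB.Q₁ x) =
      coderivation (cogen (shift ℬ)) x -
        coderivation ((r.i ∘ₗ r.p) ∘ₗ cogen (shift ℬ)) x := by
  induction x using gsym_induction with
  | one =>
    rw [Htilde_one, coderivation_one LB.Q₁_one, coderivation_one (cogen_one _),
      coderivation_linear_one, map_zero, map_zero, add_zero, sub_zero]
  | add x y hx hy =>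
    simp only [map_add]
    rw [add_add_add_comm, hx, hy]
    abel
  | smul c x hx => simp only [map_smul, ← smul_add, hx, ← smul_sub]
  | gen_mul m v hv x hx =>
    have hdv : LB.d v ∈ shift ℬ (m + 1) := LB.d_degree.shift m v hv
    have hhv : r.h v ∈ shift ℬ (m + -1) := r.h_degree.shift m v hv
    have hs : (-1 : K) ^ (m + -1) = -(-1 : K) ^ m := by
      rw [zpow_add₀ (by simp), zpow_neg, zpow_one, inv_neg_one, mul_neg_one]
    have hip : (r.i ∘ₗ r.p) v = v - (r.h (LB.d v) + LB.d (r.h v)) := by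
      rw [r.homotopy, LinearMap.comp_apply]
      abel
    rw [r.Htilde_gen_mul hv, LB.coderivation_Q₁_gen_mul hv, map_add, map_add, map_neg, map_neg,
      map_smul, map_smul, LB.coderivation_Q₁_gen_mul hhv, LB.coderivation_Q₁_gen_mul hv,
      r.Htilde_gen_mul hdv, r.Htilde_gen_mul hv, number_gen_mul,
      coderivation_even_gen_mul r.ip_degree.shift, hip, hs, zpow_add_one₀ (by simp),
      ← sub_eq_iff_eq_add'.2 hx.symm]
    simp only [map_sub, map_add, sub_mul, add_mul, mul_sub, smul_add, smul_sub, smul_neg,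
      smul_smul, neg_one_zpow_mul_self, one_smul, mul_neg_one, neg_smul]
    abel

theorem Kop_of_mem (n : ℕ) {x : GSym (shift ℬ)} (hx : x ∈ symPow (shift ℬ) n) :
    r.Kop n x = (n.factorial : K)⁻¹ • ∑ j ∈ Finset.range n,
      ((j.factorial * (n - j).factorial : ℕ) / ((n - j : ℕ) : K)) •
        partialPower (r.i ∘ₗ r.p) r.ip_degree.shift j x := by
  rw [Kop, LinearMap.smul_apply, LinearMap.sum_apply]
  congr 1
  refine Finset.sum_congr rfl fun j hj => ?_
  rw [LinearMap.smul_apply, conv_symMap_proj_proj _ (Finset.mem_range.1 hj).le hx]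

theorem conv_mem {f g : GSym (shift ℬ) →ₗ[K] GSym (shift ℬ)} {i j : ℕ}
    (hf : ∀ x, f x ∈ symPow (shift ℬ) i) (hg : ∀ x, g x ∈ symPow (shift ℬ) j)
    (x : GSym (shift ℬ)) : conv f g x ∈ symPow (shift ℬ) (i + j) := by
  rw [conv, LinearMap.comp_apply, LinearMap.comp_apply]
  generalize comul (shift ℬ) x = z
  induction z using TensorProduct.induction_on with
  | zero => simp
  | add y z hy hz =>
    rw [map_add, map_add]
    exact add_mem hy hz
  | tmul a b =>
    rw [TensorProduct.map_tmul, LinearMap.mul'_apply, symPow, pow_add]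
    exact Submodule.mul_mem_mul (hf a) (hg b)

theorem Kop_mem (n : ℕ) (x : GSym (shift ℬ)) : r.Kop n x ∈ symPow (shift ℬ) n := by
  rw [Kop, LinearMap.smul_apply, LinearMap.sum_apply]
  refine Submodule.smul_mem _ _ (Submodule.sum_mem _ fun j hj => ?_)
  rw [LinearMap.smul_apply]
  refine Submodule.smul_mem _ _ ?_
  have h := conv_mem (f := (symMap (r.i ∘ₗ r.p) r.ip_degree.shift).toLinearMap ∘ₗ proj (shift ℬ) j)
    (fun x => symMap_mem_symPow _ _ (proj_mem _ j x)) (proj_mem (shift ℬ) (n - j)) x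
  rwa [Nat.add_sub_cancel' (Finset.mem_range.1 hj).le] at h

theorem Kop_hasDegree (n : ℕ) :
    HasDegree (totalDegree (shift ℬ)) (totalDegree (shift ℬ)) 0 (r.Kop n) := by
  refine HasDegree.smul (HasDegree.sum _ fun j _ => HasDegree.smul ?_ _) _
  have h := conv_hasDegree ((symMap_hasDegree _ r.ip_degree.shift).comp (proj_hasDegree j))
    (proj_hasDegree (𝒱 := shift ℬ) (n - j))
  rwa [add_zero, add_zero] at h

theorem H_hasDegree (n : ℕ) :
    HasDegree (totalDegree (shift ℬ)) (totalDegree (shift ℬ)) (-1) (r.H n) := by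
  have h := (r.Kop_hasDegree n).comp (r.Htilde_hasDegree.comp (proj_hasDegree n))
  rwa [zero_add, add_zero] at h

theorem H_mem (n : ℕ) (x : GSym (shift ℬ)) : r.H n x ∈ symPow (shift ℬ) n :=
  r.Kop_mem n _

theorem H_of_mem_ne {m n : ℕ} (hmn : m ≠ n) {x : GSym (shift ℬ)} (hx : x ∈ symPow (shift ℬ) m) :
    r.H n x = 0 := by
  rw [H, LinearMap.comp_apply, LinearMap.comp_apply, proj_of_mem_ne _ hmn hx, map_zero, map_zero]

theorem H_of_mem {n : ℕ} {x : GSym (shift ℬ)} (hx : x ∈ symPow (shift ℬ) n) :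
    r.H n x = r.Kop n (r.Htilde x) := by
  rw [H, LinearMap.comp_apply, LinearMap.comp_apply, proj_of_mem_self _ hx]

/-- The differential commutes with ip, hence Q₁ with each partial power. -/
theorem Q₁_Kop {n : ℕ} {x : GSym (shift ℬ)} (hx : x ∈ symPow (shift ℬ) n) :
    coderivation LB.Q₁ (r.Kop n x) = r.Kop n (coderivation LB.Q₁ x) := by
  have hd : ∀ v, (-LB.d) ((r.i ∘ₗ r.p) v) = (r.i ∘ₗ r.p) ((-LB.d) v) := fun v => by
    simp only [LinearMap.neg_apply, LinearMap.comp_apply, map_neg, r.p_d, r.i_d]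
  rw [r.Kop_of_mem n hx, r.Kop_of_mem n (LB.coderivation_Q₁_mem hx), map_smul, map_sum]
  congr 1
  refine Finset.sum_congr rfl fun j _ => ?_
  rw [map_smul, LB.Q₁_eq, coderivation_partialPower _ LB.neg_d_hasDegree hd]

theorem Htilde_symMap [DirectSum.Decomposition 𝒜] (x : GSym (shift 𝒜)) :
    r.Htilde (symMap r.i r.i_degree.shift x) = 0 := by
  induction x using gsym_induction with
  | one => rw [map_one, Htilde_one]
  | add x y hx hy => rw [map_add, map_add, hx, hy, add_zero]
  | smul c x hx => rw [map_smul, map_smul, hx, smul_zero]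
  | gen_mul m v hv x hx =>
    have hiv : r.i v ∈ shift ℬ m := by simpa using r.i_degree.shift m v hv
    rw [map_mul, symMap_gen, r.Htilde_gen_mul hiv, hx, r.h_i, map_zero, zero_mul, mul_zero,
      smul_zero, neg_zero, add_zero]

theorem H_symMap [DirectSum.Decomposition 𝒜] (n : ℕ) (x : GSym (shift 𝒜)) : r.H n (symMap r.i r.i_degree.shift x) = 0 := by
  induction x using symPow_induction with
  | mem m x hx =>
    by_cases hmn : m = n
    · subst hmn
      rw [r.H_of_mem (symMap_mem_symPow _ _ hx), Htilde_symMap, map_zero]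
    · exact r.H_of_mem_ne hmn (symMap_mem_symPow _ _ hx)
  | add x y hx hy => rw [map_add, map_add, hx, hy, add_zero]

variable [CharZero K]

/-- On Symⁿ, S_j (N − D) = (n − j) S_j − (j+1) S_{j+1}. The factor 1/(n − j) in Kₙ is what makes the
sum telescope, from S₀ = id to Sₙ = Sym(ip). -/
theorem Kop_number_sub {n : ℕ} (hn : n ≠ 0) {x : GSym (shift ℬ)} (hx : x ∈ symPow (shift ℬ) n) :
    r.Kop n (coderivation (cogen (shift ℬ)) x -
        coderivation ((r.i ∘ₗ r.p) ∘ₗ cogen (shift ℬ)) x) =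
      x - symMap (r.i ∘ₗ r.p) r.ip_degree.shift x := by
  set S := partialPower (r.i ∘ₗ r.p) r.ip_degree.shift with hS
  -- Normalizing S_j by the binomial coefficient turns the j-th summand into u j − u (j + 1).
  set u : ℕ → GSym (shift ℬ) := fun j =>
    (((j.factorial * (n - j).factorial : ℕ) : K) * (n.factorial : K)⁻¹) • S j x with hu
  have hnf : (n.factorial : K) ≠ 0 := Nat.cast_ne_zero.2 n.factorial_ne_zero
  have hmem : coderivation (cogen (shift ℬ)) x -
      coderivation ((r.i ∘ₗ r.p) ∘ₗ cogen (shift ℬ)) x ∈ symPow (shift ℬ) n := by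
    refine sub_mem ?_ (coderivation_linear_mem_symPow r.ip_degree.shift hx)
    rw [number_of_mem hx]
    exact Submodule.smul_mem _ _ hx
  have h0 : u 0 = x := by
    simp only [hu, hS, partialPower_zero]
    rw [Nat.factorial_zero, one_mul, Nat.sub_zero, mul_inv_cancel₀ hnf, one_smul]
  have h1 : u n = symMap (r.i ∘ₗ r.p) r.ip_degree.shift x := by
    simp only [hu, hS, partialPower_of_mem _ hx]
    rw [Nat.sub_self, Nat.factorial_zero, mul_one, mul_inv_cancel₀ hnf, one_smul]
  have ht : x - symMap (r.i ∘ₗ r.p) r.ip_degree.shift x =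
      ∑ j ∈ Finset.range n, (u j - u (j + 1)) := by
    rw [Finset.sum_range_sub', h0, h1]
  rw [ht, r.Kop_of_mem n hmem, Finset.smul_sum]
  refine Finset.sum_congr rfl fun j hj => ?_
  -- This removes truncated subtraction; the coefficient j! (n−j)!/(n−j) becomes j! k!.
  obtain ⟨k, rfl⟩ : ∃ k, n = j + k + 1 := ⟨n - j - 1, by
    have := Finset.mem_range.1 hj
    lia⟩
  have hk : ((k + 1 : ℕ) : K) ≠ 0 := Nat.cast_ne_zero.2 k.succ_ne_zero
  rw [map_sub, number_of_mem hx, map_smul, partialPower_coderivation _ r.ip_ip, ← hS]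
  simp only [hu, show j + k + 1 - j = k + 1 by lia, show j + k + 1 - (j + 1) = k by lia,
    Nat.factorial_succ]
  rw [smul_sub, smul_sub, smul_add, smul_add, smul_smul, smul_smul, smul_smul, smul_smul, smul_smul,
    smul_smul, ← sub_sub, ← sub_smul]
  congr 2
  · push_cast at hk ⊢
    field_simp
    ring
  · push_cast at hk ⊢
    field_simp

/-- The homotopy property of `H`. -/
theorem homotopy_H {n : ℕ} (hn : n ≠ 0) {x : GSym (shift ℬ)} (hx : x ∈ symPow (shift ℬ) n) :
    coderivation LB.Q₁ (r.H n x) + r.H n (coderivation LB.Q₁ x) =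
      x - symMap (r.i ∘ₗ r.p) r.ip_degree.shift x := by
  rw [r.H_of_mem hx, r.H_of_mem (LB.coderivation_Q₁_mem hx), r.Q₁_Kop (r.Htilde_mem hx), ← map_add,
    r.anticommutator_Htilde, r.Kop_number_sub hn hx]

end DeformationRetract

/-! ### Composition and structure maps of coalgebra morphisms -/

section CoalgebraMorphism

variable {K U V W : Type*} [Field K] [AddCommGroup U] [Module K U] [AddCommGroup V] [Module K V]
  [AddCommGroup W] [Module K W] {𝒰 : ℤ → Submodule K U} [DirectSum.Decomposition 𝒰]
  {𝒱 : ℤ → Submodule K V} [DirectSum.Decomposition 𝒱]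
  {𝒲 : ℤ → Submodule K W} [DirectSum.Decomposition 𝒲]

theorem IsCoalgebraMorphism.id (𝒱 : ℤ → Submodule K V) [DirectSum.Decomposition 𝒱] :
    IsCoalgebraMorphism (LinearMap.id : GSym 𝒱 →ₗ[K] GSym 𝒱) where
  comul_comp := by rw [TensorProduct.map_id, LinearMap.id_comp, LinearMap.comp_id]
  counit_comp := LinearMap.comp_id _
  map_one := rfl
  degree := HasDegree.id _

theorem IsCoalgebraMorphism.comp {G : GSym 𝒱 →ₗ[K] GSym 𝒲} {F : GSym 𝒰 →ₗ[K] GSym 𝒱}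
    (hG : IsCoalgebraMorphism G) (hF : IsCoalgebraMorphism F) : IsCoalgebraMorphism (G ∘ₗ F) where
  comul_comp := by
    rw [← LinearMap.comp_assoc, hG.comul_comp, LinearMap.comp_assoc, hF.comul_comp,
      ← LinearMap.comp_assoc, ← TensorProduct.map_comp]
  counit_comp := by rw [← LinearMap.comp_assoc, hG.counit_comp, hF.counit_comp]
  map_one := by rw [LinearMap.comp_apply, hF.map_one, hG.map_one]
  degree := by
    have h := hG.degree.comp hF.degree
    rwa [add_zero] at h

theorem IsCoalgebraMorphism.comul_apply {F : GSym 𝒱 →ₗ[K] GSym 𝒲} (hF : IsCoalgebraMorphism F)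
    (x : GSym 𝒱) : comul 𝒲 (F x) = TensorProduct.map F F (comul 𝒱 x) :=
  LinearMap.congr_fun hF.comul_comp x

theorem IsCoalgebraMorphism.cogen_one {F : GSym 𝒱 →ₗ[K] GSym 𝒲} (hF : IsCoalgebraMorphism F) :
    (cogen 𝒲 ∘ₗ F) 1 = 0 := by
  rw [LinearMap.comp_apply, hF.map_one, GradedCoalg.cogen_one]

theorem taylor_apply {𝒱 : ℤ → Submodule K V} {𝒲 : ℤ → Submodule K W} (F : GSym 𝒱 →ₗ[K] GSym 𝒲) (n : ℕ) (x : GSym 𝒱) :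
    taylor F n x = cogen 𝒲 (F (proj 𝒱 n x)) := by
  rw [taylor, LinearMap.comp_apply, component, LinearMap.comp_apply, cogen_proj_one,
    LinearMap.comp_apply]

theorem linearPart_apply {𝒱 : ℤ → Submodule K V} {𝒲 : ℤ → Submodule K W} (F : GSym 𝒱 →ₗ[K] GSym 𝒲) (v : V) :
    linearPart F v = cogen 𝒲 (F (gen 𝒱 v)) := by
  rw [linearPart, LinearMap.comp_apply, taylor_apply, proj_of_mem_self 𝒱 (gen_mem_symPow 𝒱 v)]

/-- Sym(f) is both multiplicative and comultiplicative, so it passes through the convolution q * id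
as soon as the structure maps are compatible. -/
theorem coderivation_symMap {f : V →ₗ[K] W} (hf : HasDegree 𝒱 𝒲 0 f) {q : GSym 𝒱 →ₗ[K] V}
    {q' : GSym 𝒲 →ₗ[K] W} (h : q' ∘ₗ (symMap f hf).toLinearMap = f ∘ₗ q) :
    coderivation q' ∘ₗ (symMap f hf).toLinearMap =
      (symMap f hf).toLinearMap ∘ₗ coderivation q := by
  have hm : (symMap f hf).toLinearMap ∘ₗ LinearMap.mul' K (GSym 𝒱) ∘ₗ
      TensorProduct.map (gen 𝒱 ∘ₗ q) LinearMap.id = LinearMap.mul' K (GSym 𝒲) ∘ₗ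
        TensorProduct.map (gen 𝒲 ∘ₗ f ∘ₗ q) (symMap f hf).toLinearMap :=
    TensorProduct.ext' fun a b => by simp [symMap_gen]
  rw [coderivation, conv_comp_of_comul (isCoalgebraMorphism_symMap f hf).comul_comp,
    LinearMap.comp_assoc, h, LinearMap.id_comp, conv, ← LinearMap.comp_assoc (comul 𝒱), ← hm]
  rfl

end CoalgebraMorphism

/-! ### The obstruction maps and the recursion -/

section Obstruction

variable {K A B : Type*} [Field K] [AddCommGroup A] [Module K A] [AddCommGroup B] [Module K B]
  {𝒜 : ℤ → Submodule K A} {ℬ : ℤ → Submodule K B}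
  [DirectSum.Decomposition 𝒜] [DirectSum.Decomposition ℬ]

theorem IsCoalgebraMorphism.Q₂_apply {𝒱 : ℤ → Submodule K B} [DirectSum.Decomposition 𝒱]
    (LA : DGLA 𝒜) {F : GSym 𝒱 →ₗ[K] GSym (shift 𝒜)} (hF : IsCoalgebraMorphism F) (x : GSym 𝒱) :
    LA.Q₂ (F x) = (2 : K)⁻¹ • LA.shiftBracket
      (TensorProduct.map (cogen (shift 𝒜) ∘ₗ F) (cogen (shift 𝒜) ∘ₗ F) (comul 𝒱 x)) := by
  rw [DGLA.Q₂_eq, LinearMap.smul_apply, LinearMap.comp_apply, LinearMap.comp_apply, hF.comul_apply,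
    TensorProduct.map_map]

variable (LA : DGLA 𝒜) (LB : DGLA ℬ)

/-- The maps `L_{∞,k+1}` for all `k` together, in terms of the structure maps `f` of a coalgebra
morphism. -/
def obstruction (f : GSym (shift ℬ) →ₗ[K] A) : GSym (shift ℬ) →ₗ[K] A :=
  (2 : K)⁻¹ • (LA.shiftBracket ∘ₗ TensorProduct.map f f ∘ₗ comul (shift ℬ)) -
    f ∘ₗ coderivation LB.Q₂

theorem obstruction_apply (f : GSym (shift ℬ) →ₗ[K] A) (x : GSym (shift ℬ)) :
    obstruction LA LB f x =
      (2 : K)⁻¹ • LA.shiftBracket (TensorProduct.map f f (comul (shift ℬ) x)) -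
        f (coderivation LB.Q₂ x) :=
  rfl

theorem obstruction_hasDegree {f : GSym (shift ℬ) →ₗ[K] A}
    (hf : HasDegree (totalDegree (shift ℬ)) (shift 𝒜) 0 f) :
    HasDegree (totalDegree (shift ℬ)) (shift 𝒜) 1 (obstruction LA LB f) := by
  refine HasDegree.sub (HasDegree.smul ?_ _) ?_
  · rw [← LinearMap.comp_assoc]
    have h : LA.shiftBracket ∘ₗ TensorProduct.map f f = TensorProduct.lift
        (((TensorProduct.mk K A A).compl₁₂ f f).compr₂ LA.shiftBracket) :=
      TensorProduct.ext' fun a b => by simp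
    rw [h]
    exact lift_comul_hasDegree fun i j a ha b hb =>
      LA.shiftBracket_mem (by simpa using hf i a ha) (by simpa using hf j b hb)
  · have h := hf.comp (coderivation_hasDegree LB.Q₂_hasDegree)
    rwa [add_zero] at h

theorem map_eq_zero_of_mem_symPow_zero {ℬ : ℤ → Submodule K B} {f : GSym (shift ℬ) →ₗ[K] A} (hf : f 1 = 0)
    {x : GSym (shift ℬ)} (hx : x ∈ symPow (shift ℬ) 0) : f x = 0 := by
  obtain ⟨c, rfl⟩ := mem_symPow_zero _ hx
  rw [map_smul, hf, smul_zero]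

/-- On `Symᵏ⁺¹` the obstruction depends only on the structure maps up to `k`. -/
theorem obstruction_congr {f g : GSym (shift ℬ) →ₗ[K] A} (hf : f 1 = 0) (hg : g 1 = 0) {k : ℕ}
    (h : ∀ m ≤ k, ∀ x ∈ symPow (shift ℬ) m, f x = g x) {x : GSym (shift ℬ)}
    (hx : x ∈ symPow (shift ℬ) (k + 1)) : obstruction LA LB f x = obstruction LA LB g x := by
  rw [obstruction_apply, obstruction_apply, h k le_rfl _ (LB.coderivation_Q₂_mem hx)]
  congr 3
  refine tensorPow_eq (fun i j hij a ha b hb => ?_) (comul_mem_tensorPow hx)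
  rw [TensorProduct.map_tmul, TensorProduct.map_tmul]
  rcases Nat.eq_zero_or_pos i with rfl | hi
  · rw [map_eq_zero_of_mem_symPow_zero hf ha, map_eq_zero_of_mem_symPow_zero hg ha,
      TensorProduct.zero_tmul, TensorProduct.zero_tmul]
  rcases Nat.eq_zero_or_pos j with rfl | hj
  · rw [map_eq_zero_of_mem_symPow_zero hf hb, map_eq_zero_of_mem_symPow_zero hg hb,
      TensorProduct.tmul_zero, TensorProduct.tmul_zero]
  rw [h i (by lia) a ha, h j (by lia) b hb]

/-- Both projections in the definition are harmless: Q₂ sees only Sym², and on Symᵏ⁺¹ the part of Q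
landing in Symᵏ comes from Q₂ alone, since Q₁ preserves the weight. -/
theorem linfty_apply_of_mem {F : GSym (shift ℬ) →ₗ[K] GSym (shift 𝒜)}
    (hF : IsCoalgebraMorphism F) (k : ℕ) {x : GSym (shift ℬ)}
    (hx : x ∈ symPow (shift ℬ) (k + 1)) :
    linfty LA LB F k x = obstruction LA LB (cogen (shift 𝒜) ∘ₗ F) x := by
  have h2 : ∀ y, LA.Q₂ (proj (shift 𝒜) 2 y) = LA.Q₂ y := by
    intro y
    induction y using symPow_induction with
    | mem n y hy =>
      by_cases hn : n = 2
      · subst hn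
        rw [proj_of_mem_self _ hy]
      · rw [proj_of_mem_ne _ hn hy, map_zero, LA.Q₂_of_mem hn hy]
    | add x y hx hy => rw [map_add, map_add, map_add, hx, hy]
  have hk : proj (shift ℬ) k (LB.Q x) = coderivation LB.Q₂ x := by
    rw [LB.Q_eq, LinearMap.add_apply, map_add,
      proj_of_mem_ne _ (Nat.succ_ne_self k) (LB.coderivation_Q₁_mem hx), zero_add,
      proj_of_mem_self _ (LB.coderivation_Q₂_mem hx)]
  rw [linfty, LinearMap.sub_apply, LinearMap.comp_apply, LinearMap.comp_apply, taylor_apply,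
    component, component, LinearMap.comp_apply, LinearMap.comp_apply, LinearMap.comp_apply,
    LinearMap.comp_apply, proj_of_mem_self _ hx, h2, hk,
    proj_of_mem_self _ (LB.coderivation_Q₂_mem hx), hF.Q₂_apply, obstruction_apply,
    LinearMap.comp_apply]

variable {LA LB} (r : DeformationRetract LA LB)

/-- The conditions on P become conditions on the single map cogen ∘ P, one weight at a time; the
remaining arguments work with this form. -/
theorem isProjection_iff {P : GSym (shift ℬ) →ₗ[K] GSym (shift 𝒜)} (hP : IsCoalgebraMorphism P) :
    IsProjection r P ↔ (∀ v, (cogen (shift 𝒜) ∘ₗ P) (gen (shift ℬ) v) = r.p v) ∧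
      ∀ k, 1 ≤ k → ∀ x ∈ symPow (shift ℬ) (k + 1), (cogen (shift 𝒜) ∘ₗ P) x =
        obstruction LA LB (cogen (shift 𝒜) ∘ₗ P) (r.H (k + 1) x) := by
  constructor
  · intro h
    refine ⟨fun v => ?_, fun k hk x hx => ?_⟩
    · rw [LinearMap.comp_apply, ← linearPart_apply, h.linear]
    · have h1 := LinearMap.congr_fun (h.succ k hk) x
      rwa [taylor_apply, proj_of_mem_self _ hx, LinearMap.comp_apply,
        linfty_apply_of_mem LA LB hP k (r.H_mem _ x)] at h1
  · rintro ⟨h1, h2⟩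
    refine ⟨hP, LinearMap.ext fun v => ?_, fun k hk => symPow_linearMap_ext fun m x hx => ?_⟩
    · rw [linearPart_apply, ← LinearMap.comp_apply, h1]
    · rw [taylor_apply, LinearMap.comp_apply, linfty_apply_of_mem LA LB hP k (r.H_mem _ x)]
      by_cases hm : m = k + 1
      · subst hm
        rw [proj_of_mem_self _ hx, ← LinearMap.comp_apply, h2 k hk x hx]
      · rw [proj_of_mem_ne _ hm hx, r.H_of_mem_ne hm hx, map_zero, map_zero, map_zero]

/-! ### The inclusion -/

theorem IsDGLAMorphism.Q₁_symMap {ℬ : ℤ → Submodule K B} {LB : DGLA ℬ} {f : A →ₗ[K] B} (hf : IsDGLAMorphism LA LB f) :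
    LB.Q₁ ∘ₗ (symMap f hf.degree.shift).toLinearMap = f ∘ₗ LA.Q₁ := by
  rw [LB.Q₁_eq, LinearMap.comp_assoc, cogen_comp_symMap, LA.Q₁_eq, ← LinearMap.comp_assoc,
    ← LinearMap.comp_assoc]
  congr 1
  exact LinearMap.ext fun x => by simp [hf.map_d]

theorem IsDGLAMorphism.Q₂_symMap {f : A →ₗ[K] B} (hf : IsDGLAMorphism LA LB f) :
    LB.Q₂ ∘ₗ (symMap f hf.degree.shift).toLinearMap = f ∘ₗ LA.Q₂ := by
  refine LinearMap.ext fun x => ?_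
  have hb : LB.shiftBracket ∘ₗ TensorProduct.map f f = f ∘ₗ LA.shiftBracket := by
    refine TensorProduct.ext' fun a b => ?_
    induction a using DirectSum.Decomposition.inductionOn (shift 𝒜) with
    | zero => simp
    | @homogeneous m a =>
      have hfa : f a ∈ shift ℬ m := by simpa using hf.degree.shift m a a.2
      rw [LinearMap.comp_apply, LinearMap.comp_apply, TensorProduct.map_tmul,
        LB.shiftBracket_tmul hfa, LA.shiftBracket_tmul a.2, map_neg, map_smul, hf.map_bracket]
    | add a a' ha ha' => rw [TensorProduct.add_tmul, map_add, map_add, ha, ha']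
  rw [LinearMap.comp_apply, (isCoalgebraMorphism_symMap f hf.degree.shift).Q₂_apply,
    cogen_comp_symMap, TensorProduct.map_comp, LinearMap.comp_apply,
    ← LinearMap.comp_apply LB.shiftBracket, hb, DGLA.Q₂_eq, LinearMap.comp_apply,
    LinearMap.comp_apply, LinearMap.smul_apply, map_smul]
  rfl

theorem IsDGLAMorphism.isLInfinityMorphism {f : A →ₗ[K] B} (hf : IsDGLAMorphism LA LB f) :
    IsLInfinityMorphism LA.Q LB.Q (symMap f hf.degree.shift).toLinearMap where
  coalgebraMorphism := isCoalgebraMorphism_symMap f _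
  comm := by
    refine (coderivation_symMap _ ?_).symm
    rw [LinearMap.add_comp, hf.Q₁_symMap, hf.Q₂_symMap, LinearMap.comp_add]

/-! ### Existence and uniqueness -/

/-- The structure maps of the projection up to order `k`. -/
def structureMaps : ℕ → GSym (shift ℬ) →ₗ[K] A
  | 0 => 0
  | 1 => r.p ∘ₗ cogen (shift ℬ)
  | k + 2 => structureMaps (k + 1) + obstruction LA LB (structureMaps (k + 1)) ∘ₗ r.H (k + 2)

theorem structureMaps_hasDegree (k : ℕ) :
    HasDegree (totalDegree (shift ℬ)) (shift 𝒜) 0 (structureMaps r k) := by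
  induction k using Nat.strong_induction_on with
  | _ k ih =>
    match k with
    | 0 => exact fun n x _ => zero_mem _
    | 1 =>
      have h := r.p_degree.shift.comp (cogen_hasDegree (𝒱 := shift ℬ))
      rwa [add_zero] at h
    | k + 2 =>
      refine (ih (k + 1) (by lia)).add ?_
      exact (obstruction_hasDegree LA LB (ih (k + 1) (by lia))).comp (r.H_hasDegree (k + 2))

/-- Each correction is supported in its own weight because `H` is extended by zero. -/
theorem structureMaps_of_gt {k m : ℕ} (hm : k < m) {x : GSym (shift ℬ)}
    (hx : x ∈ symPow (shift ℬ) m) : structureMaps r k x = 0 := by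
  induction k using Nat.strong_induction_on with
  | _ k ih =>
    match k with
    | 0 => rfl
    | 1 => rw [structureMaps, LinearMap.comp_apply, cogen_of_mem _ hm.ne' hx, map_zero]
    | k + 2 =>
      rw [structureMaps, LinearMap.add_apply, ih (k + 1) (by lia) (by lia), LinearMap.comp_apply,
        r.H_of_mem_ne hm.ne' hx, map_zero, add_zero]

theorem structureMaps_of_le {k m : ℕ} (hm : m ≤ k) {x : GSym (shift ℬ)}
    (hx : x ∈ symPow (shift ℬ) m) : structureMaps r k x = structureMaps r m x := by
  induction k, hm using Nat.le_induction with
  | base => rfl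
  | succ k hm ih =>
    rw [← ih]
    match k with
    | 0 =>
      rw [structureMaps, structureMaps, LinearMap.comp_apply, cogen_of_mem _ (by lia) hx, map_zero,
        LinearMap.zero_apply]
    | k + 1 =>
      rw [structureMaps, LinearMap.add_apply, LinearMap.comp_apply, r.H_of_mem_ne (by lia) hx,
        map_zero, add_zero]

variable [CharZero K]

theorem exists_isProjection : ∃ P, IsProjection r P := by
  set f := assemble (shift ℬ) (structureMaps r) with hf
  have hfm : ∀ k, ∀ m ≤ k, ∀ x ∈ symPow (shift ℬ) m, structureMaps r k x = f x :=
    fun k m hm x hx => by rw [hf, assemble_of_mem _ hx, structureMaps_of_le r hm hx]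
  have hf1 : f 1 = 0 := by
    rw [hf, assemble_of_mem _ (one_mem_symPow _), structureMaps, LinearMap.zero_apply]
  have hdeg : HasDegree (totalDegree (shift ℬ)) (shift 𝒜) 0 f :=
    assemble_hasDegree (structureMaps_hasDegree r)
  refine ⟨coexp (shift 𝒜) f, (isProjection_iff r (isCoalgebraMorphism_coexp hdeg hf1)).2 ?_⟩
  rw [cogen_coexp hf1]
  refine ⟨fun v => ?_, fun k hk x hx => ?_⟩
  · rw [hf, assemble_of_mem _ (gen_mem_symPow _ v), structureMaps, LinearMap.comp_apply, cogen_gen]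
  · obtain ⟨k, rfl⟩ := Nat.exists_eq_add_of_le' hk
    have hk1 : structureMaps r (k + 1) 1 = 0 := by
      rw [hfm (k + 1) 0 (by lia) 1 (one_mem_symPow _), hf1]
    -- In weight k + 2 the obstruction sees only weights up to k + 1, where stage k + 1 agrees with
    -- f. That stage vanishes in weight k + 2 itself, so only the new correction remains.
    rw [← obstruction_congr LA LB hk1 hf1 (hfm (k + 1)) (r.H_mem _ x), hf, assemble_of_mem _ hx,
      structureMaps, LinearMap.add_apply, structureMaps_of_gt r (Nat.lt_succ_self _) hx, zero_add,
      LinearMap.comp_apply]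

/-- Equality may be tested on cogenerators, where the recursion fixes weight k + 2 from the lower
weights. -/
theorem IsProjection.unique {P P' : GSym (shift ℬ) →ₗ[K] GSym (shift 𝒜)} (hP : IsProjection r P)
    (hP' : IsProjection r P') : P = P' := by
  refine hP.coalgebraMorphism.ext_cogen hP'.coalgebraMorphism (symPow_linearMap_ext fun m => ?_)
  obtain ⟨h1, h2⟩ := (isProjection_iff r hP.coalgebraMorphism).1 hP
  obtain ⟨h1', h2'⟩ := (isProjection_iff r hP'.coalgebraMorphism).1 hP'
  have h0 := hP.coalgebraMorphism.cogen_one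
  have h0' := hP'.coalgebraMorphism.cogen_one
  induction m using Nat.strong_induction_on with
  | _ m ih =>
    intro x hx
    match m with
    | 0 => rw [map_eq_zero_of_mem_symPow_zero h0 hx, map_eq_zero_of_mem_symPow_zero h0' hx]
    | 1 =>
      obtain ⟨v, rfl⟩ := mem_symPow_one _ hx
      rw [h1, h1']
    | k + 2 =>
      rw [h2 (k + 1) (by lia) x hx, h2' (k + 1) (by lia) x hx]
      exact obstruction_congr LA LB h0 h0' (fun n hn => ih n (by lia)) (r.H_mem _ x)

end Obstruction

/-! ### The linear parts in cohomology -/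

section Cohomology

variable {K A B : Type*} [Field K] [AddCommGroup A] [Module K A] [AddCommGroup B] [Module K B]
  {𝒜 : ℤ → Submodule K A} {ℬ : ℤ → Submodule K B} {LA : DGLA 𝒜} {LB : DGLA ℬ}

theorem linearPart_symMap {𝒱 : ℤ → Submodule K A} {𝒲 : ℤ → Submodule K B} (f : A →ₗ[K] B)
    (hf : HasDegree 𝒱 𝒲 0 f) : linearPart (symMap f hf).toLinearMap = f := by
  refine LinearMap.ext fun v => ?_
  rw [linearPart_apply, AlgHom.toLinearMap_apply, symMap_gen, cogen_gen]

namespace DeformationRetract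

variable (r : DeformationRetract LA LB)

theorem isCochainMap_p : IsCochainMap (shift ℬ) (shift 𝒜) (-LB.d) (-LA.d) r.p where
  degree := r.p_degree.shift
  comm := LinearMap.ext fun x => by simp [r.p_d]

theorem isCochainMap_i : IsCochainMap (shift 𝒜) (shift ℬ) (-LA.d) (-LB.d) r.i where
  degree := r.i_degree.shift
  comm := LinearMap.ext fun x => by simp [r.i_d]

theorem cohomologyMap_p_i (n : ℤ) :
    cohomologyMap r.isCochainMap_p n ∘ₗ cohomologyMap r.isCochainMap_i n = LinearMap.id := by
  refine LinearMap.ext fun c => ?_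
  obtain ⟨⟨x, hx⟩, rfl⟩ := Submodule.Quotient.mk_surjective _ c
  change Submodule.Quotient.mk _ = Submodule.Quotient.mk _
  congr 1
  exact Subtype.ext (r.p_i x)

/-- On a cocycle the homotopy relation reads d h x = x − i p x, so ip x − x is the coboundary of h x
for −d. -/
theorem cohomologyMap_i_p (n : ℤ) :
    cohomologyMap r.isCochainMap_i n ∘ₗ cohomologyMap r.isCochainMap_p n = LinearMap.id := by
  refine LinearMap.ext fun c => ?_
  obtain ⟨⟨x, hx⟩, rfl⟩ := Submodule.Quotient.mk_surjective _ c
  refine (Submodule.Quotient.eq _).2 ?_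
  change r.i (r.p x) - x ∈ coboundaries (shift ℬ) (-LB.d) n
  refine ⟨r.h x, ?_, ?_⟩
  · exact r.h_degree.shift n x hx.2
  · have hd : LB.d x = 0 := by simpa using LinearMap.mem_ker.1 hx.1
    have h := r.homotopy x
    rw [hd, map_zero, zero_add] at h
    rw [LinearMap.neg_apply, h, neg_sub]

theorem isQuasiIsomorphism_p :
    IsQuasiIsomorphism (shift ℬ) (shift 𝒜) (-LB.d) (-LA.d) r.p :=
  ⟨r.isCochainMap_p, fun n => Function.bijective_iff_has_inverse.2
    ⟨cohomologyMap r.isCochainMap_i n, LinearMap.congr_fun (r.cohomologyMap_i_p n),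
      LinearMap.congr_fun (r.cohomologyMap_p_i n)⟩⟩

theorem isQuasiIsomorphism_i :
    IsQuasiIsomorphism (shift 𝒜) (shift ℬ) (-LA.d) (-LB.d) r.i :=
  ⟨r.isCochainMap_i, fun n => Function.bijective_iff_has_inverse.2
    ⟨cohomologyMap r.isCochainMap_p n, LinearMap.congr_fun (r.cohomologyMap_p_i n),
      LinearMap.congr_fun (r.cohomologyMap_i_p n)⟩⟩

end DeformationRetract

end Cohomology

/-! ### The linear part of Q and the cogenerator part of Q_A P − P Q_B -/

section Linear

variable {K A B : Type*} [Field K] [AddCommGroup A] [Module K A] [AddCommGroup B] [Module K B]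
  {𝒜 : ℤ → Submodule K A} {ℬ : ℤ → Submodule K B}
  [DirectSum.Decomposition 𝒜] [DirectSum.Decomposition ℬ]
  {LA : DGLA 𝒜} {LB : DGLA ℬ} {P : GSym (shift ℬ) →ₗ[K] GSym (shift 𝒜)}

theorem DGLA.linearPart_Q (L : DGLA 𝒜) : linearPart L.Q = -L.d := by
  refine LinearMap.ext fun v => ?_
  rw [linearPart_apply, DGLA.Q, cogen_coderivation, LinearMap.add_apply, L.Q₁_gen,
    L.Q₂_of_mem (by decide) (gen_mem_symPow _ v), add_zero, LinearMap.neg_apply]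

/-- All contributions of Q₂ are collected in the obstruction, so only Q₁ on either side of f
remains. -/
theorem cogen_sub (hP : IsCoalgebraMorphism P) (x : GSym (shift ℬ)) :
    cogen (shift 𝒜) ((LA.Q ∘ₗ P - P ∘ₗ LB.Q) x) =
      -LA.d ((cogen (shift 𝒜) ∘ₗ P) x) + obstruction LA LB (cogen (shift 𝒜) ∘ₗ P) x -
        (cogen (shift 𝒜) ∘ₗ P) (coderivation LB.Q₁ x) := by
  rw [LinearMap.sub_apply, map_sub, LinearMap.comp_apply, LinearMap.comp_apply, DGLA.Q,
    cogen_coderivation, LB.Q_eq, LinearMap.add_apply, LinearMap.add_apply, hP.Q₂_apply, map_add,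
    map_add, obstruction_apply, DGLA.Q₁, LinearMap.neg_apply, LinearMap.comp_apply]
  simp only [LinearMap.comp_apply]
  abel

theorem DeformationRetract.isLInfinityQuasiIso_symMap {r : DeformationRetract LA LB}
    (hi : IsDGLAMorphism LA LB r.i) :
    IsLInfinityQuasiIso LA.Q LB.Q (symMap r.i r.i_degree.shift).toLinearMap where
  morphism := hi.isLInfinityMorphism
  quasiIso := by
    rw [linearPart_symMap, LA.linearPart_Q, LB.linearPart_Q]
    exact r.isQuasiIsomorphism_i

end Linear

section Main

variable {K A B : Type*} [Field K] [CharZero K] [AddCommGroup A] [Module K A] [AddCommGroup B]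
  [Module K B] {𝒜 : ℤ → Submodule K A} {ℬ : ℤ → Submodule K B}
  [DirectSum.Decomposition 𝒜] [DirectSum.Decomposition ℬ]
  {LA : DGLA 𝒜} {LB : DGLA ℬ} {r : DeformationRetract LA LB}
  {P : GSym (shift ℬ) →ₗ[K] GSym (shift 𝒜)}

/-! ### `P ∘ Sym(i) = id` -/

/-- Since h i = 0, each H kills the image of Sym(i), so the recursion leaves no component of weight
at least two; in weight one, p i = id. -/
theorem IsProjection.comp_symMap (hP : IsProjection r P) :
    P ∘ₗ (symMap r.i r.i_degree.shift).toLinearMap = LinearMap.id := by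
  obtain ⟨h1, h2⟩ := (isProjection_iff r hP.coalgebraMorphism).1 hP
  refine (hP.coalgebraMorphism.comp (isCoalgebraMorphism_symMap r.i r.i_degree.shift)).ext_cogen
    (IsCoalgebraMorphism.id _) (symPow_linearMap_ext fun m x hx => ?_)
  have hix := symMap_mem_symPow r.i r.i_degree.shift hx
  rw [LinearMap.comp_id, ← LinearMap.comp_assoc, LinearMap.comp_apply, AlgHom.toLinearMap_apply]
  match m with
  | 0 =>
    rw [map_eq_zero_of_mem_symPow_zero hP.coalgebraMorphism.cogen_one hix,
      cogen_of_mem _ (by decide) hx]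
  | 1 =>
    obtain ⟨v, rfl⟩ := mem_symPow_one _ hx
    rw [symMap_gen, h1, r.p_i, cogen_gen]
  | k + 2 =>
    rw [h2 (k + 1) (by lia) _ hix, r.H_symMap, map_zero, cogen_of_mem _ (by lia) hx]

/-- As P Sym(i) = id, the bracket term becomes Q₂ of A. As i respects brackets, Q₂ of B moves past
Sym(i) and the other term becomes the same. -/
theorem IsProjection.obstruction_symMap (hP : IsProjection r P) (hi : IsDGLAMorphism LA LB r.i)
    (x : GSym (shift 𝒜)) :
    obstruction LA LB (cogen (shift 𝒜) ∘ₗ P) (symMap r.i r.i_degree.shift x) = 0 := by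
  have hc := isCoalgebraMorphism_symMap r.i r.i_degree.shift
  have hQ := LinearMap.congr_fun (coderivation_symMap r.i_degree.shift hi.Q₂_symMap) x
  have hPi := hP.comp_symMap
  have hx := hc.comul_apply x
  rw [LinearMap.comp_apply, LinearMap.comp_apply] at hQ
  rw [AlgHom.toLinearMap_apply] at hQ hx
  have hPx := LinearMap.congr_fun hPi (coderivation LA.Q₂ x)
  rw [LinearMap.comp_apply, LinearMap.id_apply] at hPx
  rw [obstruction_apply, hQ, LinearMap.comp_apply, hPx, cogen_coderivation, hx,
    TensorProduct.map_map, LinearMap.comp_assoc, hPi, LinearMap.comp_id]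
  exact sub_self _

/-- Sym(ip) factors through Sym(i). This disposes of the defect term in the homotopy formula. -/
theorem IsProjection.obstruction_symMap_ip (hP : IsProjection r P)
    (hi : IsDGLAMorphism LA LB r.i) (x : GSym (shift ℬ)) :
    obstruction LA LB (cogen (shift 𝒜) ∘ₗ P) (symMap (r.i ∘ₗ r.p) r.ip_degree.shift x) = 0 := by
  have h : symMap (r.i ∘ₗ r.p) r.ip_degree.shift =
      (symMap r.i r.i_degree.shift).comp (symMap r.p r.p_degree.shift) :=
    gsym_hom_ext fun v => by rw [AlgHom.comp_apply, symMap_gen, symMap_gen, symMap_gen]; rfl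
  rw [h, AlgHom.comp_apply, hP.obstruction_symMap hi]

/-! ### `P` commutes with the codifferentials -/

/-- Q_A P and P Q_B are both odd coderivations along P, with the same signs, and this property is
linear. -/
theorem IsCoalgebraMorphism.comul_sub (hP : IsCoalgebraMorphism P) :
    comul (shift 𝒜) ∘ₗ (LA.Q ∘ₗ P - P ∘ₗ LB.Q) =
      TensorProduct.map (LA.Q ∘ₗ P - P ∘ₗ LB.Q) P ∘ₗ comul (shift ℬ) +
      TensorProduct.map (P ∘ₗ (twist (shift ℬ) 1).toLinearMap) (LA.Q ∘ₗ P - P ∘ₗ LB.Q) ∘ₗ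
        comul (shift ℬ) := by
  have ht : (twist (shift 𝒜) 1).toLinearMap ∘ₗ P = P ∘ₗ (twist (shift ℬ) 1).toLinearMap := by
    refine LinearMap.ext fun x => ?_
    have h := hP.degree.twist_comm 1 x
    rwa [mul_zero, zpow_zero, one_smul] at h
  have h1 : ∀ E E' : GSym (shift ℬ) →ₗ[K] GSym (shift 𝒜),
      TensorProduct.map (E - E') P = TensorProduct.map E P - TensorProduct.map E' P :=
    fun E E' => TensorProduct.ext' fun a b => by simp [TensorProduct.sub_tmul]
  have h2 : ∀ F E E' : GSym (shift ℬ) →ₗ[K] GSym (shift 𝒜),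
      TensorProduct.map F (E - E') = TensorProduct.map F E - TensorProduct.map F E' :=
    fun F E E' => TensorProduct.ext' fun a b => by simp [TensorProduct.tmul_sub]
  have hA : comul (shift 𝒜) ∘ₗ LA.Q ∘ₗ P =
      TensorProduct.map (LA.Q ∘ₗ P) P ∘ₗ comul (shift ℬ) +
      TensorProduct.map (P ∘ₗ (twist (shift ℬ) 1).toLinearMap) (LA.Q ∘ₗ P) ∘ₗ
        comul (shift ℬ) := by
    rw [← LinearMap.comp_assoc, LA.comul_Q, LinearMap.add_comp, LinearMap.comp_assoc,
      LinearMap.comp_assoc, hP.comul_comp, ← LinearMap.comp_assoc, ← LinearMap.comp_assoc,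
      ← TensorProduct.map_comp, ← TensorProduct.map_comp, ht, LinearMap.id_comp]
  have hB : comul (shift 𝒜) ∘ₗ P ∘ₗ LB.Q =
      TensorProduct.map (P ∘ₗ LB.Q) P ∘ₗ comul (shift ℬ) +
      TensorProduct.map (P ∘ₗ (twist (shift ℬ) 1).toLinearMap) (P ∘ₗ LB.Q) ∘ₗ
        comul (shift ℬ) := by
    rw [← LinearMap.comp_assoc, hP.comul_comp, LinearMap.comp_assoc, LB.comul_Q,
      LinearMap.comp_add, ← LinearMap.comp_assoc, ← LinearMap.comp_assoc,
      ← TensorProduct.map_comp, ← TensorProduct.map_comp, LinearMap.comp_id]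
  rw [LinearMap.comp_sub, hA, hB, h1, h2, LinearMap.sub_comp, LinearMap.sub_comp]
  abel

/-- The relation `Q¹₁ e + e Q¹₁ = 0` for the lowest component of a `P`-coderivation which commutes
with the codifferentials. -/
theorem d_cogen_sub (hP : IsCoalgebraMorphism P) {k : ℕ}
    (ih : ∀ m ≤ k, ∀ x ∈ symPow (shift ℬ) m,
      cogen (shift 𝒜) ((LA.Q ∘ₗ P - P ∘ₗ LB.Q) x) = 0)
    {y : GSym (shift ℬ)} (hy : y ∈ symPow (shift ℬ) (k + 1)) :
    -LA.d (cogen (shift 𝒜) ((LA.Q ∘ₗ P - P ∘ₗ LB.Q) y)) +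
      cogen (shift 𝒜) ((LA.Q ∘ₗ P - P ∘ₗ LB.Q) (coderivation LB.Q₁ y)) = 0 := by
  have hf1 := hP.cogen_one
  -- Expanding leaves Q_A² P and P Q_B², which vanish, and two copies of Q_A P Q_B with opposite
  -- signs.
  have hcomm : LA.Q ((LA.Q ∘ₗ P - P ∘ₗ LB.Q) y) + (LA.Q ∘ₗ P - P ∘ₗ LB.Q) (LB.Q y) = 0 := by
    have hA := LinearMap.congr_fun LA.Q_comp_Q (P y)
    have hB := LinearMap.congr_fun LB.Q_comp_Q y
    rw [LinearMap.comp_apply, LinearMap.zero_apply] at hA hB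
    simp only [LinearMap.sub_apply, LinearMap.comp_apply, map_sub, hA, hB, map_zero]
    abel
  set E := LA.Q ∘ₗ P - P ∘ₗ LB.Q with hE
  -- The bracket pairs the cogenerator part of E on one block with that of P on the other. Either
  -- the block under E has weight at most k and `ih` applies, or the block under P is constant.
  have h2 : LA.Q₂ (E y) = 0 := by
    have hc := LinearMap.congr_fun (hP.comul_sub (LA := LA) (LB := LB)) y
    rw [LinearMap.comp_apply, ← hE] at hc
    rw [DGLA.Q₂_eq, LinearMap.smul_apply, LinearMap.comp_apply, LinearMap.comp_apply, hc,
      LinearMap.add_apply, LinearMap.comp_apply, LinearMap.comp_apply, map_add,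
      TensorProduct.map_map, TensorProduct.map_map]
    rw [tensorPow_le_ker (fun i j hij a ha b hb => ?_) (comul_mem_tensorPow hy),
      tensorPow_le_ker (fun i j hij a ha b hb => ?_) (comul_mem_tensorPow hy), add_zero, map_zero,
      smul_zero]
    · rw [TensorProduct.map_tmul]
      rcases Nat.eq_zero_or_pos i with rfl | hi
      · rw [← LinearMap.comp_assoc, LinearMap.comp_apply, AlgHom.toLinearMap_apply,
          map_eq_zero_of_mem_symPow_zero hf1 (twist_mem_symPow _ 1 ha), TensorProduct.zero_tmul]
      · rw [LinearMap.comp_apply _ E, ih j (by lia) b hb, TensorProduct.tmul_zero]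
    · rw [TensorProduct.map_tmul]
      rcases Nat.eq_zero_or_pos j with rfl | hj
      · rw [map_eq_zero_of_mem_symPow_zero hf1 hb, TensorProduct.tmul_zero]
      · rw [LinearMap.comp_apply, ih i (by lia) a ha, TensorProduct.zero_tmul]
  have h := congrArg (cogen (shift 𝒜)) hcomm
  rw [map_add, map_zero, DGLA.Q, cogen_coderivation, LinearMap.add_apply, h2, LB.Q_eq,
    LinearMap.add_apply, map_add, map_add, ih k le_rfl _ (LB.coderivation_Q₂_mem hy), add_zero,
    add_zero, DGLA.Q₁, LinearMap.neg_apply, LinearMap.comp_apply] at h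
  exact h

/-- Write f = cogen ∘ P and y = Hx. The recursion and the homotopy formula reduce the claim to −d
obs(y) + obs(Q₁ y) = 0, where obs is taken of f. The relation `d_cogen_sub` at y is this identity:
there d² = 0, Q₁² = 0 and the terms d f(Q₁ y) cancel. -/
theorem IsProjection.cogen_sub_eq_zero (hP : IsProjection r P) (hi : IsDGLAMorphism LA LB r.i)
    (m : ℕ) : ∀ x ∈ symPow (shift ℬ) m, cogen (shift 𝒜) ((LA.Q ∘ₗ P - P ∘ₗ LB.Q) x) = 0 := by
  have hPc := hP.coalgebraMorphism
  have hf1 := hPc.cogen_one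
  obtain ⟨h1, h2⟩ := (isProjection_iff r hPc).1 hP
  induction m using Nat.strong_induction_on with
  | _ m ih =>
    intro x hx
    match m with
    | 0 =>
      obtain ⟨c, rfl⟩ := mem_symPow_zero _ hx
      rw [map_smul, map_smul, LinearMap.sub_apply, LinearMap.comp_apply, LinearMap.comp_apply,
        hPc.map_one, LA.Q_one, LB.Q_one, map_zero, sub_zero, map_zero, smul_zero]
    | 1 =>
      -- In weight one the obstruction involves only the constant part of f, which is zero, so f may
      -- be replaced by the zero map.
      have ho : obstruction LA LB (cogen (shift 𝒜) ∘ₗ P) x = 0 := by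
        have h0 : obstruction LA LB (0 : GSym (shift ℬ) →ₗ[K] A) x = 0 := by
          rw [obstruction_apply, TensorProduct.map_zero_left]
          simp
        rw [← h0]
        refine obstruction_congr LA LB hf1 rfl (k := 0) (fun n hn z hz => ?_) hx
        obtain rfl : n = 0 := by lia
        rw [map_eq_zero_of_mem_symPow_zero hf1 hz, LinearMap.zero_apply]
      obtain ⟨v, rfl⟩ := mem_symPow_one _ hx
      have hd : coderivation LB.Q₁ (gen (shift ℬ) v) = gen (shift ℬ) (-LB.d v) := by
        obtain ⟨w, hw⟩ := mem_symPow_one _ (LB.coderivation_Q₁_mem (gen_mem_symPow _ v))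
        have hcw := congrArg (cogen (shift ℬ)) hw
        rw [cogen_coderivation, cogen_gen, LB.Q₁_gen] at hcw
        rw [hw, hcw]
      rw [cogen_sub hPc, ho, hd, h1, h1, map_neg, r.p_d]
      abel
    | k + 2 =>
      set f := cogen (shift 𝒜) ∘ₗ P with hf
      set y := r.H (k + 2) x with hy
      have hym : y ∈ symPow (shift ℬ) (k + 1 + 1) := r.H_mem _ x
      have hfx : f x = obstruction LA LB f y := h2 (k + 1) (by lia) x hx
      -- The recursion at Q₁ x involves H Q₁ x = x − Sym(ip) x − Q₁ H x, and the obstruction kills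
      -- the middle term.
      have hfQ : f (coderivation LB.Q₁ x) =
          obstruction LA LB f x - obstruction LA LB f (coderivation LB.Q₁ y) := by
        have hh := r.homotopy_H (by lia) hx
        rw [h2 (k + 1) (by lia) _ (LB.coderivation_Q₁_mem hx),
          eq_sub_of_add_eq' hh, map_sub, map_sub, hP.obstruction_symMap_ip hi, sub_zero]
      have hrel := d_cogen_sub hPc (fun n hn => ih n (by lia)) hym
      rw [cogen_sub hPc, cogen_sub hPc, ← hf, LB.coderivation_Q₁_coderivation_Q₁] at hrel
      simp only [map_sub, map_add, map_neg, LA.d_d, map_zero] at hrel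
      rw [cogen_sub hPc, ← hf, hfx, hfQ, ← hrel]
      abel

theorem IsProjection.isLInfinityMorphism (hP : IsProjection r P) (hi : IsDGLAMorphism LA LB r.i) :
    IsLInfinityMorphism LB.Q LA.Q P where
  coalgebraMorphism := hP.coalgebraMorphism
  comm := by
    have hPc := hP.coalgebraMorphism
    have he : cogen (shift 𝒜) ∘ₗ (LA.Q ∘ₗ P - P ∘ₗ LB.Q) = 0 :=
      symPow_linearMap_ext fun m x hx => hP.cogen_sub_eq_zero hi m x hx
    have hE : LA.Q ∘ₗ P - P ∘ₗ LB.Q = 0 := by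
      -- Here f is cogen ∘ P with the sign of an odd operator passing the left factor. The other
      -- convolution term contains the cogenerator part of the defect, already known to vanish.
      refine eq_zero_of_number
        (f := cogen (shift 𝒜) ∘ₗ P ∘ₗ (twist (shift ℬ) 1).toLinearMap) ?_ ?_
      · have h0 : conv (gen (shift 𝒜) ∘ₗ cogen (shift 𝒜) ∘ₗ (LA.Q ∘ₗ P - P ∘ₗ LB.Q)) P = 0 := by
          rw [he, LinearMap.comp_zero, conv, TensorProduct.map_zero_left, LinearMap.zero_comp,
            LinearMap.comp_zero]
        conv_lhs => rw [coderivation]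
        rw [conv_comp_of_comul_add hPc.comul_sub, LinearMap.comp_assoc, LinearMap.comp_assoc,
          LinearMap.id_comp, LinearMap.id_comp, h0, zero_add]
      · refine LinearMap.ext fun x => ?_
        have hc := LinearMap.congr_fun hPc.counit_comp (LB.Q x)
        rw [LinearMap.comp_apply] at hc
        rw [LinearMap.comp_apply, LinearMap.sub_apply, map_sub, LinearMap.comp_apply,
          LinearMap.comp_apply, hc, DGLA.Q, DGLA.Q, counit_coderivation, counit_coderivation,
          sub_zero, LinearMap.zero_apply]
    exact (sub_eq_zero.1 hE).symm

theorem IsProjection.isLInfinityQuasiIso (hP : IsProjection r P)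
    (hi : IsDGLAMorphism LA LB r.i) : IsLInfinityQuasiIso LB.Q LA.Q P where
  morphism := hP.isLInfinityMorphism hi
  quasiIso := by
    rw [hP.linear, LA.linearPart_Q, LB.linearPart_Q]
    exact r.isQuasiIsomorphism_p

theorem IsProjection.areLInfinityQuasiInverse (hP : IsProjection r P)
    (hi : IsDGLAMorphism LA LB r.i) :
    AreLInfinityQuasiInverse LB.Q LA.Q P (symMap r.i r.i_degree.shift).toLinearMap where
  left := hP.isLInfinityQuasiIso hi
  right := DeformationRetract.isLInfinityQuasiIso_symMap hi
  inverse := by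
    rw [hP.linear, linearPart_symMap, LA.linearPart_Q, LB.linearPart_Q]
    exact fun _ _ n => ⟨r.cohomologyMap_i_p n, r.cohomologyMap_p_i n⟩

end Main
end GradedCoalg
theorem mainTheorem3 {K A B : Type*} [Field K] [CharZero K]
    [AddCommGroup A] [Module K A] [AddCommGroup B] [Module K B]
    (𝒜 : ℤ → Submodule K A) [DirectSum.Decomposition 𝒜]
    (ℬ : ℤ → Submodule K B) [DirectSum.Decomposition ℬ]
    (LA : DGLA 𝒜) (LB : DGLA ℬ) (r : DeformationRetract LA LB)
    (hi : IsDGLAMorphism LA LB r.i) :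
    (∃! P : GSym (shift ℬ) →ₗ[K] GSym (shift 𝒜), IsProjection r P) ∧
      ∀ P : GSym (shift ℬ) →ₗ[K] GSym (shift 𝒜), IsProjection r P →
        IsLInfinityQuasiIso LB.Q LA.Q P ∧
        AreLInfinityQuasiInverse LB.Q LA.Q P (symMap r.i r.i_degree.shift).toLinearMap ∧
        P ∘ₗ (symMap r.i r.i_degree.shift).toLinearMap = LinearMap.id := by
  obtain ⟨P, hP⟩ := exists_isProjection r
  exact ⟨⟨P, hP, fun P' hP' => hP'.unique r hP⟩, fun P hP =>
    ⟨hP.isLInfinityQuasiIso hi, hP.areLInfinityQuasiInverse hi, hP.comp_symMap⟩⟩
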